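/- Let $n\ge 2$, let $\eta=\mathrm{diag}(-1,1,\dots,1)$ be the Minkowski metric on $\mathbb R^{n+1}$, and let $g$ be a smooth Lorentzian metric defined in a neighbourhood of the origin $O$ of $\mathbb R^{n+1}$, with coordinates $x=(x^\mu)$, such that near $O$ the light-cone $C_O$ of $O$ (the union of the null $g$-geodesics through $O$) is the set $\{x:\eta_{\mu\nu}x^\mu x^\nu=0\}$, and such that $$g_{\alpha\beta}-\eta_{\alpha\beta}=O(|x|^2),\qquad \partial_\sigma g_{\alpha\beta}=O(|x|)\qquad (x\to 0).$$ Then for every $\ell\in\mathbb N\cup\{\infty\}$ there exist a smooth Lorentzian metric $\widehat g$, defined for $|x|$ small enough, and smooth coordinates $y=(y^\mu)$ on a neighbourhood of $O$ such that: 1. $\widehat g$ and $g$ induce the same tensor field on $C_O$: at every point of $C_O\setminus\{O\}$ in the domain of $\widehat g$ they agree on all pairs of vectors tangent to $C_O$ (in particular $\widehat g_{AB}|_{C_O}=g_{AB}|_{C_O}$ for angular coordinates $x^A$ on $C_O$); 2. the coordinates $y^\mu$ coincide with $x^\mu$ on $C_O$ and are harmonic for $\widehat g$, i.e. $\Box_{\widehat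 g}\,y^\mu=0$ for all $\mu$ in a neighbourhood of $O$; 3. if $\widehat R_{\mu\nu}$ denotes the components of the Ricci tensor of $\widehat g$ in the coordinates $y^\mu$, then, for some smooth functions $P_\mu$ defined near $O$, $$\widehat R_{\mu\nu}=O\big(|y|^{\min(\ell,2)}\big),\qquad \widehat R_{\mu\nu}\,y^\nu=O\big(|y|^{\ell+1}\big)+P_\mu\,\eta_{\alpha\beta}y^\alpha y^\beta\qquad (y\to 0).$$ Here $O(|y|^{\infty})$ means $O(|y|^N)$ for every $N\in\mathbb N$. -/

import Mathlib

open scoped ContDiff Topology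

noncomputable section

namespace LightCone

/-- Coordinate space `ℝ^{n+1}` with the Euclidean norm `|x|`; the index `0` is the time index. -/
abbrev Coord (n : ℕ) : Type := EuclideanSpace ℝ (Fin (n + 1))

/-- A field of `(n+1) × (n+1)` matrices: the components `g_{μν}(x)` of a `(0,2)`-tensor field. -/
abbrev TensorField (n : ℕ) : Type := Coord n → Matrix (Fin (n + 1)) (Fin (n + 1)) ℝ

/-- The Minkowski matrix `η = diag(-1, 1, …, 1)`. -/
def eta (n : ℕ) : Matrix (Fin (n + 1)) (Fin (n + 1)) ℝ :=
  Matrix.diagonal fun μ => if μ = 0 then -1 else 1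

/-- `M_{μν} v^μ w^ν`. -/
def bilin {n : ℕ} (M : Matrix (Fin (n + 1)) (Fin (n + 1)) ℝ) (v w : Coord n) : ℝ :=
  ∑ μ, ∑ ν, M μ ν * v μ * w ν

/-- The cone `{x : η_{μν} x^μ x^ν = 0}`. -/
def cone (n : ℕ) : Set (Coord n) := {x | bilin (eta n) x x = 0}

/-- The partial derivative `∂_μ f`. -/
def pd {n : ℕ} (μ : Fin (n + 1)) (f : Coord n → ℝ) (x : Coord n) : ℝ :=
  fderiv ℝ f x (EuclideanSpace.single μ 1)

/-- A symmetric matrix of signature `(-,+,…,+)`: it admits a basis (the columns of `B`) that is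
orthonormal in the Lorentzian sense. -/
def IsLorentzMatrix {n : ℕ} (M : Matrix (Fin (n + 1)) (Fin (n + 1)) ℝ) : Prop :=
  M.IsSymm ∧ ∃ B : Matrix (Fin (n + 1)) (Fin (n + 1)) ℝ,
    IsUnit B.det ∧ B.transpose * M * B = eta n

/-- `g` is a smooth Lorentzian metric on the set `U`. -/
def IsLorentzMetricOn {n : ℕ} (g : TensorField n) (U : Set (Coord n)) : Prop :=
  (∀ μ ν, ContDiffOn ℝ ∞ (fun x => g x μ ν) U) ∧ ∀ x ∈ U, IsLorentzMatrix (g x)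

/-- Christoffel symbols `Γ^a_{μν} = ½ g^{aσ} (∂_μ g_{νσ} + ∂_ν g_{μσ} - ∂_σ g_{μν})`. -/
def christoffel {n : ℕ} (g : TensorField n) (a μ ν : Fin (n + 1)) (x : Coord n) : ℝ :=
  (1 / 2) * ∑ σ, (g x)⁻¹ a σ *
    (pd μ (fun z => g z ν σ) x + pd ν (fun z => g z μ σ) x - pd σ (fun z => g z μ ν) x)

/-- The Ricci tensor
`R_{μν} = ∂_a Γ^a_{μν} - ∂_ν Γ^a_{aμ} + Γ^a_{ab} Γ^b_{μν} - Γ^a_{νb} Γ^b_{aμ}`. -/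
def ricci {n : ℕ} (g : TensorField n) (μ ν : Fin (n + 1)) (x : Coord n) : ℝ :=
  (∑ a, (pd a (christoffel g a μ ν) x - pd ν (christoffel g a a μ) x)) +
    ∑ a, ∑ b, (christoffel g a a b x * christoffel g b μ ν x -
      christoffel g a ν b x * christoffel g b a μ x)

/-- The Laplace–Beltrami (wave) operator
`□_g f = |det g|^{-1/2} ∂_μ (|det g|^{1/2} g^{μν} ∂_ν f)`. -/
def box {n : ℕ} (g : TensorField n) (f : Coord n → ℝ) (x : Coord n) : ℝ :=
  (√|(g x).det|)⁻¹ *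
    ∑ μ, pd μ (fun z => √|(g z).det| * ∑ ν, (g z)⁻¹ μ ν * pd ν f z) x

/-- `γ` is an affinely parameterized geodesic of `g` on the interval `I`, with velocity `u`. -/
def IsGeodesicOn {n : ℕ} (g : TensorField n) (γ u : ℝ → Coord n) (I : Set ℝ) : Prop :=
  ∀ s ∈ I, HasDerivWithinAt γ (u s) I s ∧
    ∀ a, HasDerivWithinAt (fun t => u t a)
      (-∑ μ, ∑ ν, christoffel g a μ ν (γ s) * u s μ * u s ν) I s

/-- The light-cone of the origin `O` of the metric `g` within the set `B`: all points that are
reached from `O` along a null geodesic of `g` (past or future directed) lying in `B`. -/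
def lightCone {n : ℕ} (g : TensorField n) (B : Set (Coord n)) : Set (Coord n) :=
  {p | ∃ γ u : ℝ → Coord n, γ 0 = 0 ∧ bilin (g 0) (u 0) (u 0) = 0 ∧
    IsGeodesicOn g γ u (Set.Icc 0 1) ∧ (∀ s ∈ Set.Icc (0 : ℝ) 1, γ s ∈ B) ∧ γ 1 = p}

/-- `g` and `h` induce the same tensor field on `cone n` within `V`: at every point `x ≠ O` of the
cone they agree on all pairs of vectors tangent to the cone, i.e. on the kernel
`{v : η_{μν} x^μ v^ν = 0}` of the differential of `η_{μν} x^μ x^ν`. -/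
def InduceSameOnCone {n : ℕ} (g h : TensorField n) (V : Set (Coord n)) : Prop :=
  ∀ x ∈ V ∩ cone n, x ≠ 0 → ∀ v w : Coord n,
    bilin (eta n) x v = 0 → bilin (eta n) x w = 0 → bilin (g x) v w = bilin (h x) v w

/-- The components `g(∂/∂y^μ, ∂/∂y^ν)`, as functions of `y`, of the metric with components `g` in
the coordinates `x`, where `y = y(x)` are new coordinates. -/
def inCoords {n : ℕ} (g : TensorField n) (y : OpenPartialHomeomorph (Coord n) (Coord n)) :
    TensorField n := fun z => Matrix.of fun μ ν =>
  ∑ α, ∑ β, g (y.symm z) α β * pd μ (fun w => y.symm w α) z * pd ν (fun w => y.symm w β) z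

/-- `f = O(|x|^k)` near the origin for `k ∈ ℕ ∪ {∞}`; for `k = ∞` this means `f = O(|x|^N)` for
every `N ∈ ℕ`. -/
def IsOrder {n : ℕ} (f : Coord n → ℝ) (k : ℕ∞) : Prop :=
  ∀ N : ℕ, (N : ℕ∞) ≤ k → f =O[𝓝 0] fun x => ‖x‖ ^ N

end LightCone

end

noncomputable section

namespace LightCone

section

open MvPolynomial

/-! ### Polynomial tensors on Minkowski space -/

/-! The coordinates `y` are taken to be `x` itself, on a small ball, and only the metric is
constructed. Indices are lowered with `η` and `σ = η_{μν} x^μ x^ν`. A vector tangent to the cone at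
`x` satisfies `x_μ v^μ = 0`, so adding `x_μ ξ_ν + x_ν ξ_μ + σ q_{μν}` to `g` does not change the
tensor induced on the cone. This freedom is used to reach the harmonic condition `∂_μ (√|g| g^{μν})
= 0` together with the Ricci estimates.

Formal solution at `O`. Linearize at `η`, and let `V_ν` be the divergence of the trace-reversal of
`h` (`dvb`). The harmonic condition becomes `V = 0`, and the Ricci tensor becomes `½ (∂_μ V_ν + ∂_ν
V_μ - □ h_{μν})`. All metrics involved are `η + O(|x|²)`, so replacing the nonlinear operators by
their linearizations costs only terms of higher degree. Each degree is thus a linear problem for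
homogeneous polynomials. By `exists_wave_gauge_correction`, the available freedom prescribes both `□
h` and `V`, subject only to the identity relating them. By `exists_divergence_free_contraction`, any
defect in `R_{μν} x^ν` can be removed modulo `σ` by a source whose trace-reversal is divergence
free, so that identity holds by construction and no Bianchi identity for the nonlinear metric is
needed. Starting from a metric with Ricci tensor `O(|x|²)` (`exists_solvesTo_three`), the induction
`SolvesTo.exists_step` raises the order of the gauge and constraint defects indefinitely. Borel's
lemma then sums the corrections (`exists_formal_solution`).

Exact gauge. The remaining harmonic defect vanishes to infinite order at `O`. It is linear in the
densitized inverse metric, so it is cancelled by adding to that density a symmetric tensor `K` with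
prescribed divergence. `exists_divergence_eq` makes `K` flat at `O` and zero on the cone: potentials
with prescribed second derivatives along the cone are built by integration along the axes and
Hermite interpolation in time between the two halves of the cone. Flatness absorbs every negative
power of the radius that arises at the vertex. Since `n ≥ 2`, a metric is determined by its
densitized inverse. The new metric agrees with the old one on the cone and differs from it by a flat
term, so all Ricci estimates survive. One metric serves every `ℓ`, including `∞`. -/

/-- Polynomials in the coordinates of `ℝ^{n+1}`. -/
abbrev Poly (n : ℕ) : Type := MvPolynomial (Fin (n + 1)) ℝ

/-- The diagonal entries `±1` of the Minkowski matrix. -/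
def sgn {n : ℕ} (μ : Fin (n + 1)) : ℝ := if μ = 0 then -1 else 1

variable {n : ℕ}

lemma sgn_mul_self (μ : Fin (n + 1)) : sgn μ * sgn μ = 1 := by
  unfold sgn; split_ifs <;> norm_num

lemma sgn_smul_sgn_smul {M : Type*} [AddCommGroup M] [Module ℝ M] (μ : Fin (n + 1)) (p : M) :
    sgn μ • sgn μ • p = p := by
  rw [smul_smul, sgn_mul_self, one_smul]

/-- The wave operator `η^{μν} ∂_μ ∂_ν`. -/
def lap (p : Poly n) : Poly n := ∑ μ, sgn μ • pderiv μ (pderiv μ p)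

variable (n) in
/-- The quadratic form `η_{μν} x^μ x^ν`. -/
def sig : Poly n := ∑ μ, sgn μ • (X μ * X μ)

/-- The covector `η_{μν} x^ν`. -/
def xl (μ : Fin (n + 1)) : Poly n := sgn μ • X μ

/-- The divergence `η^{μν} ∂_μ W_ν`. -/
def dv (W : Fin (n + 1) → Poly n) : Poly n := ∑ μ, sgn μ • pderiv μ (W μ)

/-- The contraction `x^μ W_μ`. -/
def dot (W : Fin (n + 1) → Poly n) : Poly n := ∑ μ, X μ * W μ

/-- The trace `η^{μν} h_{μν}`. -/
def tr (h : Fin (n + 1) → Fin (n + 1) → Poly n) : Poly n := ∑ μ, sgn μ • h μ μ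

/-- The divergence of the trace-reversed tensor `h_{μν} - ½ η_{μν} tr h`. -/
def dvb (h : Fin (n + 1) → Fin (n + 1) → Poly n) (ν : Fin (n + 1)) : Poly n :=
  dv (fun μ => h μ ν) - (1 / 2 : ℝ) • pderiv ν (tr h)

/-! ### Derivatives, the wave operator and homogeneity of polynomials. -/

lemma pderiv_smul (μ : Fin (n + 1)) (c : ℝ) (p : Poly n) :
    pderiv μ (c • p) = c • pderiv μ p := (pderiv μ).map_smul c p

lemma pderiv_comm (μ ν : Fin (n + 1)) (p : Poly n) :
    pderiv μ (pderiv ν p) = pderiv ν (pderiv μ p) := by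
  have h : ⁅(pderiv μ : Derivation ℝ (Poly n) (Poly n)), pderiv ν⁆ = (0 : Derivation ℝ (Poly n) (Poly n)) := by
    apply MvPolynomial.derivation_ext
    intro i
    simp only [Derivation.commutator_apply, pderiv_X, Derivation.coe_zero, Pi.zero_apply]
    simp only [Pi.single_apply]
    split_ifs <;> simp
  have := DFunLike.congr_fun h p
  rwa [Derivation.commutator_apply, Derivation.coe_zero, Pi.zero_apply, sub_eq_zero] at this

lemma lap_add (p q : Poly n) : lap (p + q) = lap p + lap q := by
  simp [lap, Finset.sum_add_distrib]

lemma lap_sub (p q : Poly n) : lap (p - q) = lap p - lap q := by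
  simp [lap, Finset.sum_sub_distrib, smul_sub]

lemma lap_smul (c : ℝ) (p : Poly n) : lap (c • p) = c • lap p := by
  simp [lap, Finset.smul_sum, smul_comm c]

lemma lap_zero : lap (0 : Poly n) = 0 := by simp [lap]

lemma lap_sum {ι : Type*} (s : Finset ι) (f : ι → Poly n) :
    lap (∑ i ∈ s, f i) = ∑ i ∈ s, lap (f i) := by
  classical
  induction s using Finset.induction_on with
  | empty => simp [lap_zero]
  | insert a s ha ih => rw [Finset.sum_insert ha, Finset.sum_insert ha, lap_add, ih]

lemma lap_mul (p q : Poly n) : lap (p * q) =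
    lap p * q + p * lap q + (2 : ℝ) • ∑ μ, sgn μ • (pderiv μ p * pderiv μ q) := by
  simp only [lap, Finset.sum_mul, Finset.mul_sum, Finset.smul_sum, ← Finset.sum_add_distrib]
  refine Finset.sum_congr rfl fun μ _ => ?_
  simp only [Derivation.leibniz, map_add, smul_eq_mul]
  algebra

lemma lap_pderiv (ν : Fin (n + 1)) (p : Poly n) : lap (pderiv ν p) = pderiv ν (lap p) := by
  simp only [lap, map_sum, pderiv_smul]
  refine Finset.sum_congr rfl fun μ _ => ?_
  rw [pderiv_comm μ ν, pderiv_comm μ ν]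

lemma pderiv_X' (μ ν : Fin (n + 1)) :
    pderiv μ (X ν : Poly n) = if ν = μ then 1 else 0 := by
  rw [pderiv_X, Pi.single_apply]

lemma pderiv_xl (μ ν : Fin (n + 1)) :
    pderiv μ (xl ν : Poly n) = if ν = μ then sgn ν • 1 else 0 := by
  rw [xl, pderiv_smul, pderiv_X']; split_ifs <;> simp

lemma pderiv_sig (ν : Fin (n + 1)) : pderiv ν (sig n) = (2 : ℝ) • xl ν := by
  simp only [sig, map_sum, pderiv_smul, Derivation.leibniz, pderiv_X', smul_eq_mul, mul_ite,
    mul_one, mul_zero]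
  rw [Finset.sum_eq_single ν]
  · simp only [if_true, xl]; algebra
  · intro b _ hb; simp [hb]
  · simp

lemma euler {p : Poly n} {d : ℕ} (hp : p.IsHomogeneous d) :
    ∑ μ, X μ * pderiv μ p = (d : ℝ) • p := by
  rw [hp.sum_X_mul_pderiv, Nat.cast_smul_eq_nsmul]

lemma sgn_smul_xl (μ : Fin (n + 1)) : sgn μ • (xl μ : Poly n) = X μ := sgn_smul_sgn_smul _ _

lemma lap_X (ν : Fin (n + 1)) : lap (X ν : Poly n) = 0 := by
  simp only [lap, pderiv_X']
  exact Finset.sum_eq_zero fun μ _ => by split_ifs <;> simp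

lemma lap_xl_mul (ν : Fin (n + 1)) (p : Poly n) :
    lap (xl ν * p) = xl ν * lap p + (2 : ℝ) • pderiv ν p := by
  rw [lap_mul]
  have h1 : lap (xl ν : Poly n) = 0 := by rw [xl, lap_smul, lap_X, smul_zero]
  rw [h1, Finset.sum_eq_single ν]
  · rw [pderiv_xl, if_pos rfl, smul_mul_assoc, sgn_smul_sgn_smul]; algebra
  · intro b _ hb; simp [pderiv_xl, hb.symm]
  · simp

lemma lap_X_mul (ν : Fin (n + 1)) (p : Poly n) :
    lap (X ν * p) = X ν * lap p + (2 * sgn ν) • pderiv ν p := by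
  have := lap_xl_mul ν p
  rw [← sgn_smul_xl, smul_mul_assoc, lap_smul, this]
  algebra

lemma lap_sig : lap (sig n) = (2 * (n + 1) : ℝ) • (1 : Poly n) := by
  simp only [lap, pderiv_sig, pderiv_smul, pderiv_xl, if_true, smul_comm _ (2 : ℝ),
    sgn_smul_sgn_smul]
  simp only [Finset.sum_const, Finset.card_univ, Fintype.card_fin]
  rw [← Nat.cast_smul_eq_nsmul ℝ, smul_smul]
  congr 1; push_cast; ring

/-- The constant is `□σ` plus four times the degree, the latter coming from Euler's identity in the
cross term. It is positive, and all the solvability below rests on this. -/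
lemma lap_sig_mul {p : Poly n} {d : ℕ} (hp : p.IsHomogeneous d) :
    lap (sig n * p) = (2 * (n + 1) + 4 * d : ℝ) • p + sig n * lap p := by
  rw [lap_mul, lap_sig]
  have : ∑ μ, sgn μ • (pderiv μ (sig n) * pderiv μ p) = (2 * d : ℝ) • p := by
    rw [mul_smul, ← euler hp, Finset.smul_sum]
    refine Finset.sum_congr rfl fun μ _ => ?_
    rw [pderiv_sig, ← sgn_smul_xl]; algebra
  rw [this]; algebra

lemma isHomogeneous_smul {p : Poly n} {d : ℕ} (c : ℝ) (hp : p.IsHomogeneous d) :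
    (c • p).IsHomogeneous d :=
  (homogeneousSubmodule (Fin (n + 1)) ℝ d).smul_mem c hp

lemma isHomogeneous_xl (μ : Fin (n + 1)) : (xl μ : Poly n).IsHomogeneous 1 :=
  isHomogeneous_smul _ (isHomogeneous_X _ _)

lemma isHomogeneous_sig : (sig n).IsHomogeneous 2 :=
  IsHomogeneous.sum _ _ _ fun _ _ =>
    isHomogeneous_smul _ ((isHomogeneous_X _ _).mul (isHomogeneous_X _ _))

lemma isHomogeneous_pderiv {p : Poly n} {d : ℕ} (μ : Fin (n + 1)) (hp : p.IsHomogeneous (d + 1)) :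
    (pderiv μ p).IsHomogeneous d := hp.pderiv

lemma isHomogeneous_dv {W : Fin (n + 1) → Poly n} {d : ℕ} (h : ∀ μ, (W μ).IsHomogeneous (d + 1)) :
    (dv W).IsHomogeneous d :=
  IsHomogeneous.sum _ _ _ fun μ _ => isHomogeneous_smul _ (isHomogeneous_pderiv μ (h μ))

lemma isHomogeneous_dot {W : Fin (n + 1) → Poly n} {d : ℕ} (h : ∀ μ, (W μ).IsHomogeneous d) :
    (dot W).IsHomogeneous (d + 1) :=
  IsHomogeneous.sum _ _ _ fun μ _ => by
    rw [add_comm d 1]; exact (isHomogeneous_X _ _).mul (h μ)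

lemma isHomogeneous_lap {p : Poly n} {d : ℕ} (hp : p.IsHomogeneous (d + 2)) :
    (lap p).IsHomogeneous d :=
  IsHomogeneous.sum _ _ _ fun μ _ =>
    isHomogeneous_smul _ (isHomogeneous_pderiv μ (isHomogeneous_pderiv μ hp))

lemma isHomogeneous_sig_mul {p : Poly n} {d : ℕ} (hp : p.IsHomogeneous d) :
    (sig n * p).IsHomogeneous (d + 2) := by
  rw [add_comm d 2]; exact isHomogeneous_sig.mul hp

lemma isHomogeneous_xl_mul {p : Poly n} {d : ℕ} (μ : Fin (n + 1)) (hp : p.IsHomogeneous d) :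
    (xl μ * p).IsHomogeneous (d + 1) := by
  rw [add_comm d 1]; exact (isHomogeneous_xl μ).mul hp

lemma isHomogeneous_tr {h : Fin (n + 1) → Fin (n + 1) → Poly n} {d : ℕ}
    (hh : ∀ μ ν, (h μ ν).IsHomogeneous d) : (tr h).IsHomogeneous d :=
  IsHomogeneous.sum _ _ _ fun μ _ => isHomogeneous_smul _ (hh μ μ)

lemma isHomogeneous_dvb {h : Fin (n + 1) → Fin (n + 1) → Poly n} {d : ℕ}
    (hh : ∀ μ ν, (h μ ν).IsHomogeneous (d + 1)) (ν : Fin (n + 1)) :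
    (dvb h ν).IsHomogeneous d :=
  (isHomogeneous_dv fun μ => hh μ ν).sub
    (isHomogeneous_smul _ (isHomogeneous_pderiv ν (isHomogeneous_tr hh)))

lemma lap_eq_zero_of_isHomogeneous {p : Poly n} {d : ℕ} (hd : d < 2) (hp : p.IsHomogeneous d) :
    lap p = 0 := by
  refine Finset.sum_eq_zero fun μ _ => ?_
  have h1 : (pderiv μ p).IsHomogeneous 0 := by
    have := hp.pderiv (i := μ)
    rwa [show d - 1 = 0 by omega] at this
  rw [← totalDegree_zero_iff_isHomogeneous, totalDegree_eq_zero_iff_eq_C] at h1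
  rw [h1, pderiv_C, smul_zero]

/-- Every homogeneous polynomial is of the form `α q + σ □q`, for `α > 0`. -/
lemma exists_smul_add_sig_mul_lap (d : ℕ) : ∀ (α : ℝ), 0 < α → ∀ F : Poly n, F.IsHomogeneous d →
    ∃ q : Poly n, q.IsHomogeneous d ∧ α • q + sig n * lap q = F := by
  induction d using Nat.strong_induction_on with
  | _ d ih =>
    intro α hα F hF
    by_cases hd : d < 2
    · refine ⟨α⁻¹ • F, isHomogeneous_smul _ hF, ?_⟩
      rw [lap_smul, lap_eq_zero_of_isHomogeneous hd hF, smul_smul, mul_inv_cancel₀ hα.ne']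
      simp
    · obtain ⟨e, rfl⟩ : ∃ e, d = e + 2 := ⟨d - 2, by omega⟩
      -- Look for the solution as `α⁻¹ F + σ q`. Expanding `□(σ q)` leaves `σ` times an equation of
      -- the same type for `q`, two degrees lower, with `α` increased by a positive constant.
      obtain ⟨q, hq, hqF⟩ := ih e (by omega) (α + (2 * (n + 1) + 4 * e)) (by positivity)
        (-(α⁻¹ • lap F)) (isHomogeneous_smul _ (isHomogeneous_lap hF)).neg
      refine ⟨α⁻¹ • F + sig n * q, (isHomogeneous_smul _ hF).add (isHomogeneous_sig_mul hq), ?_⟩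
      rw [lap_add, lap_smul, lap_sig_mul hq]
      have h2 : α • α⁻¹ • F = F := by rw [smul_smul, mul_inv_cancel₀ hα.ne', one_smul]
      linear_combination (norm := algebra) h2 + sig n * hqF

/-- The Fischer decomposition: `q ↦ □(σ q)` is onto on homogeneous polynomials. -/
lemma exists_lap_sig_mul_eq {d : ℕ} {F : Poly n} (hF : F.IsHomogeneous d) :
    ∃ q : Poly n, q.IsHomogeneous d ∧ lap (sig n * q) = F := by
  obtain ⟨q, hq, h⟩ := exists_smul_add_sig_mul_lap d (2 * (n + 1) + 4 * d) (by positivity) F hF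
  exact ⟨q, hq, by rw [lap_sig_mul hq, h]⟩

/-! ### Identities for divergences, contractions and traces. -/

lemma dv_add (a b : Fin (n + 1) → Poly n) : dv (fun μ => a μ + b μ) = dv a + dv b := by
  simp [dv, Finset.sum_add_distrib]

lemma dv_sub (a b : Fin (n + 1) → Poly n) : dv (fun μ => a μ - b μ) = dv a - dv b := by
  simp [dv, Finset.sum_sub_distrib, smul_sub]

lemma dv_smul (c : ℝ) (a : Fin (n + 1) → Poly n) : dv (fun μ => c • a μ) = c • dv a := by
  simp [dv, Finset.smul_sum, smul_comm c]

lemma dv_xl_mul {p : Poly n} {d : ℕ} (hp : p.IsHomogeneous d) :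
    dv (fun μ => xl μ * p) = (n + 1 + d : ℝ) • p := by
  have : ∀ μ : Fin (n + 1), sgn μ • pderiv μ (xl μ * p) = p + X μ * pderiv μ p := by
    intro μ
    rw [Derivation.leibniz, pderiv_xl, if_pos rfl, ← sgn_smul_xl, smul_add, smul_eq_mul,
      smul_eq_mul, mul_smul_comm, sgn_smul_sgn_smul]
    algebra
  rw [dv, Finset.sum_congr rfl fun μ _ => this μ, Finset.sum_add_distrib, euler hp]
  simp only [Finset.sum_const, Finset.card_univ, Fintype.card_fin]
  rw [← Nat.cast_smul_eq_nsmul ℝ]; push_cast; algebra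

lemma dv_mul (p : Poly n) (W : Fin (n + 1) → Poly n) :
    dv (fun μ => p * W μ) = ∑ μ, sgn μ • (pderiv μ p * W μ) + p * dv W := by
  simp only [dv, Finset.mul_sum, ← Finset.sum_add_distrib]
  refine Finset.sum_congr rfl fun μ _ => ?_
  rw [Derivation.leibniz, smul_eq_mul, smul_eq_mul]; algebra

lemma dv_xl_mul_left (ν : Fin (n + 1)) (W : Fin (n + 1) → Poly n) :
    dv (fun μ => xl ν * W μ) = W ν + xl ν * dv W := by
  rw [dv_mul, Finset.sum_eq_single ν]
  · rw [pderiv_xl, if_pos rfl, smul_mul_assoc, sgn_smul_sgn_smul, one_mul]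
  · intro b _ hb; simp [pderiv_xl, hb.symm]
  · simp

lemma dv_sig_mul (W : Fin (n + 1) → Poly n) :
    dv (fun μ => sig n * W μ) = (2 : ℝ) • dot W + sig n * dv W := by
  rw [dv_mul, dot, Finset.smul_sum]
  congr 1
  refine Finset.sum_congr rfl fun μ _ => ?_
  rw [pderiv_sig, ← sgn_smul_xl]; algebra

lemma dv_grad (p : Poly n) : dv (fun μ => pderiv μ p) = lap p := rfl

lemma dv_pderiv (ν : Fin (n + 1)) (W : Fin (n + 1) → Poly n) :
    dv (fun μ => pderiv ν (W μ)) = pderiv ν (dv W) := by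
  simp only [dv, map_sum, pderiv_smul, pderiv_comm ν]

lemma dot_add (a b : Fin (n + 1) → Poly n) : dot (fun μ => a μ + b μ) = dot a + dot b := by
  simp [dot, Finset.sum_add_distrib, mul_add]

lemma dot_sub (a b : Fin (n + 1) → Poly n) : dot (fun μ => a μ - b μ) = dot a - dot b := by
  simp [dot, Finset.sum_sub_distrib, mul_sub]

lemma dot_smul (c : ℝ) (a : Fin (n + 1) → Poly n) : dot (fun μ => c • a μ) = c • dot a := by
  simp [dot, Finset.smul_sum]

lemma dot_mul (p : Poly n) (a : Fin (n + 1) → Poly n) : dot (fun μ => p * a μ) = p * dot a := by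
  simp only [dot, Finset.mul_sum]
  exact Finset.sum_congr rfl fun μ _ => by ring

lemma dot_mul_right (p : Poly n) (a : Fin (n + 1) → Poly n) :
    dot (fun μ => a μ * p) = dot a * p := by
  simp only [dot, Finset.sum_mul]
  exact Finset.sum_congr rfl fun μ _ => by ring

lemma dot_xl : dot (fun μ => xl μ) = sig n :=
  Finset.sum_congr rfl fun μ _ => by simp only [xl]; algebra

lemma dot_grad {p : Poly n} {d : ℕ} (hp : p.IsHomogeneous d) :
    dot (fun μ => pderiv μ p) = (d : ℝ) • p := euler hp

lemma dot_pderiv (ν : Fin (n + 1)) (W : Fin (n + 1) → Poly n) :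
    dot (fun μ => pderiv ν (W μ)) = pderiv ν (dot W) - W ν := by
  simp only [dot, map_sum, Derivation.leibniz, pderiv_X', smul_eq_mul, Finset.sum_add_distrib]
  rw [eq_sub_iff_add_eq]
  congr 1
  simp

lemma lap_dot (W : Fin (n + 1) → Poly n) :
    lap (dot W) = (2 : ℝ) • dv W + dot (fun μ => lap (W μ)) := by
  simp only [dot, lap_sum, lap_X_mul, Finset.sum_add_distrib, dv, Finset.smul_sum]
  rw [add_comm]
  congr 1
  exact Finset.sum_congr rfl fun μ _ => by algebra

lemma lap_dv (W : Fin (n + 1) → Poly n) : lap (dv W) = dv (fun μ => lap (W μ)) := by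
  simp only [dv, lap_sum, lap_smul, lap_pderiv]

lemma tr_add (a b : Fin (n + 1) → Fin (n + 1) → Poly n) :
    tr (fun μ ν => a μ ν + b μ ν) = tr a + tr b := by
  simp [tr, Finset.sum_add_distrib]

lemma tr_sub (a b : Fin (n + 1) → Fin (n + 1) → Poly n) :
    tr (fun μ ν => a μ ν - b μ ν) = tr a - tr b := by
  simp [tr, Finset.sum_sub_distrib, smul_sub]

lemma tr_smul (c : ℝ) (a : Fin (n + 1) → Fin (n + 1) → Poly n) :
    tr (fun μ ν => c • a μ ν) = c • tr a := by
  simp [tr, Finset.smul_sum, smul_comm c]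

lemma tr_mul (p : Poly n) (a : Fin (n + 1) → Fin (n + 1) → Poly n) :
    tr (fun μ ν => p * a μ ν) = p * tr a := by
  simp [tr, Finset.mul_sum]

lemma tr_xl_mul (ξ : Fin (n + 1) → Poly n) : tr (fun μ ν => xl μ * ξ ν) = dot ξ :=
  Finset.sum_congr rfl fun μ _ => by rw [← sgn_smul_xl]; algebra

lemma tr_xl_mul' (ξ : Fin (n + 1) → Poly n) : tr (fun μ ν => xl ν * ξ μ) = dot ξ :=
  tr_xl_mul ξ

lemma tr_pderiv (ξ : Fin (n + 1) → Poly n) : tr (fun μ ν => pderiv μ (ξ ν)) = dv ξ := rfl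

lemma tr_pderiv' (ξ : Fin (n + 1) → Poly n) : tr (fun μ ν => pderiv ν (ξ μ)) = dv ξ := rfl

lemma lap_tr (h : Fin (n + 1) → Fin (n + 1) → Poly n) :
    lap (tr h) = tr (fun μ ν => lap (h μ ν)) := by
  simp only [tr, lap_sum, lap_smul]

lemma dvb_add (a b : Fin (n + 1) → Fin (n + 1) → Poly n) (ν : Fin (n + 1)) :
    dvb (fun μ ν => a μ ν + b μ ν) ν = dvb a ν + dvb b ν := by
  simp only [dvb, dv_add, tr_add, map_add]; algebra

lemma dvb_sub (a b : Fin (n + 1) → Fin (n + 1) → Poly n) (ν : Fin (n + 1)) :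
    dvb (fun μ ν => a μ ν - b μ ν) ν = dvb a ν - dvb b ν := by
  simp only [dvb, dv_sub, tr_sub, map_sub]; algebra

lemma dvb_smul (c : ℝ) (a : Fin (n + 1) → Fin (n + 1) → Poly n) (ν : Fin (n + 1)) :
    dvb (fun μ ν => c • a μ ν) ν = c • dvb a ν := by
  simp only [dvb, dv_smul, tr_smul, pderiv_smul]; algebra

/-- Constant-coefficient operators commute. This is the only compatibility condition between a
prescribed `□ h` and a prescribed `dvb h`. -/
lemma lap_dvb (h : Fin (n + 1) → Fin (n + 1) → Poly n) (ν : Fin (n + 1)) :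
    lap (dvb h ν) = dvb (fun μ ν => lap (h μ ν)) ν := by
  simp only [dvb, lap_sub, lap_smul, lap_dv, lap_pderiv, lap_tr]

/-- The divergence `∂_ν ∂^μ V_μ` cancels against half of the trace. Hence `∂_μ V_ν + ∂_ν V_μ` is a
source for `□ h` compatible with the gauge divergence `V`. -/
lemma dvb_pderiv_symm (V : Fin (n + 1) → Poly n) (ν : Fin (n + 1)) :
    dvb (fun μ ν => pderiv μ (V ν) + pderiv ν (V μ)) ν = lap (V ν) := by
  simp only [dvb, dv_add, tr_add, tr_pderiv, tr_pderiv', dv_grad, dv_pderiv, map_add]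
  algebra

end

/-! ### The linearized gauge and constraint problems in a fixed degree. -/

section

open MvPolynomial
variable {n : ℕ}

/-- For harmonic `ξ` one has `□(x·ξ) = 2 div ξ`, so the divergence of the equation reads `E div ξ =
div v`. Its contraction with `x` reads `D (x·ξ) = x·v - B σ div ξ`. These determine the scalars `d =
div ξ` and `f = x·ξ`, after which the equation itself gives `A ξ`. Conversely, the `ξ` so defined
has these scalars as its divergence and contraction. -/
lemma exists_harmonic_covector {m : ℕ} {A B : ℝ} (hA : A ≠ 0) (hD : A - B * (m + 2) ≠ 0)
    (hE : A + B * (n + m - 1) ≠ 0) {v : Fin (n + 1) → Poly n}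
    (hv : ∀ ν, (v ν).IsHomogeneous (m + 1)) (hl : ∀ ν, lap (v ν) = 0) :
    ∃ ξ : Fin (n + 1) → Poly n, (∀ ν, (ξ ν).IsHomogeneous (m + 1)) ∧ (∀ ν, lap (ξ ν) = 0) ∧
      ∀ ν, A • ξ ν + B • (xl ν * dv ξ - pderiv ν (dot ξ)) = v ν := by
  set D := A - B * (m + 2) with hD'
  set E := A + B * (n + m - 1) with hE'
  set d := E⁻¹ • dv v with hd
  set f := D⁻¹ • (dot v - B • (sig n * d)) with hf
  have hdE : E • d = dv v := by rw [hd, smul_smul, mul_inv_cancel₀ hE, one_smul]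
  have hfD : D • f = dot v - B • (sig n * d) := by
    rw [hf, smul_smul, mul_inv_cancel₀ hD, one_smul]
  have hdh : d.IsHomogeneous m := isHomogeneous_smul _ (isHomogeneous_dv hv)
  have hfh : f.IsHomogeneous (m + 2) := isHomogeneous_smul _
    ((isHomogeneous_dot hv).sub (isHomogeneous_smul _ (isHomogeneous_sig_mul hdh)))
  have hld : lap d = 0 := by
    rw [hd, lap_smul, lap_dv]; simp [hl, dv]
  -- The candidates must satisfy the relation that holds between `x·ξ` and `div ξ` for harmonic `ξ`;
  -- the coefficients combine to exactly `2 D`.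
  have hlf : lap f = (2 : ℝ) • d := by
    have h1 : D • lap f = D • ((2 : ℝ) • d) := by
      rw [← lap_smul, hfD, lap_sub, lap_smul, lap_sig_mul hdh, hld, lap_dot, ← hdE, hD', hE']
      simp only [hl]
      simp only [dot, mul_zero, Finset.sum_const_zero]
      algebra
    have := congrArg (fun z => D⁻¹ • z) h1
    simpa only [smul_smul _ D, inv_mul_cancel₀ hD, one_smul] using this
  set ξ : Fin (n + 1) → Poly n := fun ν => A⁻¹ • (v ν - B • (xl ν * d) + B • pderiv ν f) with hξ
  have hAξ : ∀ ν, A • ξ ν = v ν - B • (xl ν * d) + B • pderiv ν f := fun ν => by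
    simp only [hξ]; rw [smul_smul, mul_inv_cancel₀ hA, one_smul]
  have hcancel : ∀ p q : Poly n, A • p = A • q → p = q := fun p q h => by
    have := congrArg (fun z => A⁻¹ • z) h
    simpa only [smul_smul, inv_mul_cancel₀ hA, one_smul] using this
  have hdot : dot ξ = f := by
    apply hcancel
    rw [← dot_smul]
    simp only [hAξ]
    rw [dot_add, dot_sub, dot_smul, dot_smul, dot_mul_right, dot_xl, dot_grad hfh]
    have h2 : (D + B * (m + 2)) • f = A • f := by rw [hD']; congr 1; ring
    push_cast
    linear_combination (norm := algebra) h2 - hfD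
  have hdv : dv ξ = d := by
    apply hcancel
    rw [← dv_smul]
    simp only [hAξ]
    rw [dv_add, dv_sub, dv_smul, dv_smul, dv_xl_mul hdh, dv_grad, hlf, ← hdE, hE']
    algebra
  refine ⟨ξ, fun ν => isHomogeneous_smul _ (((hv ν).sub (isHomogeneous_smul _
    (isHomogeneous_xl_mul ν hdh))).add (isHomogeneous_smul _ (isHomogeneous_pderiv ν hfh))),
    fun ν => ?_, fun ν => ?_⟩
  · apply hcancel
    rw [← lap_smul, hAξ, lap_add, lap_sub, lap_smul, lap_smul, lap_xl_mul, lap_pderiv, hlf, hld,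
      hl, pderiv_smul ν 2 d]
    algebra
  · rw [hdot, hdv, hAξ]; algebra

/-- The linearized problem: every tensor polynomial can be changed, without changing the tensor
it induces on the cone, so that its wave operator and its wave-gauge divergence become any
prescribed compatible fields. -/
lemma exists_wave_gauge_correction (hn : 2 ≤ n) {m : ℕ}
    {s S : Fin (n + 1) → Fin (n + 1) → Poly n} {V : Fin (n + 1) → Poly n}
    (hs : ∀ μ ν, (s μ ν).IsHomogeneous (m + 2)) (hss : ∀ μ ν, s μ ν = s ν μ)
    (hS : ∀ μ ν, (S μ ν).IsHomogeneous m) (hSs : ∀ μ ν, S μ ν = S ν μ)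
    (hV : ∀ ν, (V ν).IsHomogeneous (m + 1)) (hVS : ∀ ν, lap (V ν) = dvb S ν) :
    ∃ (ξ : Fin (n + 1) → Poly n) (q : Fin (n + 1) → Fin (n + 1) → Poly n),
      (∀ ν, (ξ ν).IsHomogeneous (m + 1)) ∧ (∀ μ ν, (q μ ν).IsHomogeneous m) ∧
      (∀ μ ν, q μ ν = q ν μ) ∧
      (∀ μ ν, lap (s μ ν + xl μ * ξ ν + xl ν * ξ μ + sig n * q μ ν) = S μ ν) ∧
      ∀ ν, dvb (fun μ ν => s μ ν + xl μ * ξ ν + xl ν * ξ μ + sig n * q μ ν) ν = V ν := by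
  -- A multiple of `σ` alone already achieves the prescribed wave operator. What remains is to
  -- correct the gauge divergence by a harmonic tensor that induces zero on the cone.
  have hex : ∀ μ ν, ∃ q : Poly n, q.IsHomogeneous m ∧ lap (sig n * q) = S μ ν - lap (s μ ν) :=
    fun μ ν => exists_lap_sig_mul_eq ((hS μ ν).sub (isHomogeneous_lap (hs μ ν)))
  choose q₁ hq₁ hq₁l using hex
  set q₀ : Fin (n + 1) → Fin (n + 1) → Poly n := fun μ ν => (1 / 2 : ℝ) • (q₁ μ ν + q₁ ν μ)
    with hq₀
  have hq₀h : ∀ μ ν, (q₀ μ ν).IsHomogeneous m := fun μ ν =>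
    isHomogeneous_smul _ ((hq₁ μ ν).add (hq₁ ν μ))
  have hq₀l : ∀ μ ν, lap (s μ ν + sig n * q₀ μ ν) = S μ ν := fun μ ν => by
    have : sig n * q₀ μ ν = (1 / 2 : ℝ) • (sig n * q₁ μ ν + sig n * q₁ ν μ) := by
      simp only [hq₀]; algebra
    rw [lap_add, this, lap_smul, lap_add, hq₁l, hq₁l, hSs ν μ, hss ν μ]; algebra
  set h₀ : Fin (n + 1) → Fin (n + 1) → Poly n := fun μ ν => s μ ν + sig n * q₀ μ ν with hh₀
  have hh₀h : ∀ μ ν, (h₀ μ ν).IsHomogeneous (m + 1 + 1) := fun μ ν =>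
    (hs μ ν).add (isHomogeneous_sig_mul (hq₀h μ ν))
  have hvl : ∀ ν, lap (V ν - dvb h₀ ν) = 0 := fun ν => by
    rw [lap_sub, lap_dvb, hVS]
    simp only [hh₀, hq₀l]
    exact sub_self _
  have hn' : (2 : ℝ) ≤ n := by exact_mod_cast hn
  have hm' : (0 : ℝ) ≤ m := Nat.cast_nonneg m
  -- For harmonic `ξ`, `□(x_μ ξ_ν + x_ν ξ_μ) = 2 (∂_μ ξ_ν + ∂_ν ξ_μ)`, whereas `□(σ p) = 2 (n + 1 +
  -- 2m) p` for harmonic `p` of degree `m`. This `c` makes the combination in `key` harmonic.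
  set c : ℝ := 1 / (n + 1 + 2 * m) with hc
  have hcpos : (0 : ℝ) < n + 1 + 2 * m := by positivity
  have hcm : c * (n + 1 + 2 * m) = 1 := by rw [hc]; field_simp
  have hc0 : 0 < c := by positivity
  have hcm1 : 2 * (c * m) ≤ 1 := by nlinarith
  obtain ⟨ξ, hξ, hξl, hξv⟩ := exists_harmonic_covector (n := n) (m := m)
    (A := n + m + 3 - 2 * c * m) (B := 1 + 2 * c) (by nlinarith)
    (by
      intro h0
      -- Here `D` factors as `c (n - 1)(n + 3 + 2m)`, which is nonzero for `n ≥ 2` but would vanish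
      -- for `n = 1`.
      have : (n - 1) * (n + 3 + 2 * m) * c = 0 := by
        linear_combination h0 + ((n:ℝ) + 1) * hcm
      have : 0 < ((n : ℝ) - 1) * (n + 3 + 2 * m) * c := by
        have : (0 : ℝ) < n - 1 := by linarith
        positivity
      linarith)
    (by
      have : (0 : ℝ) ≤ (1 + 2 * c) * (n + m - 1) := mul_nonneg (by positivity) (by linarith)
      nlinarith) (fun ν => (hV ν).sub (isHomogeneous_dvb hh₀h ν)) hvl
  -- The gauge divergence of the harmonic correction is the operator inverted in
  -- `exists_harmonic_covector`; the values of `A` and `B` are read off from this computation.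
  have key : ∀ ν, dvb (fun μ ν => xl μ * ξ ν + xl ν * ξ μ -
      c • (sig n * (pderiv μ (ξ ν) + pderiv ν (ξ μ)))) ν = V ν - dvb h₀ ν := fun ν => by
    rw [← hξv]
    have hdvh : (dv ξ).IsHomogeneous m := isHomogeneous_dv hξ
    have h1 : tr (fun μ ν => xl μ * ξ ν + xl ν * ξ μ -
      c • (sig n * (pderiv μ (ξ ν) + pderiv ν (ξ μ)))) =
        (2 : ℝ) • dot ξ - (2 * c) • (sig n * dv ξ) := by
      rw [tr_sub, tr_smul, tr_mul, tr_add, tr_add, tr_xl_mul, tr_xl_mul', tr_pderiv, tr_pderiv']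
      algebra
    rw [dvb, h1, dv_sub, dv_smul, dv_add, dv_xl_mul (hξ ν), dv_xl_mul_left, dv_sig_mul, dv_add,
      dv_grad, dv_pderiv, hξl, dot_add, dot_grad (hξ ν), dot_pderiv]
    simp only [map_sub, pderiv_smul, Derivation.leibniz, pderiv_sig, smul_eq_mul]
    push_cast
    algebra
  refine ⟨ξ, fun μ ν => q₀ μ ν - c • (pderiv μ (ξ ν) + pderiv ν (ξ μ)), hξ, fun μ ν =>
    (hq₀h μ ν).sub (isHomogeneous_smul _ ((isHomogeneous_pderiv μ (hξ ν)).add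
      (isHomogeneous_pderiv ν (hξ μ)))), fun μ ν => ?_, fun μ ν => ?_, fun ν => ?_⟩
  · simp only [hq₀]; rw [add_comm (pderiv μ (ξ ν)), add_comm (q₁ μ ν)]
  · have h2 : s μ ν + xl μ * ξ ν + xl ν * ξ μ +
        sig n * (q₀ μ ν - c • (pderiv μ (ξ ν) + pderiv ν (ξ μ))) =
        (s μ ν + sig n * q₀ μ ν) + (xl μ * ξ ν + xl ν * ξ μ) -
          c • (sig n * (pderiv μ (ξ ν) + pderiv ν (ξ μ))) := by algebra
    rw [h2, lap_sub, lap_add, hq₀l, lap_add, lap_xl_mul, lap_xl_mul, hξl, hξl, lap_smul,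
      lap_sig_mul ((isHomogeneous_pderiv μ (hξ ν)).add (isHomogeneous_pderiv ν (hξ μ))), lap_add,
      lap_pderiv, lap_pderiv, hξl, hξl]
    have h3 : (c * (n + 1 + 2 * m)) • (pderiv μ (ξ ν) + pderiv ν (ξ μ)) =
      (pderiv μ (ξ ν) + pderiv ν (ξ μ)) := by rw [hcm, one_smul]
    simp only [map_zero]
    linear_combination (norm := algebra) (-2 : ℝ) • h3
  · have h2 : (fun μ ν => s μ ν + xl μ * ξ ν + xl ν * ξ μ +
        sig n * (q₀ μ ν - c • (pderiv μ (ξ ν) + pderiv ν (ξ μ)))) = fun μ ν =>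
        h₀ μ ν + (xl μ * ξ ν + xl ν * ξ μ -
          c • (sig n * (pderiv μ (ξ ν) + pderiv ν (ξ μ)))) := by
      funext μ ν; simp only [hh₀]; algebra
    rw [h2, dvb_add, key]; abel

/-- The constraint operator `S ↦ S_{νμ} x^μ` is onto modulo `σ`, on tensors whose trace-reversal is
divergence free. -/
lemma exists_divergence_free_contraction {m : ℕ} {W : Fin (n + 1) → Poly n} (hn : 2 ≤ n)
    (hW : ∀ ν, (W ν).IsHomogeneous (m + 2)) :
    ∃ (S : Fin (n + 1) → Fin (n + 1) → Poly n) (P : Fin (n + 1) → Poly n),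
      (∀ μ ν, (S μ ν).IsHomogeneous (m + 1)) ∧ (∀ μ ν, S μ ν = S ν μ) ∧
      (∀ ν, (P ν).IsHomogeneous m) ∧ (∀ ν, dvb S ν = 0) ∧
      ∀ ν, dot (fun μ => S ν μ) = W ν + sig n * P ν := by
  -- Modulo `σ`, each component of `W` may be replaced by a harmonic polynomial.
  have hex : ∀ ν, ∃ w : Poly n, w.IsHomogeneous m ∧ lap (sig n * w) = lap (W ν) :=
    fun ν => exists_lap_sig_mul_eq (isHomogeneous_lap (hW ν))
  choose w hw hwl using hex
  set Y : Fin (n + 1) → Poly n := fun ν => W ν - sig n * w ν with hY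
  have hYh : ∀ ν, (Y ν).IsHomogeneous (m + 1 + 1) := fun ν =>
    (hW ν).sub (isHomogeneous_sig_mul (hw ν))
  have hYl : ∀ ν, lap (Y ν) = 0 := fun ν => by simp only [hY, lap_sub, hwl, sub_self]
  set φ := dv Y with hφ
  have hφh : φ.IsHomogeneous (m + 1) := isHomogeneous_dv hYh
  have hφl : lap φ = 0 := by rw [hφ, lap_dv]; simp [hYl, dv]
  have hdotl : lap (dot Y) = (2 : ℝ) • φ := by
    rw [lap_dot]; simp only [hYl]; simp [dot, hφ]
  have hdoth : (dot Y).IsHomogeneous (m + 1 + 1 + 1) := isHomogeneous_dot hYh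
  have hn' : (2 : ℝ) ≤ n := by exact_mod_cast hn
  set a : ℝ := 1 / (m + 1) with ha
  set b : ℝ := 1 / (m + 2) with hb
  have ha' : a * (m + 1) = 1 := by rw [ha]; field_simp
  have hb' : b * (m + 2) = 1 := by rw [hb]; field_simp
  have hκ : ((n : ℝ) + 1 + (n - 1) * (m + 1) / 2) ≠ 0 := by
    have : (0 : ℝ) ≤ n - 1 := by linarith
    positivity
  -- Below, `dvb R = -b ∂φ`, and `dvb T` is a nonzero multiple of `∂φ`. This `κ` makes `a R + κ T`
  -- divergence free after trace-reversal.
  set κ : ℝ := - (a * b) / (n + 1 + (n - 1) * (m + 1) / 2) with hκd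
  have hκ' : κ * (n + 1 + (n - 1) * (m + 1) / 2) = - (a * b) := by
    rw [hκd]; exact div_mul_cancel₀ _ hκ
  set δ : Fin (n + 1) → Fin (n + 1) → Poly n := fun μ ν => if μ = ν then sgn μ • φ else 0 with hδ
  have hδs : ∀ μ ν, δ μ ν = δ ν μ := fun μ ν => by
    simp only [hδ]
    by_cases h : μ = ν
    · simp [h]
    · simp [h, Ne.symm h]
  have hδtr : tr δ = (n + 1 : ℝ) • φ := by
    simp only [tr, hδ, if_true, sgn_smul_sgn_smul, Finset.sum_const, Finset.card_univ,
      Fintype.card_fin]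
    rw [← Nat.cast_smul_eq_nsmul ℝ]; push_cast; rfl
  have hδdv : ∀ ν, dv (fun μ => δ μ ν) = pderiv ν φ := fun ν => by
    rw [dv, Finset.sum_eq_single ν]
    · simp only [hδ, if_true, pderiv_smul, sgn_smul_sgn_smul]
    · intro c _ hc; simp [hδ, hc]
    · simp
  have hδdot : ∀ ν, dot (fun μ => δ ν μ) = xl ν * φ := fun ν => by
    rw [dot, Finset.sum_eq_single ν]
    · simp only [hδ, if_true, xl]; algebra
    · intro c _ hc; simp [hδ, hc.symm]
    · simp
  -- `T` contracts with `x` to a multiple of `σ`, so it can adjust the divergence without affecting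
  -- the contraction modulo `σ`.
  set T : Fin (n + 1) → Fin (n + 1) → Poly n := fun μ ν =>
    (m + 1 : ℝ) • δ μ ν - (xl μ * pderiv ν φ + xl ν * pderiv μ φ) with hT
  have hTdvb : ∀ ν, dvb T ν = (-(n + 1 + (n - 1) * (m + 1) / 2) : ℝ) • pderiv ν φ := fun ν => by
    simp only [hT]
    rw [dvb_sub, dvb_smul, dvb_add, dvb, dvb, dvb, hδdv, hδtr, tr_xl_mul (fun ν => pderiv ν φ),
      tr_xl_mul' (fun μ => pderiv μ φ), dv_xl_mul (isHomogeneous_pderiv ν hφh), dot_grad hφh,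
      dv_xl_mul_left ν (fun μ => pderiv μ φ), dv_grad, hφl, pderiv_smul, pderiv_smul]
    push_cast
    algebra
  have hTdot : ∀ ν, dot (fun μ => T ν μ) = - (sig n * pderiv ν φ) := fun ν => by
    simp only [hT]
    rw [dot_sub, dot_smul, hδdot, dot_add, dot_mul, dot_grad hφh, dot_mul_right, dot_xl]
    push_cast
    algebra
  -- Contracting the symmetrized gradient of `Y` with `x` gives `(m + 1) Y` plus the gradient of
  -- `x·Y`. The Hessian term, with `b = 1 / (m + 2)`, removes that gradient.
  set R : Fin (n + 1) → Fin (n + 1) → Poly n := fun μ ν =>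
    (pderiv μ (Y ν) + pderiv ν (Y μ)) - b • pderiv μ (pderiv ν (dot Y)) with hR
  have hRdvb : ∀ ν, dvb R ν = -(b • pderiv ν φ) := fun ν => by
    simp only [hR]
    rw [dvb_sub, dvb_pderiv_symm, hYl, dvb_smul, dvb, dv_grad, lap_pderiv, hdotl]
    have : tr (fun μ ν => pderiv μ (pderiv ν (dot Y))) = (2 : ℝ) • φ := by
      rw [← hdotl]; rfl
    rw [this, pderiv_smul]; algebra
  have hRdot : ∀ ν, dot (fun μ => R ν μ) = (m + 1 : ℝ) • Y ν := fun ν => by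
    simp only [hR]
    rw [dot_sub, dot_add, dot_pderiv, dot_smul]
    simp only [pderiv_comm ν]
    rw [dot_grad (hYh ν), dot_grad (isHomogeneous_pderiv ν hdoth)]
    have : (b * (m + 2)) • pderiv ν (dot Y) = pderiv ν (dot Y) := by rw [hb', one_smul]
    push_cast
    linear_combination (norm := algebra) -this
  have hRh : ∀ μ ν, (R μ ν).IsHomogeneous (m + 1) := fun μ ν =>
    ((isHomogeneous_pderiv μ (hYh ν)).add (isHomogeneous_pderiv ν (hYh μ))).sub
      (isHomogeneous_smul _ (isHomogeneous_pderiv μ (isHomogeneous_pderiv ν hdoth)))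
  have hδh : ∀ μ ν, (δ μ ν).IsHomogeneous (m + 1) := fun μ ν => by
    simp only [hδ]; split_ifs
    · exact isHomogeneous_smul _ hφh
    · exact isHomogeneous_zero _ _ _
  have hTh : ∀ μ ν, (T μ ν).IsHomogeneous (m + 1) := fun μ ν =>
    (isHomogeneous_smul _ (hδh μ ν)).sub
      ((isHomogeneous_xl_mul μ (isHomogeneous_pderiv ν hφh)).add
        (isHomogeneous_xl_mul ν (isHomogeneous_pderiv μ hφh)))
  refine ⟨fun μ ν => a • R μ ν + κ • T μ ν, fun ν => -w ν - κ • pderiv ν φ,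
    fun μ ν => (isHomogeneous_smul _ (hRh μ ν)).add (isHomogeneous_smul _ (hTh μ ν)),
    fun μ ν => ?_, fun ν => (hw ν).neg.sub (isHomogeneous_smul _ (isHomogeneous_pderiv ν hφh)),
    fun ν => ?_, fun ν => ?_⟩
  · simp only [hR, hT]
    rw [hδs μ ν, pderiv_comm μ ν, add_comm (pderiv μ (Y ν)), add_comm (xl μ * _)]
  · rw [dvb_add, dvb_smul, dvb_smul, hRdvb, hTdvb]
    have : (κ * (n + 1 + (n - 1) * (m + 1) / 2)) • pderiv ν φ = (-(a * b)) • pderiv ν φ := by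
      rw [hκ']
    linear_combination (norm := algebra) -this
  · rw [dot_add, dot_smul, dot_smul, hRdot, hTdot]
    have : (a * (m + 1)) • Y ν = Y ν := by rw [ha', one_smul]
    have h2 : Y ν = W ν - sig n * w ν := rfl
    linear_combination (norm := algebra) this + h2

end

section

open MvPolynomial
variable {n : ℕ}

/-! ### Vanishing orders at the origin -/

/-- `f` is smooth at the origin and `f = O(|x|^k)`. -/
def Ord (k : ℕ) (f : Coord n → ℝ) : Prop :=
  ContDiffAt ℝ ∞ f 0 ∧ f =O[𝓝 0] fun x => ‖x‖ ^ k

/-- Evaluation of a polynomial. -/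
def ev (p : Poly n) (x : Coord n) : ℝ := eval (fun i => x i) p

lemma sum_smul_single (v : Coord n) : v = ∑ μ, v μ • EuclideanSpace.single μ (1 : ℝ) := by
  ext i
  simp [Finset.sum_apply, Pi.single_apply]

lemma fderiv_apply_eq_sum (f : Coord n → ℝ) (x v : Coord n) :
    fderiv ℝ f x v = ∑ μ, v μ * pd μ f x := by
  conv_lhs => rw [sum_smul_single v]
  simp [pd]

lemma abs_apply_le (x : Coord n) (i : Fin (n + 1)) : |x i| ≤ ‖x‖ := by
  have := PiLp.norm_apply_le x i
  rwa [Real.norm_eq_abs] at this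

lemma norm_fderiv_le_sum (f : Coord n → ℝ) (x : Coord n) :
    ‖fderiv ℝ f x‖ ≤ ∑ μ, |pd μ f x| := by
  refine ContinuousLinearMap.opNorm_le_bound _ (Finset.sum_nonneg fun _ _ => abs_nonneg _) ?_
  intro v
  rw [fderiv_apply_eq_sum, Finset.sum_mul]
  refine (Finset.abs_sum_le_sum_abs _ _).trans (Finset.sum_le_sum fun μ _ => ?_)
  rw [abs_mul, mul_comm]
  exact mul_le_mul_of_nonneg_left (abs_apply_le v μ) (abs_nonneg _)

/-! ### Calculus of the partial derivatives `pd`. -/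

section Pd

variable {f g : Coord n → ℝ} {x : Coord n}

lemma pd_add (μ : Fin (n + 1)) (hf : DifferentiableAt ℝ f x) (hg : DifferentiableAt ℝ g x) :
    pd μ (fun z => f z + g z) x = pd μ f x + pd μ g x := by
  simp only [pd]; rw [fderiv_fun_add hf hg]; rfl

lemma pd_sub (μ : Fin (n + 1)) (hf : DifferentiableAt ℝ f x) (hg : DifferentiableAt ℝ g x) :
    pd μ (fun z => f z - g z) x = pd μ f x - pd μ g x := by
  simp only [pd]; rw [fderiv_fun_sub hf hg]; rfl

lemma pd_mul (μ : Fin (n + 1)) (hf : DifferentiableAt ℝ f x) (hg : DifferentiableAt ℝ g x) :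
    pd μ (fun z => f z * g z) x = pd μ f x * g x + f x * pd μ g x := by
  simp only [pd]; rw [fderiv_fun_mul hf hg]; simp; ring

lemma pd_const (μ : Fin (n + 1)) (c : ℝ) (x : Coord n) : pd μ (fun _ => c) x = 0 := by
  simp [pd]

lemma pd_sum {ι : Type*} (s : Finset ι) (μ : Fin (n + 1)) {F : ι → Coord n → ℝ}
    (hF : ∀ i ∈ s, DifferentiableAt ℝ (F i) x) :
    pd μ (fun z => ∑ i ∈ s, F i z) x = ∑ i ∈ s, pd μ (F i) x := by
  simp only [pd]; rw [fderiv_fun_sum hF]; simp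

lemma hasFDerivAt_coord (μ : Fin (n + 1)) (x : Coord n) :
    HasFDerivAt (fun z : Coord n => z μ) (EuclideanSpace.proj μ : Coord n →L[ℝ] ℝ) x :=
  (EuclideanSpace.proj μ : Coord n →L[ℝ] ℝ).hasFDerivAt

lemma contDiff_coord {m : WithTop ℕ∞} (μ : Fin (n + 1)) :
    ContDiff ℝ m (fun z : Coord n => z μ) :=
  (EuclideanSpace.proj μ : Coord n →L[ℝ] ℝ).contDiff

lemma pd_coord (μ ν : Fin (n + 1)) (x : Coord n) :
    pd μ (fun z : Coord n => z ν) x = if ν = μ then 1 else 0 := by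
  rw [pd, (hasFDerivAt_coord ν x).fderiv]
  simp

lemma pd_congr (μ : Fin (n + 1)) (h : f =ᶠ[𝓝 x] g) : pd μ f =ᶠ[𝓝 x] pd μ g := by
  filter_upwards [h.fderiv (𝕜 := ℝ)] with z hz
  simp only [pd, hz]

lemma contDiffAt_pd (μ : Fin (n + 1)) (hf : ContDiffAt ℝ ∞ f x) : ContDiffAt ℝ ∞ (pd μ f) x :=
  (hf.fderiv_right (m := ∞) (by simp)).clm_apply contDiffAt_const

lemma contDiff_pd (μ : Fin (n + 1)) (hf : ContDiff ℝ ∞ f) : ContDiff ℝ ∞ (pd μ f) :=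
  contDiff_iff_contDiffAt.2 fun _ => contDiffAt_pd μ hf.contDiffAt

lemma eventually_differentiableAt (hf : ContDiffAt ℝ ∞ f x) :
    ∀ᶠ z in 𝓝 x, DifferentiableAt ℝ f z := by
  have h1 : ContDiffAt ℝ 1 f x := hf.of_le (by exact_mod_cast le_top)
  filter_upwards [h1.eventually (by simp)] with z hz
  exact hz.differentiableAt (by simp)

lemma pd_pd_comm (μ ν : Fin (n + 1)) (hf : ContDiffAt ℝ 2 f x) :
    pd μ (pd ν f) x = pd ν (pd μ f) x := by
  have hd : DifferentiableAt ℝ (fderiv ℝ f) x :=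
    (hf.fderiv_right (m := 1) (by norm_num)).differentiableAt (by simp)
  have h := (hf.isSymmSndFDerivAt (by simp)).eq
    (EuclideanSpace.single μ 1) (EuclideanSpace.single ν 1)
  have e : ∀ a b : Fin (n + 1), pd a (pd b f) x =
      fderiv ℝ (fderiv ℝ f) x (EuclideanSpace.single a 1) (EuclideanSpace.single b 1) := by
    intro a b
    have : HasFDerivAt (fun z => fderiv ℝ f z (EuclideanSpace.single b 1))
        ((fderiv ℝ (fderiv ℝ f) x).flip (EuclideanSpace.single b 1)) x := by
      simpa using hd.hasFDerivAt.clm_apply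
        (hasFDerivAt_const (EuclideanSpace.single b (1 : ℝ)) x)
    change fderiv ℝ (fun z => fderiv ℝ f z (EuclideanSpace.single b 1)) x _ = _
    rw [this.fderiv]; rfl
  rw [e, e, h]

lemma pd_pd_comm_eventually (μ ν : Fin (n + 1)) (hf : ContDiffAt ℝ ∞ f x) :
    pd μ (pd ν f) =ᶠ[𝓝 x] pd ν (pd μ f) := by
  have h1 : ContDiffAt ℝ 2 f x := contDiffAt_infty.1 hf 2
  filter_upwards [h1.eventually (by simp)] with z hz
  exact pd_pd_comm μ ν hz

lemma pd_sub_eventually (μ : Fin (n + 1)) (hf : ContDiffAt ℝ ∞ f x) (hg : ContDiffAt ℝ ∞ g x) :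
    pd μ (fun z => f z - g z) =ᶠ[𝓝 x] fun z => pd μ f z - pd μ g z := by
  filter_upwards [eventually_differentiableAt hf, eventually_differentiableAt hg] with z h1 h2
  exact pd_sub μ h1 h2

end Pd

/-! ### Polynomials as smooth functions. -/

lemma ev_add (p q : Poly n) : ev (p + q) = fun x => ev p x + ev q x := by
  funext x; simp [ev]

lemma ev_sub (p q : Poly n) : ev (p - q) = fun x => ev p x - ev q x := by
  funext x; simp [ev]

lemma ev_mul (p q : Poly n) : ev (p * q) = fun x => ev p x * ev q x := by
  funext x; simp [ev]

lemma ev_smul (c : ℝ) (p : Poly n) : ev (c • p) = fun x => c * ev p x := by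
  funext x; simp [ev, smul_eval]

lemma ev_neg (p : Poly n) : ev (-p) = fun x => -ev p x := by
  funext x; simp [ev]

lemma ev_zero : ev (0 : Poly n) = fun _ => 0 := by
  funext x; simp [ev]

lemma ev_X (μ : Fin (n + 1)) : ev (X μ : Poly n) = fun x => x μ := by
  funext x; simp [ev]

lemma ev_C (c : ℝ) : ev (C c : Poly n) = fun _ => c := by
  funext x; simp [ev]

lemma ev_sum {ι : Type*} (s : Finset ι) (p : ι → Poly n) :
    ev (∑ i ∈ s, p i) = fun x => ∑ i ∈ s, ev (p i) x := by
  funext x; simp [ev]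

lemma contDiff_ev (p : Poly n) : ContDiff ℝ ∞ (ev p) := by
  induction p using MvPolynomial.induction_on with
  | C a => rw [ev_C]; exact contDiff_const
  | add p q hp hq => rw [ev_add]; exact hp.add hq
  | mul_X p i hp => rw [ev_mul, ev_X]; exact hp.mul (contDiff_coord i)

lemma differentiable_ev (p : Poly n) : Differentiable ℝ (ev p) :=
  (contDiff_ev p).differentiable (by simp)

lemma pd_ev (μ : Fin (n + 1)) (p : Poly n) : pd μ (ev p) = ev (pderiv μ p) := by
  funext x
  induction p using MvPolynomial.induction_on with
  | C a => rw [ev_C, pderiv_C, ev_zero, pd_const]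
  | add p q hp hq =>
    rw [ev_add, map_add, ev_add, pd_add μ (differentiable_ev p x) (differentiable_ev q x), hp, hq]
  | mul_X p i hp =>
    rw [Derivation.leibniz, ev_mul, ev_add, ev_X, smul_eq_mul, smul_eq_mul, ev_mul, ev_mul, ev_X,
      pd_mul μ (differentiable_ev p x) (hasFDerivAt_coord i x).differentiableAt, hp, pd_coord,
      pderiv_X']
    by_cases h : i = μ
    · simp [h, ev]; ring
    · simp [h, ev]; ring

lemma ev_smul_of_isHomogeneous {p : Poly n} {d : ℕ} (hp : p.IsHomogeneous d) (t : ℝ)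
    (x : Coord n) : ev p (t • x) = t ^ d * ev p x := by
  simp only [ev, eval_eq', Finset.mul_sum]
  refine Finset.sum_congr rfl fun m hm => ?_
  have hd : ∑ i, m i = d := by
    have := hp.degree_eq_sum_deg_support hm
    rw [this]
    exact (Finset.sum_subset (Finset.subset_univ _) fun i _ hi => by simpa using hi).symm
  simp only [PiLp.smul_apply, smul_eq_mul, mul_pow, Finset.prod_mul_distrib]
  rw [Finset.prod_pow_eq_pow_sum, hd]
  ring

lemma isBigO_coord (μ : Fin (n + 1)) : (fun x : Coord n => x μ) =O[𝓝 0] fun x => ‖x‖ ^ 1 :=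
  Asymptotics.IsBigO.of_bound 1 (Filter.Eventually.of_forall fun x => by
    simpa using abs_apply_le x μ)

/-- A homogeneous polynomial of degree `d` is bounded by a multiple of `|x|^d`. -/
lemma exists_ev_le {p : Poly n} {d : ℕ} (hp : p.IsHomogeneous d) :
    ∃ C : ℝ, 0 ≤ C ∧ ∀ x, |ev p x| ≤ C * ‖x‖ ^ d := by
  refine ⟨∑ m ∈ p.support, |coeff m p|, Finset.sum_nonneg fun _ _ => abs_nonneg _, fun x => ?_⟩
  simp only [ev, eval_eq', Finset.sum_mul]
  refine (Finset.abs_sum_le_sum_abs _ _).trans (Finset.sum_le_sum fun m hm => ?_)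
  have hd : ∑ i, m i = d := by
    have := hp.degree_eq_sum_deg_support hm
    rw [this]
    exact (Finset.sum_subset (Finset.subset_univ _) fun i _ hi => by simpa using hi).symm
  rw [abs_mul]
  refine mul_le_mul_of_nonneg_left ?_ (abs_nonneg _)
  rw [Finset.abs_prod, ← hd, ← Finset.prod_pow_eq_pow_sum]
  refine Finset.prod_le_prod (fun _ _ => abs_nonneg _) fun i _ => ?_
  rw [abs_pow]
  exact pow_le_pow_left₀ (abs_nonneg _) (abs_apply_le x i) _

lemma ord_ev {p : Poly n} {d : ℕ} (hp : p.IsHomogeneous d) : Ord d (ev p) := by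
  refine ⟨(contDiff_ev p).contDiffAt, ?_⟩
  obtain ⟨C, _, h⟩ := exists_ev_le hp
  exact Asymptotics.IsBigO.of_bound C (Filter.Eventually.of_forall fun x => by simpa using h x)

/-! ### Algebra of vanishing orders, and their characterization by derivatives. -/

lemma isBigO_norm_pow {j k : ℕ} (h : j ≤ k) :
    (fun x : Coord n => ‖x‖ ^ k) =O[𝓝 0] fun x => ‖x‖ ^ j := by
  refine Asymptotics.IsBigO.of_bound 1 ?_
  filter_upwards [Metric.ball_mem_nhds (0 : Coord n) one_pos] with x hx
  rw [mem_ball_zero_iff] at hx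
  simpa using pow_le_pow_of_le_one (norm_nonneg x) hx.le h

lemma Ord.mono {j k : ℕ} {f : Coord n → ℝ} (hf : Ord k f) (h : j ≤ k) : Ord j f :=
  ⟨hf.1, hf.2.trans (isBigO_norm_pow h)⟩

lemma Ord.add {k : ℕ} {f g : Coord n → ℝ} (hf : Ord k f) (hg : Ord k g) :
    Ord k (fun x => f x + g x) := ⟨hf.1.add hg.1, hf.2.add hg.2⟩

lemma Ord.sub {k : ℕ} {f g : Coord n → ℝ} (hf : Ord k f) (hg : Ord k g) :
    Ord k (fun x => f x - g x) := ⟨hf.1.sub hg.1, hf.2.sub hg.2⟩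

lemma Ord.neg {k : ℕ} {f : Coord n → ℝ} (hf : Ord k f) : Ord k (fun x => -f x) :=
  ⟨hf.1.neg, hf.2.neg_left⟩

lemma Ord.const_mul {k : ℕ} {f : Coord n → ℝ} (c : ℝ) (hf : Ord k f) :
    Ord k (fun x => c * f x) := ⟨contDiffAt_const.mul hf.1, hf.2.const_mul_left c⟩

lemma Ord.mul {j k : ℕ} {f g : Coord n → ℝ} (hf : Ord j f) (hg : Ord k g) :
    Ord (j + k) (fun x => f x * g x) :=
  ⟨hf.1.mul hg.1, by simpa only [pow_add] using hf.2.mul hg.2⟩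

lemma ord_zero_iff {f : Coord n → ℝ} : Ord 0 f ↔ ContDiffAt ℝ ∞ f 0 := by
  refine ⟨fun h => h.1, fun h => ⟨h, ?_⟩⟩
  simp only [pow_zero]
  exact h.continuousAt.norm.isBoundedUnder_le.isBigO_one ℝ

lemma Ord.mul_smooth {k : ℕ} {f g : Coord n → ℝ} (hf : Ord k f) (hg : ContDiffAt ℝ ∞ g 0) :
    Ord k (fun x => f x * g x) := hf.mul (ord_zero_iff.2 hg)

lemma Ord.smooth_mul {k : ℕ} {f g : Coord n → ℝ} (hg : ContDiffAt ℝ ∞ g 0) (hf : Ord k f) :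
    Ord k (fun x => g x * f x) := by
  have := (ord_zero_iff.2 hg).mul hf
  rwa [zero_add] at this

lemma ord_const_zero (k : ℕ) : Ord k (fun _ : Coord n => (0 : ℝ)) :=
  ⟨contDiffAt_const, Asymptotics.isBigO_zero _ _⟩

lemma Ord.sum {ι : Type*} {s : Finset ι} {k : ℕ} {F : ι → Coord n → ℝ}
    (h : ∀ i ∈ s, Ord k (F i)) : Ord k (fun x => ∑ i ∈ s, F i x) :=
  ⟨ContDiffAt.sum fun i hi => (h i hi).1, Asymptotics.IsBigO.fun_sum fun i hi => (h i hi).2⟩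

lemma Ord.congr {k : ℕ} {f g : Coord n → ℝ} (hf : Ord k f) (h : f =ᶠ[𝓝 0] g) : Ord k g :=
  ⟨hf.1.congr_of_eventuallyEq h.symm, hf.2.congr' h Filter.EventuallyEq.rfl⟩

lemma ord_coord (μ : Fin (n + 1)) : Ord 1 (fun x : Coord n => x μ) :=
  ⟨(contDiff_coord μ).contDiffAt, isBigO_coord μ⟩

lemma Ord.apply_zero {k : ℕ} {f : Coord n → ℝ} (hf : Ord (k + 1) f) : f 0 = 0 := by
  obtain ⟨c, hc⟩ := hf.2.bound
  have := hc.self_of_nhds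
  simpa using this

/-- A homogeneous polynomial of degree `d` that is `O(|x|^{d+1})` vanishes. -/
lemma eq_zero_of_ord {p : Poly n} {d : ℕ} (hp : p.IsHomogeneous d)
    (h : ev p =O[𝓝 0] fun x => ‖x‖ ^ (d + 1)) : p = 0 := by
  refine hp.eq_zero_of_forall_eval_eq_zero fun v => ?_
  set x : Coord n := WithLp.toLp 2 v with hx
  have hv : eval v p = ev p x := rfl
  rw [hv]
  obtain ⟨c, hc⟩ := h.bound
  have htend : Filter.Tendsto (fun t : ℝ => t • x) (𝓝[>] 0) (𝓝 0) := by
    have : Filter.Tendsto (fun t : ℝ => t • x) (𝓝 0) (𝓝 ((0 : ℝ) • x)) :=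
      (continuous_id.smul continuous_const).tendsto 0
    rw [zero_smul] at this
    exact this.mono_left nhdsWithin_le_nhds
  have hev : ∀ᶠ t in 𝓝[>] (0 : ℝ), |ev p x| ≤ t * (c * ‖x‖ ^ (d + 1)) := by
    filter_upwards [htend.eventually hc, self_mem_nhdsWithin] with t ht ht0
    have ht0' : (0 : ℝ) < t := ht0
    rw [ev_smul_of_isHomogeneous hp] at ht
    simp only [Real.norm_eq_abs, abs_mul, abs_pow, abs_norm, norm_smul, mul_pow,
      abs_of_pos ht0'] at ht
    have : t ^ d * |ev p x| ≤ t ^ d * (t * (c * ‖x‖ ^ (d + 1))) := by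
      calc _ ≤ _ := ht
        _ = _ := by ring
    exact le_of_mul_le_mul_left this (by positivity)
  have hlim : Filter.Tendsto (fun t : ℝ => t * (c * ‖x‖ ^ (d + 1))) (𝓝[>] 0) (𝓝 0) := by
    have : Filter.Tendsto (fun t : ℝ => t * (c * ‖x‖ ^ (d + 1))) (𝓝 0)
        (𝓝 (0 * (c * ‖x‖ ^ (d + 1)))) := (continuous_id.mul continuous_const).tendsto 0
    rw [zero_mul] at this
    exact this.mono_left nhdsWithin_le_nhds
  have := ge_of_tendsto hlim hev
  exact abs_nonpos_iff.1 this

/-- All derivatives of order less than `k` of `f` vanish at the origin. -/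
def Jet : ℕ → (Coord n → ℝ) → Prop
  | 0, f => ContDiffAt ℝ ∞ f 0
  | k + 1, f => ContDiffAt ℝ ∞ f 0 ∧ f 0 = 0 ∧ ∀ μ, Jet k (pd μ f)

lemma Jet.smooth {k : ℕ} {f : Coord n → ℝ} (h : Jet k f) : ContDiffAt ℝ ∞ f 0 := by
  cases k with
  | zero => exact h
  | succ k => exact h.1

lemma Jet.congr {k : ℕ} : ∀ {f g : Coord n → ℝ}, Jet k f → f =ᶠ[𝓝 0] g → Jet k g := by
  induction k with
  | zero => intro f g hf h; exact ContDiffAt.congr_of_eventuallyEq hf h.symm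
  | succ k ih =>
    intro f g hf h
    exact ⟨hf.1.congr_of_eventuallyEq h.symm, by rw [← h.self_of_nhds]; exact hf.2.1,
      fun μ => ih (hf.2.2 μ) (pd_congr μ h)⟩

lemma Jet.sub {k : ℕ} : ∀ {f g : Coord n → ℝ}, Jet k f → Jet k g →
    Jet k (fun x => f x - g x) := by
  induction k with
  | zero => intro f g hf hg; exact ContDiffAt.sub hf hg
  | succ k ih =>
    intro f g hf hg
    exact ⟨hf.1.sub hg.1, by simp [hf.2.1, hg.2.1],
      fun μ => (ih (hf.2.2 μ) (hg.2.2 μ)).congr (pd_sub_eventually μ hf.1 hg.1).symm⟩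

/-- By induction the gradient is `O(|x|^k)`. The mean value inequality on the closed ball of radius
`|x|` gains one power. -/
lemma Jet.isBigO {k : ℕ} : ∀ {f : Coord n → ℝ}, Jet k f → f =O[𝓝 0] fun x => ‖x‖ ^ k := by
  induction k with
  | zero => intro f hf; exact (ord_zero_iff.2 hf).2
  | succ k ih =>
    intro f hf
    have h1 : (fun x => ∑ μ, |pd μ f x|) =O[𝓝 0] fun x : Coord n => ‖x‖ ^ k :=
      Asymptotics.IsBigO.fun_sum fun μ _ => (ih (hf.2.2 μ)).abs_left
    obtain ⟨c, hc⟩ := h1.bound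
    obtain ⟨δ, hδ, hball⟩ := Metric.eventually_nhds_iff_ball.1
      (hc.and (eventually_differentiableAt hf.1))
    refine Asymptotics.IsBigO.of_bound c ?_
    filter_upwards [Metric.ball_mem_nhds (0 : Coord n) hδ] with x hx
    rw [mem_ball_zero_iff] at hx
    -- The constant hidden in the `O` carries no sign, but the bound at a point `x ≠ 0` forces it to
    -- be nonnegative.
    have hc0 : 0 ≤ c ∨ x = 0 := by
      by_cases hx0 : x = 0
      · exact Or.inr hx0
      · left
        have h := (hball x (by rwa [mem_ball_zero_iff])).1
        have h2 := (norm_nonneg _).trans h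
        rw [norm_pow, norm_norm] at h2
        exact nonneg_of_mul_nonneg_left h2 (pow_pos (norm_pos_iff.2 hx0) k)
    rcases hc0 with hc0 | rfl
    · have hsub : ∀ y ∈ Metric.closedBall (0 : Coord n) ‖x‖, y ∈ Metric.ball (0 : Coord n) δ :=
        fun y hy => by
          rw [mem_closedBall_zero_iff] at hy; rw [mem_ball_zero_iff]; exact hy.trans_lt hx
      have := (convex_closedBall (0 : Coord n) ‖x‖).norm_image_sub_le_of_norm_fderiv_le
        (𝕜 := ℝ) (f := f) (C := c * ‖x‖ ^ k)
        (fun y hy => (hball y (hsub y hy)).2)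
        (fun y hy => by
          refine (norm_fderiv_le_sum f y).trans ?_
          have h3 := (hball y (hsub y hy)).1
          rw [Real.norm_of_nonneg (Finset.sum_nonneg fun _ _ => abs_nonneg _), norm_pow,
            norm_norm] at h3
          rw [mem_closedBall_zero_iff] at hy
          exact h3.trans (mul_le_mul_of_nonneg_left (pow_le_pow_left₀ (norm_nonneg _) hy _) hc0))
        (Metric.mem_closedBall_self (norm_nonneg x)) (by simp : x ∈ Metric.closedBall 0 ‖x‖)
      rw [hf.2.1, sub_zero, sub_zero] at this
      rw [norm_pow, norm_norm, pow_succ, ← mul_assoc]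
      exact this
    · simp [hf.2.1]

/-- The leading parts `p_μ` of the `∂_μ f` form a closed polynomial one-form, because second
derivatives commute and a homogeneous polynomial of too high an order vanishes. Euler's identity
gives its primitive `x^μ p_μ / (k + 1)`, which is the leading part of `f`. -/
lemma Jet.exists_taylor {k : ℕ} : ∀ {f : Coord n → ℝ}, Jet k f →
    ∃ p : Poly n, p.IsHomogeneous k ∧ Jet (k + 1) (fun x => f x - ev p x) := by
  induction k with
  | zero =>
    intro f hf
    have h1 : ContDiffAt ℝ ∞ (fun x => f x - ev (C (f 0)) x) 0 :=
      ContDiffAt.sub hf (contDiff_ev _).contDiffAt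
    refine ⟨C (f 0), isHomogeneous_C _ _, h1, by simp [ev], fun μ => contDiffAt_pd μ h1⟩
  | succ k ih =>
    intro f hf
    choose p hp hpf using fun μ => ih (hf.2.2 μ)
    have hsymm : ∀ μ ν, pderiv ν (p μ) = pderiv μ (p ν) := by
      intro μ ν
      cases k with
      | zero =>
        have h0 : ∀ μ, ∃ c, p μ = C c := fun μ => by
          have := hp μ
          rw [← totalDegree_zero_iff_isHomogeneous, totalDegree_eq_zero_iff_eq_C] at this
          exact ⟨_, this⟩
        obtain ⟨c, hc⟩ := h0 μ
        obtain ⟨d, hd⟩ := h0 ν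
        rw [hc, hd, pderiv_C, pderiv_C]
      | succ i =>
        rw [← sub_eq_zero]
        refine eq_zero_of_ord ((isHomogeneous_pderiv ν (hp μ)).sub
          (isHomogeneous_pderiv μ (hp ν))) (Jet.isBigO ?_)
        have h1 := ((hpf ν).2.2 μ).sub ((hpf μ).2.2 ν)
        refine h1.congr ?_
        filter_upwards [pd_sub_eventually μ (contDiffAt_pd ν hf.1)
          (contDiff_ev (p ν)).contDiffAt, pd_sub_eventually ν (contDiffAt_pd μ hf.1)
          (contDiff_ev (p μ)).contDiffAt, pd_pd_comm_eventually μ ν hf.1] with x e1 e2 e3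
        rw [e1, e2, e3, pd_ev, pd_ev, ev_sub]; ring
    set q : Poly n := (1 / (k + 1) : ℝ) • dot p with hq
    have hqh : q.IsHomogeneous (k + 1) := isHomogeneous_smul _ (isHomogeneous_dot hp)
    have hqd : ∀ ν, pderiv ν q = p ν := by
      intro ν
      have h1 : pderiv ν (dot p) = p ν + dot (fun μ => pderiv μ (p ν)) := by
        have := dot_pderiv ν p
        simp only [hsymm _ ν] at this
        rw [this]; ring
      have h2 : dot (fun μ => pderiv μ (p ν)) = (k : ℝ) • p ν := dot_grad (hp ν)
      have h3 : (1 / (k + 1) * (k + 1) : ℝ) • p ν = p ν := by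
        rw [one_div, inv_mul_cancel₀ (by positivity), one_smul]
      rw [hq, pderiv_smul, h1, h2]
      linear_combination (norm := algebra) h3
    have h1 : ContDiffAt ℝ ∞ (fun x => f x - ev q x) 0 := hf.1.sub (contDiff_ev _).contDiffAt
    have h0 : ev q 0 = 0 := by
      have := ev_smul_of_isHomogeneous hqh 0 (0 : Coord n)
      rw [smul_zero] at this
      rw [this]; simp
    refine ⟨q, hqh, h1, by simp [hf.2.1, h0], fun μ => (hpf μ).congr ?_⟩
    filter_upwards [pd_sub_eventually μ hf.1 (contDiff_ev q).contDiffAt] with x e1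
    rw [e1, pd_ev, hqd]

/-- For a smooth function, decay forces derivatives to vanish. If those of order below `j` vanish
and `j < k`, then the leading part of degree `j` is `O(|x|^{j+1})`, hence zero. This is what allows
`Ord` bounds to be differentiated. -/
lemma ord_iff_jet {k : ℕ} {f : Coord n → ℝ} : Ord k f ↔ Jet k f := by
  refine ⟨fun h => ?_, fun h => ⟨h.smooth, h.isBigO⟩⟩
  have : ∀ j ≤ k, Jet j f := by
    intro j
    induction j with
    | zero => intro _; exact h.1
    | succ j ih =>
      intro hj
      obtain ⟨p, hp, hpf⟩ := (ih (by omega)).exists_taylor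
      have h1 : ev p =O[𝓝 0] fun x => ‖x‖ ^ (j + 1) := by
        have := (h.2.trans (isBigO_norm_pow hj)).sub hpf.isBigO
        simpa using this
      have h2 := eq_zero_of_ord hp h1
      rw [h2, ev_zero] at hpf
      simpa using hpf
  exact this k le_rfl

lemma Ord.pd {k : ℕ} {f : Coord n → ℝ} (hf : Ord (k + 1) f) (μ : Fin (n + 1)) :
    Ord k (pd μ f) := ord_iff_jet.2 ((ord_iff_jet.1 hf).2.2 μ)

/-- The leading part of a smooth function that is `O(|x|^k)`. -/
lemma Ord.exists_taylor {k : ℕ} {f : Coord n → ℝ} (hf : Ord k f) :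
    ∃ p : Poly n, p.IsHomogeneous k ∧ Ord (k + 1) (fun x => f x - ev p x) := by
  obtain ⟨p, hp, h⟩ := (ord_iff_jet.1 hf).exists_taylor
  exact ⟨p, hp, ord_iff_jet.2 h⟩

end

section

open MvPolynomial
variable {n : ℕ}

/-! ### Composition with smooth functions -/

section Comp

variable {E : Type*} [NormedAddCommGroup E] [NormedSpace ℝ E] {Ψ : E → ℝ} {a : E}
  {u v : Coord n → E}

lemma ord_comp_sub (hΨ : ContDiffAt ℝ ∞ Ψ a) (hu : ContDiffAt ℝ ∞ u 0) (hv : ContDiffAt ℝ ∞ v 0)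
    (hu0 : u 0 = a) (hv0 : v 0 = a) {k : ℕ} (h : (fun x => v x - u x) =O[𝓝 0] fun x => ‖x‖ ^ k) :
    Ord k (fun x => Ψ (v x) - Ψ (u x)) := by
  have hΨu : ContDiffAt ℝ ∞ Ψ (u 0) := by rwa [hu0]
  have hΨv : ContDiffAt ℝ ∞ Ψ (v 0) := by rwa [hv0]
  refine ⟨(hΨv.comp 0 hv).sub (hΨu.comp 0 hu), ?_⟩
  have hs : HasStrictFDerivAt Ψ (fderiv ℝ Ψ a) a := hΨ.hasStrictFDerivAt (by simp)
  have ht : Filter.Tendsto (fun x => (v x, u x)) (𝓝 0) (𝓝 (a, a)) := by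
    have := (hv.continuousAt.prodMk hu.continuousAt).tendsto
    simpa only [hu0, hv0] using this
  exact (hs.isBigO_sub.comp_tendsto ht).trans h

/-- The derivative of `Ψ` is Lipschitz near `a`. The mean value inequality then bounds the remainder
by `(|u - a| + |v - a|) |v - u|`, which is smaller than `|v - u|` by the order to which `u` and `v`
approach `a`. -/
lemma ord_comp_sub_sub (hΨ : ContDiffAt ℝ ∞ Ψ a) (hu : ContDiffAt ℝ ∞ u 0)
    (hv : ContDiffAt ℝ ∞ v 0) {j k : ℕ}
    (hu0 : (fun x => u x - a) =O[𝓝 0] fun x => ‖x‖ ^ (j + 1))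
    (hv0 : (fun x => v x - a) =O[𝓝 0] fun x => ‖x‖ ^ (j + 1))
    (h : (fun x => v x - u x) =O[𝓝 0] fun x => ‖x‖ ^ k) :
    Ord (k + (j + 1)) (fun x => Ψ (v x) - Ψ (u x) - fderiv ℝ Ψ a (v x - u x)) := by
  have hz : ∀ {w : Coord n → E}, ((fun x => w x - a) =O[𝓝 0] fun x => ‖x‖ ^ (j + 1)) → w 0 = a := by
    intro w hw
    obtain ⟨c, hc⟩ := hw.bound
    have := hc.self_of_nhds
    simpa [sub_eq_zero] using this
  have hΨu : ContDiffAt ℝ ∞ Ψ (u 0) := by rwa [hz hu0]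
  have hΨv : ContDiffAt ℝ ∞ Ψ (v 0) := by rwa [hz hv0]
  refine ⟨((hΨv.comp 0 hv).sub (hΨu.comp 0 hu)).sub
    ((fderiv ℝ Ψ a).contDiff.contDiffAt.comp 0 (hv.sub hu)), ?_⟩
  have h1 : ContDiffAt ℝ 1 (fderiv ℝ Ψ) a := (show ContDiffAt ℝ 2 Ψ a from contDiffAt_infty.1 hΨ 2).fderiv_right
    (by norm_num)
  obtain ⟨K, t, ht, hK⟩ := h1.exists_lipschitzOnWith
  have h2 : ∀ᶠ y in 𝓝 a, DifferentiableAt ℝ Ψ y := by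
    filter_upwards [(hΨ.of_le (m := 1) (by exact_mod_cast le_top)).eventually (by simp)] with z hz
    exact hz.differentiableAt (by simp)
  obtain ⟨δ, hδ, hball⟩ := Metric.eventually_nhds_iff_ball.1 (h2.and ht)
  have hmain : ∀ y ∈ Metric.ball a δ, ∀ z ∈ Metric.ball a δ,
      ‖Ψ z - Ψ y - fderiv ℝ Ψ a (z - y)‖ ≤ K * (‖y - a‖ + ‖z - a‖) * ‖z - y‖ := by
    intro y hy z hz
    set ρ := max ‖y - a‖ ‖z - a‖ with hρ
    have hρδ : ρ < δ := max_lt (by simpa [dist_eq_norm] using hy) (by simpa [dist_eq_norm] using hz)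
    have hsub : ∀ w ∈ Metric.closedBall a ρ, w ∈ Metric.ball a δ := fun w hw =>
      lt_of_le_of_lt hw hρδ
    have := (convex_closedBall a ρ).norm_image_sub_le_of_norm_hasFDerivWithin_le'
      (𝕜 := ℝ) (f := Ψ) (f' := fderiv ℝ Ψ) (φ := fderiv ℝ Ψ a) (C := K * ρ)
      (fun w hw => ((hball w (hsub w hw)).1.hasFDerivAt).hasFDerivWithinAt)
      (fun w hw => by
        have h3 := hK.dist_le_mul w (hball w (hsub w hw)).2 a (mem_of_mem_nhds ht)
        rw [dist_eq_norm, dist_eq_norm] at h3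
        refine h3.trans (mul_le_mul_of_nonneg_left ?_ K.2)
        rw [← dist_eq_norm]; exact hw)
      (by rw [Metric.mem_closedBall, dist_eq_norm]; exact le_max_left _ _ : y ∈ Metric.closedBall a ρ)
      (by rw [Metric.mem_closedBall, dist_eq_norm]; exact le_max_right _ _ : z ∈ Metric.closedBall a ρ)
    refine this.trans (mul_le_mul_of_nonneg_right (mul_le_mul_of_nonneg_left ?_ K.2)
      (norm_nonneg _))
    exact max_le (by linarith [norm_nonneg (z - a)]) (by linarith [norm_nonneg (y - a)])
  have hub : ∀ᶠ x in 𝓝 (0 : Coord n), u x ∈ Metric.ball a δ := by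
    have := hu.continuousAt.tendsto
    rw [hz hu0] at this
    exact this (Metric.ball_mem_nhds a hδ)
  have hvb : ∀ᶠ x in 𝓝 (0 : Coord n), v x ∈ Metric.ball a δ := by
    have := hv.continuousAt.tendsto
    rw [hz hv0] at this
    exact this (Metric.ball_mem_nhds a hδ)
  have h3 : (fun x => Ψ (v x) - Ψ (u x) - fderiv ℝ Ψ a (v x - u x)) =O[𝓝 0]
      fun x => (‖u x - a‖ + ‖v x - a‖) * ‖v x - u x‖ := by
    refine Asymptotics.IsBigO.of_bound K ?_
    filter_upwards [hub, hvb] with x hx1 hx2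
    refine (hmain _ hx1 _ hx2).trans (le_of_eq ?_)
    rw [Real.norm_of_nonneg (by positivity), mul_assoc]
  refine h3.trans ?_
  have := (hu0.norm_left.add hv0.norm_left).mul h.norm_left
  refine this.congr_right fun x => ?_
  rw [pow_add]; ring

end Comp

/-! ### Smooth functions of matrices -/

/-- Arrays of matrix entries, with the sup norm. -/
abbrev Mat (n : ℕ) : Type := Fin (n + 1) → Fin (n + 1) → ℝ

/-- The entries of a matrix. -/
def ent (A : Matrix (Fin (n + 1)) (Fin (n + 1)) ℝ) : Mat n := fun i j => A i j

@[simp] lemma of_ent (A : Matrix (Fin (n + 1)) (Fin (n + 1)) ℝ) : Matrix.of (ent A) = A := rfl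

lemma contDiff_det {E : Type*} [NormedAddCommGroup E] [NormedSpace ℝ E] {m : ℕ}
    {M : E → Matrix (Fin m) (Fin m) ℝ} (hM : ∀ i j, ContDiff ℝ ∞ fun x => M x i j) :
    ContDiff ℝ ∞ fun x => (M x).det := by
  simp only [Matrix.det_apply]
  exact ContDiff.sum fun σ _ => (contDiff_prod fun i _ => hM _ _).const_smul _

lemma contDiff_entry (i j : Fin (n + 1)) : ContDiff ℝ ∞ fun M : Mat n => M i j :=
  contDiff_apply_apply ℝ ℝ i j

lemma contDiff_matrix_det :
    ContDiff ℝ ∞ fun M : Mat n => Matrix.det (Matrix.of M) :=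
  contDiff_det fun i j => contDiff_entry i j

lemma contDiffAt_matrix_inv {M : Mat n}
    (hM : Matrix.det (Matrix.of M) ≠ 0) (i j : Fin (n + 1)) :
    ContDiffAt ℝ ∞ (fun M : Mat n => (Matrix.of M)⁻¹ i j) M := by
  have h1 : (fun M : Mat n => (Matrix.of M)⁻¹ i j) = fun M : Mat n =>
      (Matrix.det (Matrix.of M))⁻¹ *
        Matrix.adjugate (Matrix.of M) i j := by
    funext M
    rw [Matrix.inv_def, Ring.inverse_eq_inv', Matrix.smul_apply, smul_eq_mul]
  rw [h1]
  refine (contDiff_matrix_det.contDiffAt.inv hM).mul (ContDiff.contDiffAt ?_)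
  simp only [Matrix.adjugate_apply]
  refine contDiff_det fun k l => ?_
  by_cases h : k = j
  · simp only [Matrix.updateRow_apply, h, if_true]; exact contDiff_const
  · simp only [Matrix.updateRow_apply, h, if_false]; exact contDiff_entry k l

lemma contDiffAt_sqrt_abs_det {M : Mat n}
    (hM : Matrix.det (Matrix.of M) ≠ 0) :
    ContDiffAt ℝ ∞ (fun M : Mat n => √|Matrix.det (Matrix.of M)|) M :=
  ((contDiffAt_abs hM).comp M contDiff_matrix_det.contDiffAt).sqrt (abs_ne_zero.2 hM)

lemma eta_apply (μ ν : Fin (n + 1)) : eta n μ ν = if μ = ν then sgn μ else 0 := by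
  simp [eta, Matrix.diagonal_apply, sgn]

lemma eta_mul_self : eta n * eta n = 1 := by
  rw [eta, Matrix.diagonal_mul_diagonal, ← Matrix.diagonal_one]
  congr 1; funext μ; split_ifs <;> norm_num

lemma eta_inv : (eta n)⁻¹ = eta n := Matrix.inv_eq_right_inv eta_mul_self

lemma eta_det : (eta n).det = -1 := by
  rw [eta, Matrix.det_diagonal, Fin.prod_univ_succ]
  simp [Fin.succ_ne_zero]

lemma eta_transpose : (eta n).transpose = eta n := by
  rw [eta, Matrix.diagonal_transpose]

/-- The derivative of `√|det|` at the Minkowski matrix. -/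
lemma fderiv_sqrt_abs_det_eta (h : Mat n) :
    fderiv ℝ (fun M : Mat n => √|Matrix.det (Matrix.of M)|) (ent (eta n)) h =
      (1 / 2) * ∑ μ, sgn μ * h μ μ := by
  set Ψ : Mat n → ℝ := fun M : Mat n =>
    √|Matrix.det (Matrix.of M)| with hΨ
  have hd : (Matrix.det (eta n)) ≠ 0 := by rw [eta_det]; norm_num
  have h1 : HasFDerivAt Ψ (fderiv ℝ Ψ (ent (eta n))) (ent (eta n)) :=
    ((contDiffAt_sqrt_abs_det (M := ent (eta n)) hd).differentiableAt (by simp)).hasFDerivAt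
  have hline : HasDerivAt (fun t : ℝ => ent (eta n) + t • h) h 0 := by
    simpa using ((hasDerivAt_id (0 : ℝ)).smul_const h).const_add (ent (eta n))
  have h2 : HasDerivAt (fun t : ℝ => Ψ (ent (eta n) + t • h)) (fderiv ℝ Ψ (ent (eta n)) h) 0 := by
    have h1' : HasFDerivAt Ψ (fderiv ℝ Ψ (ent (eta n))) (ent (eta n) + (0 : ℝ) • h) := by
      rw [zero_smul, add_zero]; exact h1
    exact h1'.comp_hasDerivAt (0 : ℝ) hline
  set A : Matrix (Fin (n + 1)) (Fin (n + 1)) ℝ := eta n * Matrix.of h with hA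
  -- Along the line, `det (η + t h) = - det (1 + t η h)`, and the linear coefficient of the last
  -- determinant is the trace of `η h`.
  obtain ⟨q, hq⟩ : ∃ q : Polynomial ℝ, ∀ t : ℝ,
      Matrix.det (Matrix.of (ent (eta n) + t • h)) =
        -(1 + A.trace * t + q.eval t * t ^ 2) := by
    refine ⟨(Matrix.det (1 + (Polynomial.X : Polynomial ℝ) • A.map Polynomial.C)).divX.divX,
      fun t => ?_⟩
    rw [← Matrix.det_one_add_smul t A]
    have : Matrix.of (ent (eta n) + t • h) =
        eta n * (1 + t • A) := by
      rw [hA, mul_add, mul_one, Matrix.mul_smul, ← mul_assoc, eta_mul_self, one_mul]; rfl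
    rw [this, Matrix.det_mul, eta_det]; ring
  have hp : HasDerivAt (fun t : ℝ => 1 + A.trace * t + q.eval t * t ^ 2) A.trace 0 := by
    have := (((hasDerivAt_id (0 : ℝ)).const_mul A.trace).const_add 1).add
      ((q.hasDerivAt 0).mul ((hasDerivAt_id (0 : ℝ)).pow 2))
    refine (this.congr_deriv (by simp)).congr_of_eventuallyEq
      (Filter.Eventually.of_forall fun t => ?_)
    simp
  have h3 : HasDerivAt (fun t : ℝ => Ψ (ent (eta n) + t • h)) (A.trace / 2) 0 := by
    have h4 := hp.sqrt (by simp)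
    have h5 : A.trace / (2 * √(1 + A.trace * 0 + Polynomial.eval 0 q * 0 ^ 2)) = A.trace / 2 := by
      simp
    rw [h5] at h4
    refine h4.congr_of_eventuallyEq ?_
    have hpos : ∀ᶠ t in 𝓝 (0 : ℝ), 0 < 1 + A.trace * t + q.eval t * t ^ 2 :=
      hp.continuousAt.eventually (lt_mem_nhds (by simp))
    filter_upwards [hpos] with t ht
    simp only [hΨ]
    rw [hq t, abs_neg, abs_of_pos ht]
  rw [h2.unique h3, Matrix.trace, div_eq_inv_mul, one_div]
  congr 1
  refine Finset.sum_congr rfl fun μ _ => ?_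
  rw [Matrix.diag_apply, hA, eta, Matrix.diagonal_mul, sgn]; rfl

/-! ### Metrics close to the Minkowski metric -/

/-- The components of the tensor field are smooth at the origin and `O(|x|^k)`. -/
def OrdT (k : ℕ) (H : TensorField n) : Prop := ∀ μ ν, Ord k fun x => H x μ ν

/-- `g = η + O(|x|²)`, with `g` smooth at the origin. -/
def NearEta (G : TensorField n) : Prop := OrdT 2 fun x => G x - eta n

variable {G G' H : TensorField n}

lemma NearEta.contDiffAt_entry (hG : NearEta G) (μ ν : Fin (n + 1)) :
    ContDiffAt ℝ ∞ (fun x => G x μ ν) 0 := by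
  have := (hG μ ν).1.add (contDiffAt_const (c := eta n μ ν))
  simpa using this

lemma NearEta.contDiffAt (hG : NearEta G) : ContDiffAt ℝ ∞ (fun x => ent (G x)) 0 :=
  contDiffAt_pi.2 fun μ => contDiffAt_pi.2 fun ν => hG.contDiffAt_entry μ ν

lemma OrdT.isBigO {k : ℕ} (hH : OrdT k H) :
    (fun x => ent (H x)) =O[𝓝 0] fun x => ‖x‖ ^ k :=
  Asymptotics.isBigO_pi.2 fun μ => Asymptotics.isBigO_pi.2 fun ν => (hH μ ν).2

lemma NearEta.apply_zero (hG : NearEta G) : G 0 = eta n := by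
  ext μ ν
  have := (hG μ ν).apply_zero
  simpa [sub_eq_zero] using this

lemma nearEta_eta : NearEta fun _ : Coord n => eta n := fun μ ν => by
  simpa using ord_const_zero 2

lemma NearEta.add (hG : NearEta G) (hH : OrdT 2 H) : NearEta fun x => G x + H x := fun μ ν =>
  ((hG μ ν).add (hH μ ν)).congr (Filter.Eventually.of_forall fun x => by
    simp only [Matrix.sub_apply, Matrix.add_apply]; ring)

lemma eta_det_ne_zero : Matrix.det (eta n) ≠ 0 := by rw [eta_det]; norm_num

lemma NearEta.eventually_det_ne_zero (hG : NearEta G) : ∀ᶠ x in 𝓝 0, (G x).det ≠ 0 := by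
  have h1 : ContinuousAt (fun x => (G x).det) 0 :=
    (contDiff_matrix_det.continuous.continuousAt).comp hG.contDiffAt.continuousAt
  exact h1.eventually_ne (by rw [hG.apply_zero]; exact eta_det_ne_zero)

lemma ord_inv_sub {k : ℕ} (hG : NearEta G) (hG' : NearEta G') (h : OrdT k fun x => G' x - G x)
    (i j : Fin (n + 1)) : Ord k fun x => (G' x)⁻¹ i j - (G x)⁻¹ i j :=
  ord_comp_sub (contDiffAt_matrix_inv (M := ent (eta n)) eta_det_ne_zero i j) hG.contDiffAt
    hG'.contDiffAt (congrArg ent hG.apply_zero) (congrArg ent hG'.apply_zero) h.isBigO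

lemma NearEta.ord_inv_sub_eta (hG : NearEta G) (i j : Fin (n + 1)) :
    Ord 2 fun x => (G x)⁻¹ i j - eta n i j := by
  have := ord_inv_sub nearEta_eta hG hG i j
  rwa [eta_inv] at this

lemma NearEta.contDiffAt_inv (hG : NearEta G) (i j : Fin (n + 1)) :
    ContDiffAt ℝ ∞ (fun x => (G x)⁻¹ i j) 0 := by
  have := (hG.ord_inv_sub_eta i j).1.add (contDiffAt_const (c := eta n i j))
  simpa using this

lemma NearEta.ord_pd (hG : NearEta G) (σ μ ν : Fin (n + 1)) :
    Ord 1 (pd σ fun x => G x μ ν) := by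
  refine ((hG μ ν).pd σ).congr ?_
  filter_upwards [pd_sub_eventually σ (hG.contDiffAt_entry μ ν)
    (contDiffAt_const (c := eta n μ ν))] with x hx
  simp only [Matrix.sub_apply]
  rw [hx, pd_const, sub_zero]

/-- The linearization of the Christoffel symbols at the Minkowski metric. -/
def chLin (h : TensorField n) (a μ ν : Fin (n + 1)) (x : Coord n) : ℝ :=
  (1 / 2) * (sgn a * (pd μ (fun z => h z ν a) x + pd ν (fun z => h z μ a) x -
    pd a (fun z => h z μ ν) x))

/-- The linearization of the Ricci tensor at the Minkowski metric. -/
def ricLin (h : TensorField n) (μ ν : Fin (n + 1)) (x : Coord n) : ℝ :=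
  ∑ a, (pd a (chLin h a μ ν) x - pd ν (chLin h a a μ) x)

lemma OrdT.chLin {k : ℕ} (hH : OrdT (k + 1) H) (a μ ν : Fin (n + 1)) :
    Ord k (chLin H a μ ν) :=
  (((((hH ν a).pd μ).add ((hH μ a).pd ν)).sub ((hH μ ν).pd a)).const_mul (sgn a)).const_mul (1 / 2)

lemma OrdT.ricLin {k : ℕ} (hH : OrdT (k + 2) H) (μ ν : Fin (n + 1)) : Ord k (ricLin H μ ν) :=
  Ord.sum fun a _ => ((hH.chLin a μ ν).pd a).sub ((hH.chLin a a μ).pd ν)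

lemma NearEta.ord_christoffel (hG : NearEta G) (a μ ν : Fin (n + 1)) :
    Ord 1 (christoffel G a μ ν) :=
  (Ord.sum fun σ _ => Ord.smooth_mul (hG.contDiffAt_inv a σ)
    (((hG.ord_pd μ ν σ).add (hG.ord_pd ν μ σ)).sub (hG.ord_pd σ μ ν))).const_mul (1 / 2)

lemma sum_eta_mul (a : Fin (n + 1)) (f : Fin (n + 1) → ℝ) :
    ∑ σ, eta n a σ * f σ = sgn a * f a := by
  rw [Finset.sum_eq_single a]
  · simp [eta_apply]
  · intro b _ hb; simp [eta_apply, hb.symm]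
  · simp

/-- The error is `(g'⁻¹ - g⁻¹) ∂g' + (g⁻¹ - η) ∂(g' - g)`, with factors of orders `k + 1`, `1` and
`2`, `k`. It gains two orders over the linear term because both metrics are `η + O(|x|²)`. -/
lemma ord_christoffel_sub {k : ℕ} (hG : NearEta G) (hG' : NearEta G')
    (h : OrdT (k + 1) fun x => G' x - G x) (a μ ν : Fin (n + 1)) :
    Ord (k + 2) fun x => christoffel G' a μ ν x - christoffel G a μ ν x -
      chLin (fun z => G' z - G z) a μ ν x := by
  set B : TensorField n → Fin (n + 1) → Coord n → ℝ := fun G σ x =>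
    pd μ (fun z => G z ν σ) x + pd ν (fun z => G z μ σ) x - pd σ (fun z => G z μ ν) x with hB
  have hB1 : ∀ σ, Ord 1 (B G' σ) := fun σ =>
    ((hG'.ord_pd μ ν σ).add (hG'.ord_pd ν μ σ)).sub (hG'.ord_pd σ μ ν)
  have hBh : ∀ σ, Ord k (B (fun z => G' z - G z) σ) := fun σ =>
    (((h ν σ).pd μ).add ((h μ σ).pd ν)).sub ((h μ ν).pd σ)
  have hBsub : ∀ σ, ∀ᶠ x in 𝓝 0, B (fun z => G' z - G z) σ x = B G' σ x - B G σ x := fun σ => by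
    filter_upwards [pd_sub_eventually μ (hG'.contDiffAt_entry ν σ) (hG.contDiffAt_entry ν σ),
      pd_sub_eventually ν (hG'.contDiffAt_entry μ σ) (hG.contDiffAt_entry μ σ),
      pd_sub_eventually σ (hG'.contDiffAt_entry μ ν) (hG.contDiffAt_entry μ ν)] with x e1 e2 e3
    simp only [hB, Matrix.sub_apply]
    rw [e1, e2, e3]; ring
  have key : Ord (k + 2) fun x => (1 / 2) * ∑ σ, (((G' x)⁻¹ a σ - (G x)⁻¹ a σ) * B G' σ x +
      ((G x)⁻¹ a σ - eta n a σ) * B (fun z => G' z - G z) σ x) := by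
    refine (Ord.sum fun σ _ => ?_).const_mul (1 / 2)
    refine ((ord_inv_sub hG hG' h a σ).mul (hB1 σ)).add ?_
    rw [add_comm k 2]
    exact (hG.ord_inv_sub_eta a σ).mul (hBh σ)
  refine key.congr ?_
  filter_upwards [Filter.eventually_all.2 hBsub] with x hx
  have e1 : ∀ (G : TensorField n), christoffel G a μ ν x =
    (1 / 2) * ∑ σ, (G x)⁻¹ a σ * B G σ x := fun G => rfl
  have e2 : chLin (fun z => G' z - G z) a μ ν x =
    (1 / 2) * ∑ σ, eta n a σ * B (fun z => G' z - G z) σ x := by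
      rw [sum_eta_mul]; rfl
  rw [e1, e1, e2, ← mul_sub, ← mul_sub, ← Finset.sum_sub_distrib, ← Finset.sum_sub_distrib]
  congr 1
  refine Finset.sum_congr rfl fun σ _ => ?_
  rw [hx σ]; ring

lemma OrdT.chLin_smooth {k : ℕ} (hH : OrdT (k + 1) H) (a μ ν : Fin (n + 1)) :
    ContDiffAt ℝ ∞ (LightCone.chLin H a μ ν) 0 := (hH.chLin a μ ν).1

/-- The Ricci tensor depends on the metric, to leading order, through its linearization at the
Minkowski metric. -/
lemma ord_ricci_sub {k : ℕ} (hG : NearEta G) (hG' : NearEta G')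
    (h : OrdT (k + 1) fun x => G' x - G x) (μ ν : Fin (n + 1)) :
    Ord (k + 1) fun x => ricci G' μ ν x - ricci G μ ν x -
      ricLin (fun z => G' z - G z) μ ν x := by
  have hd := fun a μ ν => ord_christoffel_sub hG hG' h a μ ν
  have hs := fun a μ ν => (hG.ord_christoffel a μ ν).1
  have hs' := fun a μ ν => (hG'.ord_christoffel a μ ν).1
  have hl := fun a μ ν => h.chLin_smooth a μ ν
  have hpd : ∀ b a μ ν, ∀ᶠ x in 𝓝 0, pd b (fun x => christoffel G' a μ ν x -
      christoffel G a μ ν x - chLin (fun z => G' z - G z) a μ ν x) x =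
      pd b (christoffel G' a μ ν) x - pd b (christoffel G a μ ν) x -
        pd b (chLin (fun z => G' z - G z) a μ ν) x := fun b a μ ν => by
    filter_upwards [pd_sub_eventually b ((hs' a μ ν).sub (hs a μ ν)) (hl a μ ν),
      pd_sub_eventually b (hs' a μ ν) (hs a μ ν)] with x e1 e2
    rw [e1, e2]
  have hdiff : ∀ a μ ν, Ord k fun x => christoffel G' a μ ν x - christoffel G a μ ν x :=
    fun a μ ν => (((hd a μ ν).mono (by omega : k ≤ k + 2)).add (h.chLin a μ ν)).congr
      (Filter.Eventually.of_forall fun x => by ring)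
  have hquad : ∀ a b c d e f, Ord (k + 1) fun x => christoffel G' a b c x * christoffel G' d e f x -
      christoffel G a b c x * christoffel G d e f x := fun a b c d e f => by
    refine (((hdiff a b c).mul (hG'.ord_christoffel d e f)).add
      ((hdiff d e f).mul (hG.ord_christoffel a b c))).congr
      (Filter.Eventually.of_forall fun x => by ring)
  have key : Ord (k + 1) fun x =>
      (∑ a, (pd a (fun x => christoffel G' a μ ν x -
          christoffel G a μ ν x - chLin (fun z => G' z - G z) a μ ν x) x -
        pd ν (fun x => christoffel G' a a μ x -
          christoffel G a a μ x - chLin (fun z => G' z - G z) a a μ x) x)) +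
      ∑ a, ∑ b, ((christoffel G' a a b x * christoffel G' b μ ν x -
          christoffel G a a b x * christoffel G b μ ν x) -
        (christoffel G' a ν b x * christoffel G' b a μ x -
          christoffel G a ν b x * christoffel G b a μ x)) :=
    (Ord.sum fun a _ => ((hd a μ ν).pd a).sub ((hd a a μ).pd ν)).add
      (Ord.sum fun a _ => Ord.sum fun b _ => (hquad a a b b μ ν).sub (hquad a ν b b a μ))
  refine key.congr ?_
  filter_upwards [Filter.eventually_all.2 fun a => hpd a a μ ν,
    Filter.eventually_all.2 fun a => hpd ν a a μ] with x e1 e2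
  simp only [ricci, ricLin, e1, e2, Finset.sum_sub_distrib]
  ring

/-! ### The wave gauge condition -/

/-- The densitized inverse metric `√|det g| g^{μν}`. -/
def dens (G : TensorField n) (μ ν : Fin (n + 1)) (x : Coord n) : ℝ :=
  √|(G x).det| * (G x)⁻¹ μ ν

/-- The divergence `∂_μ (√|det g| g^{μν})`, which vanishes when the coordinates are harmonic. -/
def harm (G : TensorField n) (ν : Fin (n + 1)) (x : Coord n) : ℝ :=
  ∑ μ, pd μ (dens G μ ν) x

/-- The linearization of `dens` at the Minkowski metric. -/
def densLin (h : TensorField n) (μ ν : Fin (n + 1)) (x : Coord n) : ℝ :=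
  eta n μ ν * ((1 / 2) * ∑ a, sgn a * h x a a) - sgn μ * sgn ν * h x μ ν

lemma NearEta.contDiffAt_sqrt (hG : NearEta G) : ContDiffAt ℝ ∞ (fun x => √|(G x).det|) 0 := by
  have h : ContDiffAt ℝ ∞ (fun M : Mat n =>
      √|Matrix.det (Matrix.of M)|) (ent (G 0)) :=
    contDiffAt_sqrt_abs_det (M := ent (G 0)) (by rw [hG.apply_zero]; exact eta_det_ne_zero)
  exact ContDiffAt.comp (g := fun M : Mat n => √|Matrix.det (Matrix.of M)|) (0 : Coord n) h
    hG.contDiffAt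

lemma NearEta.contDiffAt_dens (hG : NearEta G) (μ ν : Fin (n + 1)) :
    ContDiffAt ℝ ∞ (dens G μ ν) 0 := hG.contDiffAt_sqrt.mul (hG.contDiffAt_inv μ ν)

lemma NearEta.ord_sqrt_sub_one (hG : NearEta G) : Ord 2 fun x => √|(G x).det| - 1 := by
  have := ord_comp_sub (contDiffAt_sqrt_abs_det (M := ent (eta n)) eta_det_ne_zero)
    (nearEta_eta (n := n)).contDiffAt hG.contDiffAt rfl (congrArg ent hG.apply_zero) (k := 2)
    (OrdT.isBigO (H := fun x => G x - eta n) hG)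
  simpa only [of_ent, eta_det, abs_neg, abs_one, Real.sqrt_one] using this

/-- In `g'⁻¹ - g⁻¹ = - g'⁻¹ (g' - g) g⁻¹`, replacing either inverse by `η` produces an error smaller
by two orders. -/
lemma ord_inv_sub_sub {k : ℕ} (hG : NearEta G) (hG' : NearEta G')
    (h : OrdT k fun x => G' x - G x) (μ ν : Fin (n + 1)) :
    Ord (k + 2) fun x => (G' x)⁻¹ μ ν - (G x)⁻¹ μ ν + sgn μ * sgn ν * (G' x - G x) μ ν := by
  have key : Ord (k + 2) fun x => -∑ a, ∑ b,
      ((((G' x)⁻¹ μ a - eta n μ a) * (G' x - G x) a b) * (G x)⁻¹ b ν +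
        (eta n μ a * (G' x - G x) a b) * ((G x)⁻¹ b ν - eta n b ν)) := by
    refine (Ord.sum fun a _ => Ord.sum fun b _ => Ord.add ?_ ?_).neg
    · refine Ord.mul_smooth ?_ (hG.contDiffAt_inv b ν)
      rw [add_comm k 2]
      exact (hG'.ord_inv_sub_eta μ a).mul (h a b)
    · exact ((h a b).const_mul _).mul (hG.ord_inv_sub_eta b ν)
  refine key.congr ?_
  filter_upwards [hG.eventually_det_ne_zero, hG'.eventually_det_ne_zero] with x h1 h2
  have e1 : (G' x)⁻¹ - (G x)⁻¹ = -((G' x)⁻¹ * (G' x - G x) * (G x)⁻¹) := by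
    rw [mul_sub, sub_mul, Matrix.nonsing_inv_mul _ (isUnit_iff_ne_zero.2 h2), one_mul, mul_assoc,
      Matrix.mul_nonsing_inv _ (isUnit_iff_ne_zero.2 h1), mul_one, neg_sub]
  have e2 : (G' x)⁻¹ μ ν - (G x)⁻¹ μ ν =
      -∑ a, ∑ b, (G' x)⁻¹ μ a * (G' x - G x) a b * (G x)⁻¹ b ν := by
    rw [← Matrix.sub_apply, e1, Matrix.neg_apply, Matrix.mul_apply]
    simp only [Matrix.mul_apply, Finset.sum_mul]
    rw [Finset.sum_comm]
  have e3 : sgn μ * sgn ν * (G' x - G x) μ ν =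
      ∑ a, ∑ b, eta n μ a * (G' x - G x) a b * eta n b ν := by
    have : ∀ a, ∑ b, eta n μ a * (G' x - G x) a b * eta n b ν =
        eta n μ a * ((G' x - G x) a ν * sgn ν) := fun a => by
      rw [Finset.sum_eq_single ν]
      · simp only [eta_apply, if_true]; ring
      · intro b _ hb; simp [eta_apply, hb]
      · simp
    simp only [this]
    rw [sum_eta_mul]; ring
  rw [e2, e3, neg_add_eq_sub, ← sub_eq_zero, ← Finset.sum_neg_distrib, ← Finset.sum_sub_distrib,
    ← Finset.sum_sub_distrib]
  refine Finset.sum_eq_zero fun a _ => ?_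
  rw [← Finset.sum_neg_distrib, ← Finset.sum_sub_distrib, ← Finset.sum_sub_distrib]
  refine Finset.sum_eq_zero fun b _ => ?_
  ring

lemma ord_sqrt_sub_sub {k : ℕ} (hG : NearEta G) (hG' : NearEta G')
    (h : OrdT k fun x => G' x - G x) :
    Ord (k + 2) fun x => √|(G' x).det| - √|(G x).det| -
      (1 / 2) * ∑ a, sgn a * (G' x - G x) a a := by
  have := ord_comp_sub_sub (j := 1) (contDiffAt_sqrt_abs_det (M := ent (eta n)) eta_det_ne_zero)
    hG.contDiffAt hG'.contDiffAt (OrdT.isBigO (H := fun x => G x - eta n) hG)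
    (OrdT.isBigO (H := fun x => G' x - eta n) hG') h.isBigO
  simp only [fderiv_sqrt_abs_det_eta] at this
  exact this

lemma ord_dens_sub {k : ℕ} (hG : NearEta G) (hG' : NearEta G')
    (h : OrdT k fun x => G' x - G x) (μ ν : Fin (n + 1)) :
    Ord (k + 2) fun x => dens G' μ ν x - dens G μ ν x - densLin (fun z => G' z - G z) μ ν x := by
  have htr : Ord k fun x => (1 / 2) * ∑ a, sgn a * (G' x - G x) a a :=
    (Ord.sum fun a _ => (h a a).const_mul _).const_mul _
  have h1 := (ord_sqrt_sub_sub hG hG' h).mul_smooth (hG'.contDiffAt_inv μ ν)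
  have h2 := htr.mul (hG'.ord_inv_sub_eta μ ν)
  have h3 := Ord.smooth_mul hG.contDiffAt_sqrt (ord_inv_sub_sub hG hG' h μ ν)
  have h4 := ((h μ ν).const_mul (sgn μ * sgn ν)).mul hG.ord_sqrt_sub_one
  refine (((h1.add h2).add h3).sub h4).congr (Filter.Eventually.of_forall fun x => ?_)
  simp only [dens, densLin]
  ring

/-! ### Linearized operators on polynomial tensors -/

/-- The tensor field with polynomial components. -/
def evT (h : Fin (n + 1) → Fin (n + 1) → Poly n) : TensorField n :=
  fun x => Matrix.of fun μ ν => ev (h μ ν) x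

lemma ordT_evT {h : Fin (n + 1) → Fin (n + 1) → Poly n} {d : ℕ}
    (hh : ∀ μ ν, (h μ ν).IsHomogeneous d) : OrdT d (evT h) := fun μ ν => ord_ev (hh μ ν)

lemma chLin_evT (h : Fin (n + 1) → Fin (n + 1) → Poly n) (a μ ν : Fin (n + 1)) :
    chLin (evT h) a μ ν = ev ((1 / 2 : ℝ) • (sgn a • (pderiv μ (h ν a) + pderiv ν (h μ a) -
      pderiv a (h μ ν)))) := by
  have e : ∀ α β, (fun z => evT h z α β) = ev (h α β) := fun α β => rfl
  funext x
  simp only [chLin, e, pd_ev, ev_smul, ev_sub, ev_add]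

/-- In this form the Ricci tensor reduces to `-½ □ h` once the gauge divergence is known, which
turns the Ricci equation into a wave equation. -/
lemma ricLin_evT {h : Fin (n + 1) → Fin (n + 1) → Poly n} (hs : ∀ μ ν, h μ ν = h ν μ)
    (μ ν : Fin (n + 1)) : ricLin (evT h) μ ν = ev ((1 / 2 : ℝ) •
      (pderiv μ (dvb h ν) + pderiv ν (dvb h μ) - lap (h μ ν))) := by
  have e : ricLin (evT h) μ ν = ev (∑ a, (pderiv a ((1 / 2 : ℝ) • (sgn a • (pderiv μ (h ν a) +
      pderiv ν (h μ a) - pderiv a (h μ ν)))) - pderiv ν ((1 / 2 : ℝ) • (sgn a •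
      (pderiv a (h μ a) + pderiv μ (h a a) - pderiv a (h a μ)))))) := by
    funext x
    simp only [ricLin, chLin_evT, pd_ev, ev_sum, ev_sub]
  rw [e]
  congr 1
  simp only [dvb, dv, tr, lap, map_sub, map_add, map_sum, pderiv_smul, Finset.smul_sum]
  simp only [← Finset.sum_add_distrib, ← Finset.sum_sub_distrib, Finset.smul_sum]
  refine Finset.sum_congr rfl fun a _ => ?_
  rw [hs a μ, hs a ν, pderiv_comm a μ, pderiv_comm a ν, pderiv_comm ν μ]
  algebra

lemma sum_pd_densLin_evT (h : Fin (n + 1) → Fin (n + 1) → Poly n) (ν : Fin (n + 1)) (x : Coord n) :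
    ∑ μ, pd μ (densLin (evT h) μ ν) x = -(sgn ν * ev (dvb h ν) x) := by
  have e : ∀ μ, densLin (evT h) μ ν = ev (eta n μ ν • ((1 / 2 : ℝ) • tr h) -
      (sgn μ * sgn ν) • h μ ν) := fun μ => by
    funext x
    simp only [densLin, evT, Matrix.of_apply, ev_sub, ev_smul, tr, ev_sum]
  have e2 : ∑ μ, pderiv μ (eta n μ ν • ((1 / 2 : ℝ) • tr h) - (sgn μ * sgn ν) • h μ ν) =
      -(sgn ν • dvb h ν) := by
    simp only [map_sub, pderiv_smul, Finset.sum_sub_distrib, dvb, dv]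
    rw [Finset.sum_eq_single ν (by intro b _ hb; simp [eta_apply, hb]) (by simp)]
    simp only [eta_apply, if_true, smul_sub, Finset.smul_sum, mul_smul, smul_comm (sgn ν) (sgn _)]
    abel
  simp only [e, pd_ev]
  have := congrFun (congrArg ev e2) x
  rw [ev_sum, ev_neg, ev_smul] at this
  exact this

end

section

open MvPolynomial
variable {n : ℕ}

/-! ### Borel's lemma -/

/-- A smooth cutoff equal to `1` near the origin and supported in the unit ball. -/
def cutoff (n : ℕ) : ContDiffBump (0 : Coord n) := ⟨1 / 2, 1, by norm_num, by norm_num⟩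

lemma cutoff_eq_one {x : Coord n} (hx : ‖x‖ ≤ 1 / 2) : cutoff n x = 1 :=
  (cutoff n).one_of_mem_closedBall (by simpa [cutoff] using hx)

lemma cutoff_eq_zero {x : Coord n} (hx : 1 ≤ ‖x‖) : cutoff n x = 0 :=
  (cutoff n).zero_of_le_dist (by simpa [cutoff, dist_eq_norm] using hx)

lemma contDiff_cutoff : ContDiff ℝ ∞ (cutoff n) := (cutoff n).contDiff

/-- Rescaled cutoffs make the derivatives of order less than the degree of a homogeneous
polynomial as small as desired. -/
lemma exists_cutoff_scale {p : Poly n} {j d : ℕ} (hjd : j ≤ d) (hp : p.IsHomogeneous d) {ε : ℝ}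
    (hε : 0 < ε) :
    ∃ L : ℝ, 1 ≤ L ∧
      (∀ i < j, ∀ x, ‖iteratedFDeriv ℝ i (fun x => cutoff n (L • x) * ev p x) x‖ ≤ ε) ∧
      ∀ N < j, ∀ x, |cutoff n (L • x) * ev p x| ≤ ε * ‖x‖ ^ N := by
  set φ : Coord n → ℝ := fun x => cutoff n x * ev p x with hφ
  have hφc : ContDiff ℝ ∞ φ := contDiff_cutoff.mul (contDiff_ev p)
  have hφs : HasCompactSupport φ := (cutoff n).hasCompactSupport.mul_right
  have hb : ∀ i : ℕ, ∃ M : ℝ, ∀ x, ‖iteratedFDeriv ℝ i φ x‖ ≤ M := fun i =>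
    (hφc.continuous_iteratedFDeriv (by exact_mod_cast le_top)).bounded_above_of_compact_support
      (hφs.iteratedFDeriv i)
  choose M hM using hb
  obtain ⟨C, hC0, hC⟩ := exists_ev_le hp
  set B : ℝ := C + ∑ i ∈ Finset.range j, |M i| with hB
  have hB0 : 0 ≤ B := by positivity
  -- `B` dominates the polynomial bound and the derivatives of orders below `j`; the choice of `L`
  -- gives `L ≥ 1` and `B ≤ ε L`.
  set L : ℝ := 1 + B / ε with hL
  have hL1 : 1 ≤ L := by rw [hL]; linarith [div_nonneg hB0 hε.le]
  have hL0 : 0 < L := by linarith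
  have hBL : B ≤ ε * L := by
    rw [hL, mul_add, mul_div_cancel₀ _ hε.ne']; linarith
  refine ⟨L, hL1, fun i hi x => ?_, fun N hN x => ?_⟩
  -- By homogeneity the function is `L^{-d} φ(L x)`, so its derivative of order `i` carries `L^{i-d}
  -- ≤ L^{-1}` for `i < j ≤ d`.
  · have e : (fun x => cutoff n (L • x) * ev p x) = (L ^ d)⁻¹ • fun x => φ (L • x) := by
      funext x
      simp only [hφ, ev_smul_of_isHomogeneous hp, Pi.smul_apply, smul_eq_mul]
      field_simp
    have hc : ContDiff ℝ ∞ fun x => φ (L • x) := hφc.comp (contDiff_const_smul L)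
    rw [e, iteratedFDeriv_const_smul_apply (hc.contDiffAt.of_le (by exact_mod_cast le_top)),
      iteratedFDeriv_comp_const_smul L (hφc.of_le (by exact_mod_cast le_top)), smul_smul,
      norm_smul, norm_mul, norm_inv, norm_pow, norm_pow, Real.norm_of_nonneg hL0.le]
    have h1 : ‖iteratedFDeriv ℝ i φ (L • x)‖ ≤ B := by
      refine (hM i _).trans ((le_abs_self _).trans ?_)
      have := Finset.single_le_sum (f := fun i => |M i|) (fun i _ => abs_nonneg (M i))
        (Finset.mem_range.2 hi)
      linarith
    have h2 : L ^ i * L ≤ L ^ d := by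
      rw [← pow_succ]; exact pow_le_pow_right₀ hL1 (by omega)
    calc (L ^ d)⁻¹ * L ^ i * ‖iteratedFDeriv ℝ i φ (L • x)‖
        ≤ (L ^ d)⁻¹ * L ^ i * (ε * L) := by gcongr; exact h1.trans hBL
      _ = ε * ((L ^ d)⁻¹ * (L ^ i * L)) := by ring
      _ ≤ ε * ((L ^ d)⁻¹ * L ^ d) := by gcongr
      _ = ε := by rw [inv_mul_cancel₀ (by positivity), mul_one]
  · by_cases hx : 1 ≤ ‖L • x‖
    · rw [cutoff_eq_zero hx, zero_mul, abs_zero]; positivity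
    · push Not at hx
      rw [norm_smul, Real.norm_of_nonneg hL0.le] at hx
      have hx1 : ‖x‖ ≤ 1 := by nlinarith [norm_nonneg x]
      have h1 : |cutoff n (L • x)| ≤ 1 := by
        rw [abs_of_nonneg (cutoff n).nonneg]; exact (cutoff n).le_one
      rw [abs_mul]
      calc |cutoff n (L • x)| * |ev p x| ≤ 1 * (C * ‖x‖ ^ d) :=
            mul_le_mul h1 (hC x) (abs_nonneg _) zero_le_one
        _ ≤ 1 * (C * ‖x‖ ^ (N + 1)) := by
            gcongr 1 * (C * ?_)
            exact pow_le_pow_of_le_one (norm_nonneg _) hx1 (by omega)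
        _ = (C * ‖x‖) * ‖x‖ ^ N := by ring
        _ ≤ ε * ‖x‖ ^ N := by
            gcongr
            have hCB : C ≤ B := by
              rw [hB]; linarith [Finset.sum_nonneg fun i (_ : i ∈ Finset.range j) => abs_nonneg (M i)]
            calc C * ‖x‖ ≤ (ε * L) * ‖x‖ := by gcongr; exact hCB.trans hBL
              _ = ε * (L * ‖x‖) := by ring
              _ ≤ ε * 1 := by gcongr
              _ = ε := mul_one _

/-- Borel's lemma: every formal power series is the Taylor series of a smooth function. -/
theorem exists_contDiff_ord_sub_sum {p : ℕ → Poly n} {d : ℕ → ℕ} (hd : ∀ j, j ≤ d j)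
    (hp : ∀ j, (p j).IsHomogeneous (d j)) :
    ∃ f : Coord n → ℝ, ContDiff ℝ ∞ f ∧
      ∀ N, Ord N fun x => f x - ∑ j ∈ Finset.range N, ev (p j) x := by
  choose L hL1 hLi hLN using fun j =>
    exists_cutoff_scale (hd j) (hp j) (ε := (1 / 2 : ℝ) ^ j) (by positivity)
  set u : ℕ → Coord n → ℝ := fun j x => cutoff n (L j • x) * ev (p j) x with hu
  have huc : ∀ j, ContDiff ℝ ∞ (u j) := fun j =>
    (contDiff_cutoff.comp (contDiff_const_smul (L j))).mul (contDiff_ev (p j))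
  have hgeom : Summable fun j : ℕ => (1 / 2 : ℝ) ^ j := summable_geometric_two
  have hfc : ContDiff ℝ ∞ fun x => ∑' j, u j x := by
    refine contDiff_tsum_of_eventually (N := ⊤) (v := fun _ j => (1 / 2 : ℝ) ^ j) huc
      (fun _ _ => hgeom) fun k _ => ?_
    rw [Nat.cofinite_eq_atTop]
    filter_upwards [Filter.eventually_gt_atTop k] with j hj x
    exact hLi j k hj x
  refine ⟨fun x => ∑' j, u j x, hfc, fun N => ⟨hfc.contDiffAt.sub
    (ContDiff.sum fun j _ => contDiff_ev (p j)).contDiffAt, ?_⟩⟩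
  have hsum : ∀ x, Summable fun j => u (j + (N + 1)) x := fun x => by
    refine Summable.of_norm_bounded (g := fun j => (1 / 2 : ℝ) ^ (j + (N + 1)) * ‖x‖ ^ N)
      (((summable_nat_add_iff (N + 1)).2 hgeom).mul_right _) fun j => ?_
    exact hLN (j + (N + 1)) N (by omega) x
  have hsum' : ∀ x, Summable fun j => u j x := fun x => (summable_nat_add_iff (N + 1)).1 (hsum x)
  -- The tail starts at `N + 1`, because the scale estimate requires `N < j`. The omitted term of
  -- index `N` is `O(|x|^N)` by homogeneity.
  have htail : (fun x => ∑' j, u (j + (N + 1)) x) =O[𝓝 0] fun x => ‖x‖ ^ N := by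
    refine Asymptotics.IsBigO.of_bound (∑' j, (1 / 2 : ℝ) ^ (j + (N + 1)))
      (Filter.Eventually.of_forall fun x => ?_)
    rw [norm_pow, norm_norm, ← tsum_mul_right]
    exact tsum_of_norm_bounded
      (((summable_nat_add_iff (N + 1)).2 hgeom).mul_right _).hasSum
      fun j => hLN (j + (N + 1)) N (by omega) x
  have hone : ∀ j, ∀ᶠ x in 𝓝 (0 : Coord n), u j x = ev (p j) x := fun j => by
    have ht : Filter.Tendsto (fun x : Coord n => L j • x) (𝓝 0) (𝓝 0) := by
      have := (continuous_const_smul (L j) : Continuous fun x : Coord n => L j • x).tendsto 0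
      rwa [smul_zero] at this
    filter_upwards [ht (Metric.closedBall_mem_nhds (0 : Coord n) (by norm_num : (0 : ℝ) < 1 / 2))]
      with x hx
    simp only [hu]
    rw [cutoff_eq_one (by simpa using hx), one_mul]
  have hN : (fun x => ev (p N) x) =O[𝓝 0] fun x => ‖x‖ ^ N :=
    ((ord_ev (hp N)).mono (hd N)).2
  refine (hN.add htail).congr' ?_ Filter.EventuallyEq.rfl
  have hall : ∀ᶠ x in 𝓝 (0 : Coord n), ∀ j ∈ Finset.range (N + 1), u j x = ev (p j) x :=
    (Filter.eventually_all_finset _).2 fun j _ => hone j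
  filter_upwards [hall] with x hx
  rw [← (hsum' x).sum_add_tsum_nat_add (N + 1), Finset.sum_congr rfl hx, Finset.sum_range_succ]
  ring

end

section

open MvPolynomial
variable {n : ℕ} {G G' H A B : TensorField n}

/-! ### Formal solution of the vacuum constraints in wave gauge -/

lemma chLin_sub_eventually (hA : OrdT 0 A) (hB : OrdT 0 B) (a μ ν : Fin (n + 1)) :
    chLin (fun z => A z - B z) a μ ν =ᶠ[𝓝 0] fun x => chLin A a μ ν x - chLin B a μ ν x := by
  filter_upwards [pd_sub_eventually μ (hA ν a).1 (hB ν a).1,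
    pd_sub_eventually ν (hA μ a).1 (hB μ a).1, pd_sub_eventually a (hA μ ν).1 (hB μ ν).1]
    with x e1 e2 e3
  simp only [chLin, Matrix.sub_apply]
  rw [e1, e2, e3]; ring

lemma contDiffAt_chLin (hA : OrdT 0 A) (a μ ν : Fin (n + 1)) :
    ContDiffAt ℝ ∞ (chLin A a μ ν) 0 :=
  contDiffAt_const.mul (contDiffAt_const.mul
    (((contDiffAt_pd μ (hA ν a).1).add (contDiffAt_pd ν (hA μ a).1)).sub
      (contDiffAt_pd a (hA μ ν).1)))

lemma ricLin_sub_eventually (hA : OrdT 0 A) (hB : OrdT 0 B) (μ ν : Fin (n + 1)) :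
    ricLin (fun z => A z - B z) μ ν =ᶠ[𝓝 0] fun x => ricLin A μ ν x - ricLin B μ ν x := by
  have h : ∀ b a μ ν, ∀ᶠ x in 𝓝 0, pd b (chLin (fun z => A z - B z) a μ ν) x =
      pd b (chLin A a μ ν) x - pd b (chLin B a μ ν) x := fun b a μ ν => by
    filter_upwards [pd_congr b (chLin_sub_eventually hA hB a μ ν),
      pd_sub_eventually b (contDiffAt_chLin hA a μ ν) (contDiffAt_chLin hB a μ ν)] with x e1 e2
    rw [e1, e2]
  filter_upwards [Filter.eventually_all.2 fun a => h a a μ ν,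
    Filter.eventually_all.2 fun a => h ν a a μ] with x e1 e2
  simp only [ricLin, e1, e2, ← Finset.sum_sub_distrib]
  exact Finset.sum_congr rfl fun a _ => by ring

lemma OrdT.mono {j k : ℕ} (hA : OrdT k A) (h : j ≤ k) : OrdT j A := fun μ ν => (hA μ ν).mono h

/-- The linearization may be evaluated on an approximation `H` of `G' - G`, here a polynomial
tensor. This is needed for the first step, where `g - η` itself is not polynomial. -/
lemma ord_ricci_sub_ricLin {k : ℕ} (hG : NearEta G) (hG' : NearEta G')
    (h : OrdT (k + 1) fun x => G' x - G x) (hH : OrdT 0 H)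
    (hr : OrdT (k + 3) fun x => (G' x - G x) - H x) (μ ν : Fin (n + 1)) :
    Ord (k + 1) fun x => ricci G' μ ν x - ricci G μ ν x - ricLin H μ ν x := by
  refine ((ord_ricci_sub hG hG' h μ ν).add (hr.ricLin μ ν)).congr ?_
  filter_upwards [ricLin_sub_eventually (h.mono (Nat.zero_le _)) hH μ ν] with x e
  rw [e]; ring

lemma ord_ricci_sub_of_ord {k : ℕ} (hG : NearEta G) (hG' : NearEta G')
    (h : OrdT (k + 2) fun x => G' x - G x) (μ ν : Fin (n + 1)) :
    Ord k fun x => ricci G' μ ν x - ricci G μ ν x :=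
  (((ord_ricci_sub (k := k + 1) hG hG' h μ ν).mono (by omega)).add (h.ricLin μ ν)).congr
    (Filter.Eventually.of_forall fun x => by ring)

lemma ord_densLin {k : ℕ} (hA : OrdT k A) (μ ν : Fin (n + 1)) : Ord k (densLin A μ ν) :=
  (((Ord.sum fun a _ => (hA a a).const_mul (sgn a)).const_mul _).const_mul _).sub
    ((hA μ ν).const_mul _)

lemma ord_harm_sub_densLin {k : ℕ} (hG : NearEta G) (hG' : NearEta G')
    (h : OrdT k fun x => G' x - G x) (hH : OrdT 0 H)
    (hr : OrdT (k + 2) fun x => (G' x - G x) - H x) (ν : Fin (n + 1)) :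
    Ord (k + 1) fun x => harm G' ν x - harm G ν x - ∑ μ, pd μ (densLin H μ ν) x := by
  have h1 : ∀ μ, Ord (k + 2) fun x => dens G' μ ν x - dens G μ ν x - densLin H μ ν x := fun μ => by
    refine ((ord_dens_sub hG hG' h μ ν).add (ord_densLin hr μ ν)).congr
      (Filter.Eventually.of_forall fun x => ?_)
    simp only [densLin, Matrix.sub_apply, mul_sub, Finset.sum_sub_distrib]
    ring
  refine (Ord.sum (s := Finset.univ) fun μ _ => (h1 μ).pd μ).congr ?_
  have hpd : ∀ μ, ∀ᶠ x in 𝓝 0, pd μ (fun x => dens G' μ ν x - dens G μ ν x -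
      densLin H μ ν x) x = pd μ (dens G' μ ν) x - pd μ (dens G μ ν) x -
        pd μ (densLin H μ ν) x := fun μ => by
    filter_upwards [pd_sub_eventually μ ((hG'.contDiffAt_dens μ ν).sub (hG.contDiffAt_dens μ ν))
      (ord_densLin hH μ ν).1, pd_sub_eventually μ (hG'.contDiffAt_dens μ ν)
      (hG.contDiffAt_dens μ ν)] with x e1 e2
    rw [e1, e2]
  filter_upwards [Filter.eventually_all.2 hpd] with x hx
  simp only [hx, Finset.sum_sub_distrib, harm]

lemma ord_harm_sub_of_ord {k : ℕ} (hG : NearEta G) (hG' : NearEta G')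
    (h : OrdT (k + 1) fun x => G' x - G x) (ν : Fin (n + 1)) :
    Ord k fun x => harm G' ν x - harm G ν x := by
  have h1 : ∀ μ, Ord (k + 1) fun x => dens G' μ ν x - dens G μ ν x := fun μ =>
    (((ord_dens_sub hG hG' h μ ν).mono (by omega)).add (ord_densLin h μ ν)).congr
      (Filter.Eventually.of_forall fun x => by ring)
  refine (Ord.sum (s := Finset.univ) fun μ _ => (h1 μ).pd μ).congr ?_
  filter_upwards [Filter.eventually_all.2 fun μ => pd_sub_eventually μ (hG'.contDiffAt_dens μ ν)
    (hG.contDiffAt_dens μ ν)] with x hx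
  simp only [hx, Finset.sum_sub_distrib, harm]

/-- The tensor `x_μ ξ_ν + x_ν ξ_μ + σ q_{μν}`, which induces the zero tensor on the cone. -/
def coneNull (ξ : Fin (n + 1) → Poly n) (q : Fin (n + 1) → Fin (n + 1) → Poly n)
    (μ ν : Fin (n + 1)) : Poly n := xl μ * ξ ν + xl ν * ξ μ + sig n * q μ ν

/-- Polynomial data `(ξ, q, P)`: a tensor inducing zero on the cone, and the multiplier of `σ` in
the vacuum constraints. -/
abbrev ConeData (n : ℕ) : Type :=
  (Fin (n + 1) → Poly n) × (Fin (n + 1) → Fin (n + 1) → Poly n) × (Fin (n + 1) → Poly n)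

/-- The metric `g`, modified by a tensor inducing zero on the cone. -/
def modify (g : TensorField n) (D : ConeData n) : TensorField n :=
  fun x => g x + evT (coneNull D.1 D.2.1) x

/-- The wave gauge condition and the vacuum constraints hold to order `k`. -/
structure SolvesTo (g : TensorField n) (k : ℕ) (D : ConeData n) : Prop where
  symm : ∀ μ ν, D.2.1 μ ν = D.2.1 ν μ
  near : NearEta (modify g D)
  gauge : ∀ ν, Ord k (harm (modify g D) ν)
  vacuum : ∀ μ ν, Ord 2 (ricci (modify g D) μ ν)
  constraint : ∀ μ, Ord k fun x => ∑ ν, ricci (modify g D) μ ν x * x ν -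
    ev (D.2.2 μ) x * ev (sig n) x

lemma modify_add (g : TensorField n) (D E : ConeData n) (x : Coord n) :
    modify g (D + E) x = modify g D x + evT (coneNull E.1 E.2.1) x := by
  ext μ ν
  simp only [modify, evT, Matrix.add_apply, Matrix.of_apply, add_assoc, ← ev_add_apply]
  congr 2
  simp only [coneNull, Prod.fst_add, Prod.snd_add, Pi.add_apply]
  ring
where
  ev_add_apply (p q : Poly n) (x : Coord n) : ev (p + q) x = ev p x + ev q x := by rw [ev_add]

lemma ricci_eta (μ ν : Fin (n + 1)) (x : Coord n) : ricci (fun _ => eta n) μ ν x = 0 := by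
  have : ∀ a μ ν, christoffel (fun _ : Coord n => eta n) a μ ν = fun _ => 0 := fun a μ ν => by
    funext z; simp [christoffel, pd_const]
  simp [ricci, this, pd_const]

lemma harm_eta (ν : Fin (n + 1)) (x : Coord n) : harm (fun _ => eta n) ν x = 0 := by
  have : ∀ μ, dens (fun _ : Coord n => eta n) μ ν = fun _ => √|(eta n).det| * (eta n)⁻¹ μ ν :=
    fun μ => rfl
  simp [harm, this, pd_const]

/-- The parts of `g - η` of degrees `2` and `3` are made harmonic with vanishing gauge divergence.
Their linearized Ricci tensor is then zero, and the nonlinear terms and Taylor remainder contribute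
only `O(|x|²)` to Ricci and `O(|x|³)` to the gauge. The constraint, with zero multiplier, follows on
contracting with `x`. -/
lemma exists_solvesTo_three (hn : 2 ≤ n) {g : TensorField n} (hg : NearEta g)
    (hgs : ∀ᶠ x in 𝓝 0, (g x).IsSymm) : ∃ D : ConeData n, SolvesTo g 3 D := by
  have hT2 : ∀ μ ν, ∃ p : Poly n, p.IsHomogeneous 2 ∧
      Ord 3 fun x => (g x - eta n) μ ν - ev p x := fun μ ν => (hg μ ν).exists_taylor
  choose p hp hpo using hT2
  choose q hq hqo using fun μ ν => (hpo μ ν).exists_taylor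
  set s₂ : Fin (n + 1) → Fin (n + 1) → Poly n := fun μ ν => (1 / 2 : ℝ) • (p μ ν + p ν μ) with hs₂
  set s₃ : Fin (n + 1) → Fin (n + 1) → Poly n := fun μ ν => (1 / 2 : ℝ) • (q μ ν + q ν μ) with hs₃
  have hs₂s : ∀ μ ν, s₂ μ ν = s₂ ν μ := fun μ ν => by simp only [hs₂, add_comm]
  have hs₃s : ∀ μ ν, s₃ μ ν = s₃ ν μ := fun μ ν => by simp only [hs₃, add_comm]
  -- Taylor polynomials were chosen entry by entry; averaging with the transpose is harmless since
  -- `g` is symmetric near the origin.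
  have hs : ∀ μ ν, Ord 4 fun x => (g x - eta n) μ ν - ev (s₂ μ ν) x - ev (s₃ μ ν) x := by
    intro μ ν
    refine (((hqo μ ν).add (hqo ν μ)).const_mul (1 / 2)).congr ?_
    filter_upwards [hgs] with x hx
    have e1 : (g x - eta n) ν μ = (g x - eta n) μ ν := by
      rw [Matrix.sub_apply, Matrix.sub_apply, hx.apply]
      congr 1
      have := congrFun (congrFun (eta_transpose (n := n)) μ) ν
      rwa [Matrix.transpose_apply] at this
    simp only [hs₂, hs₃, ev_smul, ev_add, e1]
    ring
  have z0 : ∀ m : ℕ, ∀ _ _ : Fin (n + 1), (0 : Poly n).IsHomogeneous m := fun m _ _ =>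
    isHomogeneous_zero _ _ _
  have hzero : ∀ ν : Fin (n + 1), lap (0 : Poly n) = dvb (fun _ _ => (0 : Poly n)) ν := fun ν => by
    simp [lap_zero, dvb, dv, tr]
  obtain ⟨ξ, r, hξ, hr, hrs, hl, hd⟩ := exists_wave_gauge_correction hn (m := 0)
    (S := fun _ _ => 0) (V := fun _ => 0)
    (fun μ ν => isHomogeneous_smul _ ((hp μ ν).add (hp ν μ))) hs₂s (z0 0) (fun _ _ => rfl)
    (fun ν => z0 _ ν ν) hzero
  obtain ⟨ξ', r', hξ', hr', hrs', hl', hd'⟩ := exists_wave_gauge_correction hn (m := 1)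
    (S := fun _ _ => 0) (V := fun _ => 0)
    (fun μ ν => isHomogeneous_smul _ ((hq μ ν).add (hq ν μ))) hs₃s (z0 1) (fun _ _ => rfl)
    (fun ν => z0 _ ν ν) hzero
  set h₂ : Fin (n + 1) → Fin (n + 1) → Poly n := fun μ ν =>
    s₂ μ ν + xl μ * ξ ν + xl ν * ξ μ + sig n * r μ ν with hh₂
  set h₃ : Fin (n + 1) → Fin (n + 1) → Poly n := fun μ ν =>
    s₃ μ ν + xl μ * ξ' ν + xl ν * ξ' μ + sig n * r' μ ν with hh₃
  have hh₂h : ∀ μ ν, (h₂ μ ν).IsHomogeneous 2 := fun μ ν =>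
    (((isHomogeneous_smul _ ((hp μ ν).add (hp ν μ))).add (isHomogeneous_xl_mul μ (hξ ν))).add
      (isHomogeneous_xl_mul ν (hξ μ))).add (isHomogeneous_sig_mul (hr μ ν))
  have hh₃h : ∀ μ ν, (h₃ μ ν).IsHomogeneous 3 := fun μ ν =>
    (((isHomogeneous_smul _ ((hq μ ν).add (hq ν μ))).add (isHomogeneous_xl_mul μ (hξ' ν))).add
      (isHomogeneous_xl_mul ν (hξ' μ))).add (isHomogeneous_sig_mul (hr' μ ν))
  set h : Fin (n + 1) → Fin (n + 1) → Poly n := fun μ ν => h₂ μ ν + h₃ μ ν with hh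
  have hsymm : ∀ μ ν, h μ ν = h ν μ := fun μ ν => by
    simp only [hh, hh₂, hh₃]
    rw [hs₂s μ ν, hs₃s μ ν, hrs μ ν, hrs' μ ν]; ring
  have hlap : ∀ μ ν, lap (h μ ν) = 0 := fun μ ν => by
    simp only [hh]; rw [lap_add, hl, hl', add_zero]
  have hdvb : ∀ ν, dvb h ν = 0 := fun ν => by
    simp only [hh]; rw [dvb_add, hd, hd', add_zero]
  have hhO : OrdT 2 (evT h) := fun μ ν => by
    have := (ord_ev (hh₂h μ ν)).add ((ord_ev (hh₃h μ ν)).mono (by norm_num : 2 ≤ 3))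
    refine this.congr (Filter.Eventually.of_forall fun x => ?_)
    simp only [evT, Matrix.of_apply, hh, ev_add]
  set D : ConeData n := (fun ν => ξ ν + ξ' ν, fun μ ν => r μ ν + r' μ ν, fun _ => 0) with hD
  have hrem : OrdT 4 fun x => (modify g D x - eta n) - evT h x := fun μ ν => by
    refine (hs μ ν).congr (Filter.Eventually.of_forall fun x => ?_)
    have e : coneNull D.1 D.2.1 μ ν = h μ ν - s₂ μ ν - s₃ μ ν := by
      simp only [coneNull, hD, hh, hh₂, hh₃]; ring
    simp only [modify, evT, Matrix.sub_apply, Matrix.add_apply, Matrix.of_apply, e, ev_sub]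
    ring
  have hnear : NearEta (modify g D) := fun μ ν => by
    refine (((hrem μ ν).mono (by norm_num : 2 ≤ 4)).add (hhO μ ν)).congr
      (Filter.Eventually.of_forall fun x => ?_)
    simp only [Matrix.sub_apply]
    ring
  have hh0 : OrdT 0 (evT h) := hhO.mono (by norm_num)
  have hric : ∀ μ ν, Ord 2 (ricci (modify g D) μ ν) := fun μ ν => by
    refine (ord_ricci_sub_ricLin (k := 1) nearEta_eta hnear hnear hh0 hrem μ ν).congr
      (Filter.Eventually.of_forall fun x => ?_)
    simp only [ricci_eta]
    rw [ricLin_evT hsymm, hdvb, hdvb, hlap]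
    simp [ev_zero]
  refine ⟨D, fun μ ν => ?_, hnear, fun ν => ?_, hric, fun μ => ?_⟩
  · simp only [hD]; rw [hrs μ ν, hrs' μ ν]
  · refine (ord_harm_sub_densLin (k := 2) nearEta_eta hnear hnear hh0 hrem ν).congr
      (Filter.Eventually.of_forall fun x => ?_)
    simp only [harm_eta]
    rw [sum_pd_densLin_evT, hdvb]
    simp [ev_zero]
  · refine (Ord.sum (s := Finset.univ) fun ν _ => (hric μ ν).mul (ord_coord ν)).congr
      (Filter.Eventually.of_forall fun x => ?_)
    simp [hD, ev_zero]

/-- Add `h` of degree `j + 4` with gauge divergence `V` and `□ h = ∂_μ V_ν + ∂_ν V_μ + S`. The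
linearized Ricci tensor is then `-½ S`. Thus `V` cancels the leading gauge defect, the contraction
of `S` with `x` cancels the leading constraint defect modulo `σ`, and the linearization errors are
`O(|x|^{j+4})` or better. As `S` has degree `j + 2`, the bound `O(|x|²)` on Ricci is preserved. -/
lemma SolvesTo.exists_step (hn : 2 ≤ n) {g : TensorField n} {j : ℕ} {D : ConeData n}
    (hD : SolvesTo g (j + 3) D) :
    ∃ E : ConeData n, ((∀ ν, (E.1 ν).IsHomogeneous (j + 3)) ∧
      (∀ μ ν, (E.2.1 μ ν).IsHomogeneous (j + 2)) ∧ ∀ ν, (E.2.2 ν).IsHomogeneous (j + 1)) ∧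
      SolvesTo g (j + 1 + 3) (D + E) := by
  choose v hv hvo using fun ν => (hD.gauge ν).exists_taylor
  choose w hw hwo using fun μ => (hD.constraint μ).exists_taylor
  -- The linearized harmonic condition is `-sgn ν · dvb h ν`, so this sign choice makes it equal to
  -- `-v ν`.
  set V : Fin (n + 1) → Poly n := fun ν => sgn ν • v ν with hV
  have hVh : ∀ ν, (V ν).IsHomogeneous (j + 2 + 1) := fun ν => isHomogeneous_smul _ (hv ν)
  -- The factor `2` compensates the `-½` in `-½ S`; correspondingly the multiplier of `σ` changes by
  -- `-½ P`.
  obtain ⟨S, P, hSh, hSs, hPh, hSd, hSx⟩ := exists_divergence_free_contraction (m := j + 1)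
    (W := fun ν => (2 : ℝ) • w ν) hn fun ν => isHomogeneous_smul _ (hw ν)
  obtain ⟨ξ, q, hξ, hq, hqs, hl, hd⟩ := exists_wave_gauge_correction hn (m := j + 2)
    (s := fun _ _ => 0) (S := fun μ ν => (pderiv μ (V ν) + pderiv ν (V μ)) + S μ ν) (V := V)
    (fun _ _ => isHomogeneous_zero _ _ _) (fun _ _ => rfl)
    (fun μ ν => ((isHomogeneous_pderiv μ (hVh ν)).add (isHomogeneous_pderiv ν (hVh μ))).add
      (hSh μ ν)) (fun μ ν => by rw [hSs μ ν, add_comm (pderiv μ (V ν))]) hVh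
    (fun ν => by rw [dvb_add, dvb_pderiv_symm, hSd, add_zero])
  simp only [zero_add] at hl hd
  set h : Fin (n + 1) → Fin (n + 1) → Poly n := coneNull ξ q with hh
  have hl' : ∀ μ ν, lap (h μ ν) = (pderiv μ (V ν) + pderiv ν (V μ)) + S μ ν := hl
  have hd' : ∀ ν, dvb h ν = V ν := hd
  have hhh : ∀ μ ν, (h μ ν).IsHomogeneous (j + 4) := fun μ ν =>
    ((isHomogeneous_xl_mul μ (hξ ν)).add (isHomogeneous_xl_mul ν (hξ μ))).add
      (isHomogeneous_sig_mul (hq μ ν))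
  have hsymm : ∀ μ ν, h μ ν = h ν μ := fun μ ν => by
    simp only [hh, coneNull]; rw [hqs μ ν]; ring
  have hhO : OrdT (j + 4) (evT h) := ordT_evT hhh
  set E : ConeData n := (ξ, q, fun ν => -(1 / 2 : ℝ) • P ν) with hE
  have hmod : ∀ x, modify g (D + E) x = modify g D x + evT h x := fun x => modify_add g D E x
  have hdiff : ∀ x, modify g (D + E) x - modify g D x = evT h x := fun x => by
    rw [hmod, add_sub_cancel_left]
  have hdO : OrdT (j + 4) fun x => modify g (D + E) x - modify g D x := by
    simp only [hdiff]; exact hhO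
  have hrem : ∀ k, OrdT k fun x => (modify g (D + E) x - modify g D x) - evT h x :=
    fun k μ ν => by
      simp only [hdiff, sub_self]; exact ord_const_zero k
  have hnear : NearEta (modify g (D + E)) := by
    have := hD.near.add (hhO.mono (by omega : 2 ≤ j + 4))
    simpa only [← hmod] using this
  have hh0 : OrdT 0 (evT h) := hhO.mono (by omega)
  have hricE : ∀ μ ν x, ricLin (evT h) μ ν x = -(1 / 2) * ev (S μ ν) x := fun μ ν x => by
    rw [ricLin_evT hsymm, hd', hd', hl', ev_smul, ev_sub, ev_add, ev_add, ev_add]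
    ring
  have hric : ∀ μ ν, Ord (j + 4) fun x => ricci (modify g (D + E)) μ ν x -
      ricci (modify g D) μ ν x - -(1 / 2) * ev (S μ ν) x := fun μ ν => by
    have := ord_ricci_sub_ricLin (k := j + 3) hD.near hnear hdO hh0 (hrem _) μ ν
    simpa only [hricE] using this
  refine ⟨E, ⟨hξ, hq, fun ν => isHomogeneous_smul _ (hPh ν)⟩, fun μ ν => ?_, hnear, fun ν => ?_,
    fun μ ν => ?_, fun μ => ?_⟩
  · have : (D + E).2.1 μ ν = D.2.1 μ ν + q μ ν := rfl
    rw [this, hD.symm, hqs]; rfl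
  · have h1 := ord_harm_sub_densLin (k := j + 4) hD.near hnear hdO hh0 (hrem _) ν
    refine ((h1.mono (by omega : j + 1 + 3 ≤ j + 4 + 1)).add (hvo ν)).congr
      (Filter.Eventually.of_forall fun x => ?_)
    simp only
    rw [sum_pd_densLin_evT, hd', hV, ev_smul]
    have := sgn_mul_self ν
    linear_combination (ev (v ν) x) * this
  · refine ((((hric μ ν).mono (by omega : 2 ≤ j + 4)).add (hD.vacuum μ ν)).add
      (((ord_ev (hSh μ ν)).mono (by omega : 2 ≤ j + 1 + 1)).const_mul (-(1 / 2)))).congr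
      (Filter.Eventually.of_forall fun x => ?_)
    ring
  · have h1 : Ord (j + 1 + 3) fun x => ∑ ν, (ricci (modify g (D + E)) μ ν x -
        ricci (modify g D) μ ν x - -(1 / 2) * ev (S μ ν) x) * x ν :=
      Ord.sum fun ν _ => Ord.mul_smooth (hric μ ν) (contDiff_coord ν).contDiffAt
    refine (h1.add (hwo μ)).congr (Filter.Eventually.of_forall fun x => ?_)
    have h2 : ∑ ν, x ν * ev (S μ ν) x = 2 * ev (w μ) x + ev (sig n) x * ev (P μ) x := by
      have := congrFun (congrArg ev (hSx μ)) x
      simpa only [dot, ev_sum, ev_mul, ev_X, ev_add, ev_smul] using this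
    have h3 : ev ((D + E).2.2 μ) x = ev (D.2.2 μ) x - (1 / 2) * ev (P μ) x := by
      have : (D + E).2.2 μ = D.2.2 μ + -(1 / 2 : ℝ) • P μ := rfl
      rw [this, ev_add, ev_smul]; ring
    simp only
    rw [h3]
    have h4 : ∑ ν, (ricci (modify g (D + E)) μ ν x - ricci (modify g D) μ ν x -
        -(1 / 2) * ev (S μ ν) x) * x ν = ∑ ν, ricci (modify g (D + E)) μ ν x * x ν -
        ∑ ν, ricci (modify g D) μ ν x * x ν + (1 / 2) * ∑ ν, x ν * ev (S μ ν) x := by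
      rw [Finset.mul_sum, ← Finset.sum_sub_distrib, ← Finset.sum_add_distrib]
      exact Finset.sum_congr rfl fun ν _ => by ring
    rw [h4, h2]
    ring

/-- The metric `g`, modified by a smooth tensor inducing zero on the cone. -/
def modifySmooth (g : TensorField n) (ξ : Fin (n + 1) → Coord n → ℝ)
    (q : Fin (n + 1) → Fin (n + 1) → Coord n → ℝ) : TensorField n :=
  fun x => g x + Matrix.of fun μ ν =>
    ev (xl μ) x * ξ ν x + ev (xl ν) x * ξ μ x + ev (sig n) x * q μ ν x

lemma exists_contDiff_ord_sub_ev {p : ℕ → Poly n} {r : Poly n} {d : ℕ → ℕ} (hd : ∀ j, j ≤ d j)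
    (hp : ∀ j, (p j).IsHomogeneous (d j)) : ∃ f : Coord n → ℝ, ContDiff ℝ ∞ f ∧
      ∀ N, Ord N fun x => f x - ev (r + ∑ j ∈ Finset.range N, p j) x := by
  obtain ⟨f, hf, hfN⟩ := exists_contDiff_ord_sub_sum hd hp
  refine ⟨fun x => ev r x + f x, (contDiff_ev r).add hf, fun N => (hfN N).congr
    (Filter.Eventually.of_forall fun x => ?_)⟩
  simp only [ev_add, ev_sum]
  ring

/-- There is a metric inducing the same tensor as `g` on the cone that satisfies the wave gauge
condition to infinite order, and the vacuum constraints to infinite order modulo `σ`. -/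
theorem exists_formal_solution (hn : 2 ≤ n) {g : TensorField n} (hg : NearEta g)
    (hgs : ∀ᶠ x in 𝓝 0, (g x).IsSymm) :
    ∃ (ξ : Fin (n + 1) → Coord n → ℝ) (q : Fin (n + 1) → Fin (n + 1) → Coord n → ℝ)
      (P : Fin (n + 1) → Coord n → ℝ), (∀ ν, ContDiff ℝ ∞ (ξ ν)) ∧ (∀ μ ν, ContDiff ℝ ∞ (q μ ν)) ∧
      (∀ μ ν, q μ ν = q ν μ) ∧ (∀ μ, ContDiff ℝ ∞ (P μ)) ∧ NearEta (modifySmooth g ξ q) ∧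
      (∀ N ν, Ord N (harm (modifySmooth g ξ q) ν)) ∧
      (∀ μ ν, Ord 2 (ricci (modifySmooth g ξ q) μ ν)) ∧
      ∀ N μ, Ord N fun x => ∑ ν, ricci (modifySmooth g ξ q) μ ν x * x ν -
        P μ x * ev (sig n) x := by
  obtain ⟨D₀, hD₀⟩ := exists_solvesTo_three hn hg hgs
  choose inc hinc hstep using fun (j : ℕ) (D : ConeData n) (hD : SolvesTo g (j + 3) D) =>
    hD.exists_step hn
  set seq : ∀ j : ℕ, {D : ConeData n // SolvesTo g (j + 3) D} := fun j =>
    Nat.rec (motive := fun j => {D : ConeData n // SolvesTo g (j + 3) D}) ⟨D₀, hD₀⟩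
      (fun j D => ⟨D.1 + inc j D.1 D.2, hstep j D.1 D.2⟩) j with hseq
  set E : ℕ → ConeData n := fun j => inc j (seq j).1 (seq j).2 with hE
  have hE1 : ∀ j ν, ((E j).1 ν).IsHomogeneous (j + 3) := fun j => (hinc j _ _).1
  have hE2 : ∀ j μ ν, ((E j).2.1 μ ν).IsHomogeneous (j + 2) := fun j => (hinc j _ _).2.1
  have hE3 : ∀ j ν, ((E j).2.2 ν).IsHomogeneous (j + 1) := fun j => (hinc j _ _).2.2
  have hsum : ∀ N, (seq N).1 = D₀ + ∑ j ∈ Finset.range N, E j := fun N => by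
    induction N with
    | zero => simp [hseq]
    | succ N ih =>
      rw [Finset.sum_range_succ, ← add_assoc, ← ih]
  have hsum1 : ∀ N ν, (seq N).1.1 ν = D₀.1 ν + ∑ j ∈ Finset.range N, (E j).1 ν := fun N ν => by
    rw [hsum]; simp [Prod.fst_sum, Finset.sum_apply]
  have hsum2 : ∀ N μ ν, (seq N).1.2.1 μ ν = D₀.2.1 μ ν + ∑ j ∈ Finset.range N, (E j).2.1 μ ν :=
    fun N μ ν => by rw [hsum]; simp [Prod.fst_sum, Prod.snd_sum, Finset.sum_apply]
  have hsum3 : ∀ N ν, (seq N).1.2.2 ν = D₀.2.2 ν + ∑ j ∈ Finset.range N, (E j).2.2 ν :=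
    fun N ν => by rw [hsum]; simp [Prod.snd_sum, Finset.sum_apply]
  choose ξ hξ hξN using fun ν => exists_contDiff_ord_sub_ev (p := fun j => (E j).1 ν)
    (r := D₀.1 ν) (d := fun j => j + 3) (fun j => by omega) fun j => hE1 j ν
  choose q' hq' hqN' using fun μ ν => exists_contDiff_ord_sub_ev (p := fun j => (E j).2.1 μ ν)
    (r := D₀.2.1 μ ν) (d := fun j => j + 2) (fun j => by omega) fun j => hE2 j μ ν
  choose P hP hPN using fun ν => exists_contDiff_ord_sub_ev (p := fun j => (E j).2.2 ν)
    (r := D₀.2.2 ν) (d := fun j => j + 1) (fun j => by omega) fun j => hE3 j ν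
  simp only [← hsum1] at hξN
  simp only [← hsum2] at hqN'
  simp only [← hsum3] at hPN
  -- Borel sums are chosen independently for each entry, so symmetry has to be restored; the partial
  -- sums are symmetric, hence the asymptotics persist.
  set q : Fin (n + 1) → Fin (n + 1) → Coord n → ℝ := fun μ ν x =>
    (1 / 2) * (q' μ ν x + q' ν μ x) with hq
  have hqN : ∀ μ ν N, Ord N fun x => q μ ν x - ev ((seq N).1.2.1 μ ν) x := fun μ ν N => by
    refine (((hqN' μ ν N).add (hqN' ν μ N)).const_mul (1 / 2)).congr
      (Filter.Eventually.of_forall fun x => ?_)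
    simp only [hq]
    rw [(seq N).2.symm ν μ]; ring
  have hdiff : ∀ N, OrdT N fun x => modifySmooth g ξ q x - modify g (seq N).1 x := fun N μ ν => by
    have h1 := Ord.smooth_mul (contDiff_ev (xl μ)).contDiffAt (hξN ν N)
    have h2 := Ord.smooth_mul (contDiff_ev (xl ν)).contDiffAt (hξN μ N)
    have h3 := Ord.smooth_mul (contDiff_ev (sig n)).contDiffAt (hqN μ ν N)
    refine ((h1.add h2).add h3).congr (Filter.Eventually.of_forall fun x => ?_)
    simp only [modifySmooth, modify, evT, coneNull, Matrix.sub_apply, Matrix.add_apply,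
      Matrix.of_apply, ev_add, ev_mul]
    ring
  have hnear : NearEta (modifySmooth g ξ q) := fun μ ν => by
    refine (((seq 2).2.near μ ν).add (hdiff 2 μ ν)).congr
      (Filter.Eventually.of_forall fun x => ?_)
    simp only [Matrix.sub_apply]
    ring
  -- The Ricci tensor loses two derivatives, hence the comparison with stage `N + 2`.
  have hricN : ∀ N μ ν, Ord N fun x => ricci (modifySmooth g ξ q) μ ν x -
      ricci (modify g (seq (N + 2)).1) μ ν x := fun N μ ν =>
    ord_ricci_sub_of_ord (seq (N + 2)).2.near hnear (hdiff (N + 2)) μ ν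
  refine ⟨ξ, q, P, hξ, fun μ ν => contDiff_const.mul ((hq' μ ν).add (hq' ν μ)), fun μ ν => ?_, hP,
    hnear, fun N ν => ?_, fun μ ν => ?_, fun N μ => ?_⟩
  · funext x; simp only [hq, add_comm]
  · refine ((ord_harm_sub_of_ord (seq (N + 1)).2.near hnear (hdiff (N + 1)) ν).add
      (((seq (N + 1)).2.gauge ν).mono (by omega))).congr (Filter.Eventually.of_forall fun x => ?_)
    ring
  · refine ((hricN 2 μ ν).add ((seq (2 + 2)).2.vacuum μ ν)).congr
      (Filter.Eventually.of_forall fun x => ?_)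
    ring
  · have h1 : Ord N fun x => ∑ ν, (ricci (modifySmooth g ξ q) μ ν x -
        ricci (modify g (seq (N + 2)).1) μ ν x) * x ν :=
      Ord.sum fun ν _ => Ord.mul_smooth (hricN N μ ν) (contDiff_coord ν).contDiffAt
    have h2 := ((seq (N + 2)).2.constraint μ).mono (by omega : N ≤ N + 2 + 3)
    have h3 := ((hPN μ (N + 2)).mono (by omega : N ≤ N + 2)).mul_smooth
      (contDiff_ev (sig n)).contDiffAt
    refine ((h1.add h2).sub h3).congr (Filter.Eventually.of_forall fun x => ?_)
    simp only [sub_mul, Finset.sum_sub_distrib]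
    ring

end

section

variable {n : ℕ}

/-! ### Functions that are flat along the kernel of a projection -/

lemma differentiable_of_contDiff {f : Coord n → ℝ} (hf : ContDiff ℝ ∞ f) : Differentiable ℝ f :=
  hf.differentiable (by simp)

/-- Iterated partial derivatives. -/
def iterPd : List (Fin (n + 1)) → (Coord n → ℝ) → Coord n → ℝ
  | [], F => F
  | i :: l, F => iterPd l (pd i F)

/-- `F` is smooth and vanishes to infinite order along the kernel of `L`. -/
def Flat (L : Coord n →L[ℝ] Coord n) (F : Coord n → ℝ) : Prop :=
  ContDiff ℝ ∞ F ∧ ∀ l z, L z = 0 → iterPd l F z = 0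

variable {L : Coord n →L[ℝ] Coord n} {F H : Coord n → ℝ}

lemma Flat.differentiable (hF : Flat L F) : Differentiable ℝ F := differentiable_of_contDiff hF.1

lemma Flat.eq_zero (hF : Flat L F) {z : Coord n} (hz : L z = 0) : F z = 0 := hF.2 [] z hz

lemma Flat.pd (hF : Flat L F) (i : Fin (n + 1)) : Flat L (pd i F) :=
  ⟨contDiff_pd i hF.1, fun l z hz => hF.2 (i :: l) z hz⟩

/-- Smoothness of singular-looking functions is proved by exhibiting a class of once differentiable
functions closed under partial derivatives; regularity then bootstraps. -/
lemma contDiff_nat_of_class {𝒮 : Set (Coord n → ℝ)}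
    (h : ∀ F ∈ 𝒮, Differentiable ℝ F ∧ ∀ i, LightCone.pd i F ∈ 𝒮) (m : ℕ) :
    ∀ F ∈ 𝒮, ContDiff ℝ m F := by
  induction m with
  | zero => intro F hF; exact contDiff_zero.2 (h F hF).1.continuous
  | succ m ih =>
    intro F hF
    have e : fderiv ℝ F = fun x => ∑ i, LightCone.pd i F x •
        (EuclideanSpace.proj i : Coord n →L[ℝ] ℝ) := by
      funext x
      ext v
      rw [fderiv_apply_eq_sum, sum_apply]
      exact Finset.sum_congr rfl fun i _ => by simp [mul_comm]
    have : ((m + 1 : ℕ) : WithTop ℕ∞) = (m : WithTop ℕ∞) + 1 := by push_cast; rfl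
    rw [this, contDiff_succ_iff_fderiv]
    refine ⟨(h F hF).1, by simp, ?_⟩
    rw [e]
    exact ContDiff.sum fun i _ => (ih _ ((h F hF).2 i)).smul contDiff_const

/-- A class of differentiable functions vanishing on the kernel of `L` and stable under partial
derivatives consists of flat functions. -/
lemma flat_of_class {𝒮 : Set (Coord n → ℝ)} (h : ∀ F ∈ 𝒮, Differentiable ℝ F ∧
    (∀ z, L z = 0 → F z = 0) ∧ ∀ i, LightCone.pd i F ∈ 𝒮) : ∀ F ∈ 𝒮, Flat L F := by
  intro F hF
  refine ⟨contDiff_infty.2 fun m =>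
    contDiff_nat_of_class (fun F hF => ⟨(h F hF).1, (h F hF).2.2⟩) m F hF, fun l => ?_⟩
  induction l generalizing F with
  | nil => exact (h F hF).2.1
  | cons i l ih => exact ih (LightCone.pd i F) ((h F hF).2.2 i)

lemma iterPd_add (l : List (Fin (n + 1))) : ∀ {F H : Coord n → ℝ}, ContDiff ℝ ∞ F →
    ContDiff ℝ ∞ H → iterPd l (fun z => F z + H z) = fun z => iterPd l F z + iterPd l H z := by
  induction l with
  | nil => intro F H _ _; rfl
  | cons i l ih =>
    intro F H hF hH
    have : pd i (fun z => F z + H z) = fun z => pd i F z + pd i H z := by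
      funext z
      exact pd_add i (differentiable_of_contDiff hF z) (differentiable_of_contDiff hH z)
    simp only [iterPd, this]
    exact ih (contDiff_pd i hF) (contDiff_pd i hH)

lemma Flat.add (hF : Flat L F) (hH : Flat L H) : Flat L fun z => F z + H z :=
  ⟨hF.1.add hH.1, fun l z hz => by
    rw [iterPd_add l hF.1 hH.1]
    show iterPd l F z + iterPd l H z = 0
    rw [hF.2 l z hz, hH.2 l z hz, add_zero]⟩

lemma Flat.smooth_mul {c : Coord n → ℝ} (hc : ContDiff ℝ ∞ c) (hF : Flat L F) :
    Flat L fun z => c z * F z := by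
  refine ⟨hc.mul hF.1, fun l => ?_⟩
  induction l generalizing c F with
  | nil => intro z hz; simp [iterPd, hF.eq_zero hz]
  | cons i l ih =>
    intro z hz
    have : LightCone.pd i (fun z => c z * F z) = fun z =>
        LightCone.pd i c z * F z + c z * LightCone.pd i F z := by
      funext z
      exact pd_mul i (differentiable_of_contDiff hc z) (hF.differentiable z)
    simp only [iterPd, this]
    rw [iterPd_add l ((contDiff_pd i hc).mul hF.1) (hc.mul (contDiff_pd i hF.1))]
    have h1 := ih (contDiff_pd i hc) hF z hz
    have h2 := ih hc (hF.pd i) z hz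
    linarith

lemma Flat.const_mul (c : ℝ) (hF : Flat L F) : Flat L fun z => c * F z :=
  hF.smooth_mul contDiff_const

lemma Flat.neg (hF : Flat L F) : Flat L fun z => -F z := by
  simpa using hF.const_mul (-1)

lemma Flat.sub (hF : Flat L F) (hH : Flat L H) : Flat L fun z => F z - H z := by
  simpa only [sub_eq_add_neg] using hF.add hH.neg

lemma iterPd_zero (l : List (Fin (n + 1))) (z : Coord n) : iterPd l (fun _ => (0 : ℝ)) z = 0 := by
  induction l with
  | nil => rfl
  | cons i l ih =>
    have : pd i (fun _ : Coord n => (0 : ℝ)) = fun _ => 0 := by funext z; exact pd_const i 0 z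
    simp only [iterPd, this]; exact ih

lemma flat_zero : Flat L fun _ => (0 : ℝ) := ⟨contDiff_const, fun l z _ => iterPd_zero l z⟩

lemma Flat.sum {ι : Type*} (s : Finset ι) {f : ι → Coord n → ℝ} (h : ∀ i ∈ s, Flat L (f i)) :
    Flat L fun z => ∑ i ∈ s, f i z := by
  classical
  induction s using Finset.induction_on with
  | empty => simpa using flat_zero
  | insert a s ha ih =>
    simp only [Finset.sum_insert ha]
    exact (h a (Finset.mem_insert_self a s)).add
      (ih fun i hi => h i (Finset.mem_insert_of_mem hi))

/-- A flat function is bounded by every power of the distance to the kernel. -/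
lemma Flat.exists_bound (hL : ∀ z, L (L z) = L z) (N : ℕ) : ∀ {F : Coord n → ℝ}, Flat L F →
    ∀ R : ℝ, ∃ C : ℝ, 0 ≤ C ∧ ∀ z, ‖z‖ ≤ R → |F z| ≤ C * ‖L z‖ ^ N := by
  induction N with
  | zero =>
    intro F hF R
    obtain ⟨C, hC⟩ := (isCompact_closedBall (0 : Coord n) R).exists_bound_of_continuousOn
      hF.1.continuous.continuousOn
    refine ⟨max C 0, le_max_right _ _, fun z hz => ?_⟩
    rw [pow_zero, mul_one]
    exact (hC z (by simpa using hz)).trans (le_max_left _ _)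
  | succ N ih =>
    intro F hF R
    set R' := (1 + ‖L‖) * R with hR'
    choose C hC0 hC using fun i => ih (hF.pd i) R'
    refine ⟨∑ i, C i, Finset.sum_nonneg fun i _ => hC0 i, fun z hz => ?_⟩
    have hR0 : 0 ≤ R := (norm_nonneg z).trans hz
    have hLz : ‖L z‖ ≤ ‖L‖ * R := (L.le_opNorm z).trans (by gcongr)
    have ha : z - L z ∈ Metric.closedBall (0 : Coord n) R' := by
      rw [mem_closedBall_zero_iff]
      refine (norm_sub_le _ _).trans ?_
      rw [hR']; linarith
    have hb : z ∈ Metric.closedBall (0 : Coord n) R' := by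
      rw [mem_closedBall_zero_iff, hR']
      nlinarith [norm_nonneg L, mul_nonneg (norm_nonneg L) hR0]
    have hLa : L (z - L z) = 0 := by rw [map_sub, hL, sub_self]
    -- Integrate from `z - L z`, which lies in the kernel, to `z`. On this segment `|L y| ≤ |L z|`,
    -- so the inductive bound for the gradient gains one factor `|L z|`. The radius `R'` is large
    -- enough to contain the segment.
    have hseg := (convex_segment (𝕜 := ℝ) (z - L z) z).norm_image_sub_le_of_norm_fderiv_le
      (𝕜 := ℝ) (f := F) (C := (∑ i, C i) * ‖L z‖ ^ N) (fun y _ => hF.differentiable y)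
      (fun y hy => by
        have hyR : ‖y‖ ≤ R' := by
          simpa using (convex_closedBall (0 : Coord n) R').segment_subset ha hb hy
        have hyL : ‖L y‖ ≤ ‖L z‖ := by
          obtain ⟨a, b, ha, hb, hab, rfl⟩ := hy
          rw [map_add, map_smul, map_smul, hLa, smul_zero, zero_add, norm_smul,
            Real.norm_of_nonneg hb]
          exact mul_le_of_le_one_left (norm_nonneg _) (by linarith)
        refine (norm_fderiv_le_sum F y).trans ?_
        rw [Finset.sum_mul]
        refine Finset.sum_le_sum fun i _ => (hC i y hyR).trans ?_
        gcongr
        exact hC0 i)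
      (left_mem_segment ℝ _ _) (right_mem_segment ℝ _ _)
    rw [hF.eq_zero hLa, sub_zero, sub_sub_cancel] at hseg
    rw [pow_succ, ← mul_assoc]
    exact hseg

/-- No regularity of `F` is assumed: a quadratic bound in the distance to the kernel suffices. This
supplies differentiability exactly where quotients by `|L z|` are singular. -/
lemma hasFDerivAt_zero_of_bound {z : Coord n} (hz : L z = 0) {C : ℝ}
    (h : ∀ᶠ y in 𝓝 z, |F y| ≤ C * ‖L y‖ ^ 2) : HasFDerivAt F (0 : Coord n →L[ℝ] ℝ) z := by
  have hFz : F z = 0 := by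
    have := h.self_of_nhds
    rw [hz] at this
    simpa using this
  refine HasFDerivAt.of_isLittleO ?_
  have h1 : (fun y => F y - F z - (0 : Coord n →L[ℝ] ℝ) (y - z)) =O[𝓝 z]
      fun y => ‖y - z‖ ^ 2 := by
    refine Asymptotics.IsBigO.of_bound (|C| * ‖L‖ ^ 2) ?_
    filter_upwards [h] with y hy
    have hLy : ‖L y‖ ≤ ‖L‖ * ‖y - z‖ := by
      have : L y = L (y - z) := by rw [map_sub, hz, sub_zero]
      rw [this]; exact L.le_opNorm _
    simp only [hFz, sub_zero, zero_apply, norm_pow, norm_norm]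
    rw [Real.norm_eq_abs]
    calc |F y| ≤ C * ‖L y‖ ^ 2 := hy
      _ ≤ |C| * (‖L‖ * ‖y - z‖) ^ 2 := by gcongr; exact le_abs_self C
      _ = |C| * ‖L‖ ^ 2 * ‖y - z‖ ^ 2 := by ring
  refine h1.trans_isLittleO ?_
  have h2 : (fun y : Coord n => ‖y - z‖ ^ 2) =o[𝓝 z] fun y => ‖y - z‖ ^ 1 := by
    have := (Asymptotics.isLittleO_pow_pow (𝕜 := ℝ) (m := 1) (n := 2) (by norm_num)).comp_tendsto
      (k := fun y : Coord n => ‖y - z‖) (l' := 𝓝 z) (by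
        have : Filter.Tendsto (fun y : Coord n => ‖y - z‖) (𝓝 z) (𝓝 ‖z - z‖) :=
          (by fun_prop : Continuous fun y : Coord n => ‖y - z‖).tendsto z
        simpa using this)
    exact this
  simpa only [pow_one, Asymptotics.isLittleO_norm_right] using h2

/-- The derivative of `½ |Lz|²` in the direction of the `i`-th axis. -/
def rad (L : Coord n →L[ℝ] Coord n) (i : Fin (n + 1)) (z : Coord n) : ℝ :=
  ∑ j, L z j * L (EuclideanSpace.single i 1) j

lemma contDiff_apply_clm (L : Coord n →L[ℝ] Coord n) (j : Fin (n + 1)) :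
    ContDiff ℝ ∞ fun z => L z j :=
  (contDiff_coord j).comp L.contDiff

lemma contDiff_rad (i : Fin (n + 1)) : ContDiff ℝ ∞ (rad L i) :=
  ContDiff.sum fun j _ => (contDiff_apply_clm L j).mul contDiff_const

lemma norm_sq_eq_sum (x : Coord n) : ‖x‖ ^ 2 = ∑ j, x j * x j := by
  rw [EuclideanSpace.real_norm_sq_eq]
  exact Finset.sum_congr rfl fun j _ => sq _

lemma contDiff_norm_sq_clm (L : Coord n →L[ℝ] Coord n) : ContDiff ℝ ∞ fun z => ‖L z‖ ^ 2 := by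
  simp only [norm_sq_eq_sum]
  exact ContDiff.sum fun j _ => (contDiff_apply_clm L j).mul (contDiff_apply_clm L j)

lemma pd_apply_clm (L : Coord n →L[ℝ] Coord n) (i j : Fin (n + 1)) (z : Coord n) :
    pd i (fun z => L z j) z = L (EuclideanSpace.single i 1) j := by
  have : HasFDerivAt (fun z => L z j) ((EuclideanSpace.proj j : Coord n →L[ℝ] ℝ).comp L) z :=
    ((EuclideanSpace.proj j : Coord n →L[ℝ] ℝ).comp L).hasFDerivAt
  rw [pd, this.fderiv]; rfl

lemma differentiableAt_norm_clm {z : Coord n} (hz : L z ≠ 0) :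
    DifferentiableAt ℝ (fun z => ‖L z‖) z :=
  L.differentiableAt.norm ℝ hz

lemma pd_norm_clm (i : Fin (n + 1)) {z : Coord n} (hz : L z ≠ 0) :
    pd i (fun z => ‖L z‖) z = rad L i z / ‖L z‖ := by
  have hd := differentiableAt_norm_clm hz
  have h1 : pd i (fun z => ‖L z‖ * ‖L z‖) z = 2 * rad L i z := by
    have e : (fun z => ‖L z‖ * ‖L z‖) = fun z => ∑ j, L z j * L z j := by
      funext z; rw [← norm_sq_eq_sum, sq]
    have hj : ∀ j, DifferentiableAt ℝ (fun z => L z j) z := fun j =>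
      differentiable_of_contDiff (contDiff_apply_clm L j) z
    rw [e, pd_sum _ _ fun j _ => (hj j).fun_mul (hj j), rad, Finset.mul_sum]
    refine Finset.sum_congr rfl fun j _ => ?_
    rw [pd_mul i (hj j) (hj j), pd_apply_clm]; ring
  rw [pd_mul i hd hd] at h1
  rw [eq_div_iff (norm_ne_zero_iff.2 hz)]
  linarith

lemma pd_inv_norm_pow (i : Fin (n + 1)) (p : ℕ) {z : Coord n} (hz : L z ≠ 0) :
    DifferentiableAt ℝ (fun z => (‖L z‖ ^ p)⁻¹) z ∧
    pd i (fun z => (‖L z‖ ^ p)⁻¹) z = -(p * rad L i z) * (‖L z‖ ^ (p + 2))⁻¹ := by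
  have hd := differentiableAt_norm_clm hz
  have hn : ‖L z‖ ≠ 0 := norm_ne_zero_iff.2 hz
  have h1 : HasFDerivAt (fun z => (‖L z‖ ^ p)⁻¹)
      ((-((p : ℝ) * ‖L z‖ ^ (p - 1)) / (‖L z‖ ^ p) ^ 2) • fderiv ℝ (fun z => ‖L z‖) z) z := by
    have h2 : HasDerivAt (fun r : ℝ => (r ^ p)⁻¹)
        (-((p : ℝ) * ‖L z‖ ^ (p - 1)) / (‖L z‖ ^ p) ^ 2) ‖L z‖ :=
      (hasDerivAt_pow p ‖L z‖).fun_inv (pow_ne_zero p hn)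
    exact HasDerivAt.comp_hasFDerivAt (h₂ := fun r : ℝ => (r ^ p)⁻¹) (f := fun z => ‖L z‖) z h2
      hd.hasFDerivAt
  refine ⟨h1.differentiableAt, ?_⟩
  have e : pd i (fun z => ‖L z‖) z = fderiv ℝ (fun z => ‖L z‖) z (EuclideanSpace.single i 1) := rfl
  rw [pd, h1.fderiv, smul_apply, ← e, pd_norm_clm i hz, smul_eq_mul]
  cases p with
  | zero => simp
  | succ p =>
    rw [Nat.add_sub_cancel]
    field_simp
    ring

/-- The class of all `|L z|^{-p} F` with `F` flat is closed under derivatives: `∂_i` gives `|L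
z|^{-p-2} (|L z|² ∂_i F - p rad_i F)`, whose second factor is again flat. On the kernel the function
and its derivative vanish, because flat functions decay faster than any power. -/
lemma Flat.inv_norm_pow_mul (hL : ∀ z, L (L z) = L z) (hF : Flat L F) (p : ℕ) :
    Flat L fun z => (‖L z‖ ^ p)⁻¹ * F z := by
  refine flat_of_class (𝒮 := {H | ∃ (p : ℕ) (F : Coord n → ℝ), Flat L F ∧
    H = fun z => (‖L z‖ ^ p)⁻¹ * F z}) ?_ _ ⟨p, F, hF, rfl⟩
  rintro _ ⟨p, F, hF, rfl⟩
  have hzero : ∀ z, L z = 0 →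
      HasFDerivAt (fun z => (‖L z‖ ^ p)⁻¹ * F z) (0 : Coord n →L[ℝ] ℝ) z := fun z hz => by
    obtain ⟨C, hC0, hC⟩ := hF.exists_bound hL (p + 2) (‖z‖ + 1)
    refine hasFDerivAt_zero_of_bound hz (C := C) ?_
    filter_upwards [Metric.ball_mem_nhds z one_pos] with y hy
    have hy' : ‖y‖ ≤ ‖z‖ + 1 := by
      have : ‖y - z‖ < 1 := by simpa [dist_eq_norm] using hy
      linarith [norm_sub_norm_le y z]
    have h1 := hC y hy'
    by_cases hLy : L y = 0
    · rw [hF.eq_zero hLy]; simp [hLy]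
    · have hpos : 0 < ‖L y‖ := norm_pos_iff.2 hLy
      rw [abs_mul, abs_of_pos (by positivity)]
      calc (‖L y‖ ^ p)⁻¹ * |F y| ≤ (‖L y‖ ^ p)⁻¹ * (C * ‖L y‖ ^ (p + 2)) := by gcongr
        _ = C * ‖L y‖ ^ 2 := by rw [pow_add]; field_simp
  refine ⟨fun z => ?_, fun z hz => by simp [hF.eq_zero hz], fun i => ?_⟩
  · by_cases hz : L z = 0
    · exact (hzero z hz).differentiableAt
    · exact (pd_inv_norm_pow 0 p hz).1.mul (hF.differentiable z)
  · refine ⟨p + 2, fun z => ‖L z‖ ^ 2 * LightCone.pd i F z - (p * rad L i z) * F z,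
      ((hF.pd i).smooth_mul (contDiff_norm_sq_clm L)).sub
        (hF.smooth_mul (contDiff_const.mul (contDiff_rad i))), ?_⟩
    funext z
    by_cases hz : L z = 0
    · rw [LightCone.pd, (hzero z hz).fderiv]
      simp [hz]
    · have hpos : 0 < ‖L z‖ := norm_pos_iff.2 hz
      rw [pd_mul i (pd_inv_norm_pow i p hz).1 (hF.differentiable z), (pd_inv_norm_pow i p hz).2,
        pow_add]
      field_simp
      ring

lemma Flat.norm_mul (hL : ∀ z, L (L z) = L z) (hF : Flat L F) :
    Flat L fun z => ‖L z‖ * F z := by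
  have := (hF.inv_norm_pow_mul hL 1).smooth_mul (contDiff_norm_sq_clm L)
  refine (funext fun z => ?_ : _ = fun z => ‖L z‖ * F z) ▸ this
  by_cases hz : L z = 0
  · simp [hz]
  · have hpos : 0 < ‖L z‖ := norm_pos_iff.2 hz
    field_simp

end

section

variable {n : ℕ} {L : Coord n →L[ℝ] Coord n} {F H : Coord n → ℝ}

/-! ### Primitives along the axes -/

/-- The point `z` with its `i`-th coordinate multiplied by `u`. -/
def scaleAxis (i : Fin (n + 1)) (u : ℝ) (z : Coord n) : Coord n :=
  z + ((u - 1) * z i) • EuclideanSpace.single i 1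

/-- A weighted average of `F` along the segment joining `z` to the hyperplane `z^i = 0`. -/
def axisMean (i : Fin (n + 1)) (a : ℝ → ℝ) (F : Coord n → ℝ) (z : Coord n) : ℝ :=
  ∫ u in (0 : ℝ)..1, a u * F (scaleAxis i u z)

/-- The primitive of `F` along the `i`-th axis that vanishes for `z^i = 0`. -/
def primitive (i : Fin (n + 1)) (F : Coord n → ℝ) (z : Coord n) : ℝ :=
  z i * axisMean i (fun _ => 1) F z

/-- `scaleAxis` as a continuous linear map. -/
def scaleAxisL (i : Fin (n + 1)) (u : ℝ) : Coord n →L[ℝ] Coord n :=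
  ContinuousLinearMap.id ℝ _ + (u - 1) • (EuclideanSpace.proj i : Coord n →L[ℝ] ℝ).smulRight
    (EuclideanSpace.single i 1)

lemma continuous_scaleAxis (i : Fin (n + 1)) :
    Continuous fun q : Coord n × ℝ => scaleAxis i q.2 q.1 := by
  unfold scaleAxis
  have : Continuous fun q : Coord n × ℝ => q.1 i :=
    (contDiff_coord (m := 0) i).continuous.comp continuous_fst
  fun_prop

lemma scaleAxisL_apply (i : Fin (n + 1)) (u : ℝ) (z : Coord n) :
    scaleAxisL i u z = scaleAxis i u z := by
  simp [scaleAxisL, scaleAxis, smul_smul]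

lemma scaleAxis_single (i j : Fin (n + 1)) (u : ℝ) :
    scaleAxis i u (EuclideanSpace.single j 1) =
      (if j = i then u else 1) • EuclideanSpace.single j (1 : ℝ) := by
  rw [scaleAxis]
  by_cases h : j = i
  · subst h
    simp only [PiLp.single_apply, if_true, mul_one]
    module
  · simp [h, Ne.symm h]

lemma continuous_scaleAxisL (i : Fin (n + 1)) : Continuous (scaleAxisL (n := n) i) := by
  unfold scaleAxisL
  fun_prop

/-- Differentiation under the integral yields an average of the same kind with another continuous
weight. General weights are allowed so that the class of averages of flat functions is closed under
derivatives. -/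
lemma hasFDerivAt_axisMean (i : Fin (n + 1)) {a : ℝ → ℝ} (ha : Continuous a)
    (hF : ContDiff ℝ ∞ F) (z : Coord n) :
    HasFDerivAt (axisMean i a F)
      (∫ u in (0 : ℝ)..1, a u • (fderiv ℝ F (scaleAxis i u z)).comp (scaleAxisL i u)) z ∧
    ∀ j, pd j (axisMean i a F) z =
      axisMean i (fun u => a u * (if j = i then u else 1)) (pd j F) z := by
  have hFc : Continuous F := hF.continuous
  have hF' : Continuous (fderiv ℝ F) := hF.continuous_fderiv (by simp)
  have hc1 : ∀ x : Coord n, Continuous fun u => a u * F (scaleAxis i u x) := fun x =>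
    ha.mul (hFc.comp ((continuous_scaleAxis i).comp (by fun_prop : Continuous fun u => (x, u))))
  have hc2 : Continuous fun q : Coord n × ℝ =>
      a q.2 • (fderiv ℝ F (scaleAxis i q.2 q.1)).comp (scaleAxisL i q.2) :=
    (ha.comp continuous_snd).smul
      ((hF'.comp (continuous_scaleAxis i)).clm_comp ((continuous_scaleAxisL i).comp continuous_snd))
  have hc3 : Continuous fun u => a u • (fderiv ℝ F (scaleAxis i u z)).comp (scaleAxisL i u) :=
    hc2.comp (by fun_prop : Continuous fun u : ℝ => (z, u))
  obtain ⟨C, hC⟩ := ((isCompact_closedBall z 1).prod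
    (isCompact_Icc (a := (0 : ℝ)) (b := 1))).exists_bound_of_continuousOn hc2.continuousOn
  have key : HasFDerivAt (axisMean i a F)
      (∫ u in (0 : ℝ)..1, a u • (fderiv ℝ F (scaleAxis i u z)).comp (scaleAxisL i u)) z := by
    refine intervalIntegral.hasFDerivAt_integral_of_dominated_of_fderiv_le
      (F := fun x u => a u * F (scaleAxis i u x)) (bound := fun _ => C)
      (F' := fun x u => a u • (fderiv ℝ F (scaleAxis i u x)).comp (scaleAxisL i u))
      (Metric.closedBall_mem_nhds z one_pos)
      (Filter.Eventually.of_forall fun x => (hc1 x).aestronglyMeasurable)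
      ((hc1 z).intervalIntegrable _ _) hc3.aestronglyMeasurable
      (Filter.Eventually.of_forall fun u hu x hx => hC (x, u) ⟨hx, ?_⟩)
      intervalIntegrable_const (Filter.Eventually.of_forall fun u _ x _ => ?_)
    · rw [Set.uIoc_of_le zero_le_one] at hu
      exact ⟨hu.1.le, hu.2⟩
    · have h1 : HasFDerivAt (fun x => scaleAxis i u x) (scaleAxisL i u) x := by
        simpa only [← scaleAxisL_apply] using (scaleAxisL i u).hasFDerivAt
      exact ((differentiable_of_contDiff hF _).hasFDerivAt.comp x h1).const_mul (a u)
  refine ⟨key, fun j => ?_⟩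
  rw [pd, key.fderiv, ContinuousLinearMap.intervalIntegral_apply (hc3.intervalIntegrable _ _)]
  refine intervalIntegral.integral_congr fun u _ => ?_
  simp only [smul_apply, ContinuousLinearMap.comp_apply, scaleAxisL_apply, scaleAxis_single,
    map_smul, smul_eq_mul, pd, mul_assoc]

lemma Flat.axisMean (i : Fin (n + 1)) (hL : ∀ u z, L z = 0 → L (scaleAxis i u z) = 0)
    (hF : Flat L F) {a : ℝ → ℝ} (ha : Continuous a) : Flat L (axisMean i a F) := by
  refine flat_of_class (𝒮 := {H | ∃ (a : ℝ → ℝ) (F : Coord n → ℝ), Continuous a ∧ Flat L F ∧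
    H = LightCone.axisMean i a F}) ?_ _ ⟨a, F, ha, hF, rfl⟩
  rintro _ ⟨a, F, ha, hF, rfl⟩
  refine ⟨fun z => (hasFDerivAt_axisMean i ha hF.1 z).1.differentiableAt, fun z hz => ?_,
    fun j => ⟨_, _, ?_, hF.pd j, funext fun z => (hasFDerivAt_axisMean i ha hF.1 z).2 j⟩⟩
  · simp [LightCone.axisMean, hF.eq_zero (hL _ z hz)]
  · refine ha.mul ?_
    split_ifs <;> fun_prop

lemma Flat.primitive (i : Fin (n + 1)) (hL : ∀ u z, L z = 0 → L (scaleAxis i u z) = 0)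
    (hF : Flat L F) : Flat L (primitive i F) :=
  (hF.axisMean i hL continuous_const).smooth_mul (contDiff_coord i)

/-- Integrate the derivative of `u ↦ u F(scaleAxis i u z)` over `[0, 1]`. -/
lemma pd_primitive (i : Fin (n + 1)) (hF : ContDiff ℝ ∞ F) (z : Coord n) :
    pd i (primitive i F) z = F z := by
  have hd := hasFDerivAt_axisMean i (a := fun _ => 1) continuous_const hF z
  have hs : Continuous fun u : ℝ => scaleAxis i u z :=
    (continuous_scaleAxis i).comp (by fun_prop : Continuous fun u : ℝ => (z, u))
  have hc : ∀ {H : Coord n → ℝ}, ContDiff ℝ ∞ H → Continuous fun u => H (scaleAxis i u z) :=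
    fun hH => hH.continuous.comp hs
  have hderiv : ∀ u, HasDerivAt (fun u => u * F (scaleAxis i u z))
      (1 * F (scaleAxis i u z) + u * (z i * pd i F (scaleAxis i u z))) u := fun u => by
    refine (hasDerivAt_id u).mul ?_
    have h1 : HasDerivAt (fun u => scaleAxis i u z) (z i • EuclideanSpace.single i 1) u := by
      unfold scaleAxis
      have := (((hasDerivAt_id u).sub_const 1).mul_const (z i)).smul_const
        (EuclideanSpace.single i (1 : ℝ) : Coord n)
      simpa using this.const_add z
    have h2 : HasDerivAt (fun u => F (scaleAxis i u z)) _ u :=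
      (differentiable_of_contDiff hF _).hasFDerivAt.comp_hasDerivAt u h1
    simpa only [pd, map_smul, smul_eq_mul] using h2
  have hi1 : IntervalIntegrable (fun u => 1 * F (scaleAxis i u z)) MeasureTheory.volume 0 1 :=
    (continuous_const.mul (hc hF)).intervalIntegrable _ _
  have hi2 : IntervalIntegrable (fun u => u * (z i * pd i F (scaleAxis i u z)))
      MeasureTheory.volume 0 1 :=
    (continuous_id.mul (continuous_const.mul (hc (contDiff_pd i hF)))).intervalIntegrable _ _
  have hint := intervalIntegral.integral_eq_sub_of_hasDerivAt
    (fun u _ => hderiv u) (hi1.add hi2)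
  have hs1 : scaleAxis i 1 z = z := by simp [scaleAxis]
  rw [intervalIntegral.integral_add hi1 hi2, one_mul, zero_mul, sub_zero, hs1] at hint
  unfold primitive
  rw [pd_mul i (differentiable_of_contDiff (contDiff_coord i) z) hd.1.differentiableAt, hd.2 i,
    ← hint, pd_coord, if_pos rfl, one_mul]
  simp only [axisMean, if_true, one_mul]
  rw [← intervalIntegral.integral_const_mul]
  congr 1
  exact intervalIntegral.integral_congr fun u _ => by ring

end

section

variable {n : ℕ} {F H : Coord n → ℝ}

/-! ### Traces on the two halves of the cone -/

/-- The unit vector of the time axis. -/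
abbrev timeDir (n : ℕ) : Coord n := EuclideanSpace.single 0 1

/-- The projection onto the hyperplane `z^0 = 0` along the time axis. -/
def spat (n : ℕ) : Coord n →L[ℝ] Coord n :=
  ContinuousLinearMap.id ℝ _ - (EuclideanSpace.proj 0 : Coord n →L[ℝ] ℝ).smulRight (timeDir n)

lemma spat_apply (z : Coord n) : spat n z = z - z 0 • timeDir n := by
  simp [spat]

lemma spat_apply_zero (z : Coord n) : spat n z 0 = 0 := by
  simp [spat_apply]

lemma spat_apply_of_ne (z : Coord n) {i : Fin (n + 1)} (hi : i ≠ 0) : spat n z i = z i := by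
  simp [spat_apply, hi]

lemma spat_timeDir : spat n (timeDir n) = 0 := by
  simp [spat_apply]

lemma spat_single {i : Fin (n + 1)} (hi : i ≠ 0) :
    spat n (EuclideanSpace.single i 1) = EuclideanSpace.single i 1 := by
  simp [spat_apply, hi.symm]

lemma spat_spat (z : Coord n) : spat n (spat n z) = spat n z := by
  rw [spat_apply (spat n z), spat_apply_zero, zero_smul, sub_zero]

lemma spat_add_smul (z : Coord n) (s : ℝ) : spat n (spat n z + s • timeDir n) = spat n z := by
  rw [map_add, spat_spat, map_smul, spat_timeDir, smul_zero, add_zero]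

lemma spat_add_smul_self (z : Coord n) : spat n z + z 0 • timeDir n = z := by
  rw [spat_apply, sub_add_cancel]

lemma spat_scaleAxis {i : Fin (n + 1)} (hi : i ≠ 0) (u : ℝ) (z : Coord n) :
    spat n (scaleAxis i u z) = scaleAxis i u (spat n z) := by
  rw [scaleAxis, map_add, map_smul, spat_single hi, scaleAxis, spat_apply_of_ne z hi]

lemma norm_spat_add_smul_sq (z : Coord n) (s : ℝ) :
    ‖spat n z + s • timeDir n‖ ^ 2 = ‖spat n z‖ ^ 2 + s ^ 2 := by
  rw [norm_sq_eq_sum, norm_sq_eq_sum, Fin.sum_univ_succ, Fin.sum_univ_succ]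
  simp [spat_apply_zero, Fin.succ_ne_zero]
  ring

/-- The values of `f` at the points `z^0 = ε |z|` of the cone. -/
def coneTrace (ε : ℝ) (f : Coord n → ℝ) (z : Coord n) : ℝ :=
  f (spat n z + (ε * ‖spat n z‖) • timeDir n)

lemma coneTrace_spat (ε : ℝ) (f : Coord n → ℝ) (z : Coord n) :
    coneTrace ε f (spat n z) = coneTrace ε f z := by
  rw [coneTrace, coneTrace, spat_spat]

lemma coneTrace_eq {ε : ℝ} (f : Coord n → ℝ) {z : Coord n} (h : z 0 = ε * ‖spat n z‖) :
    coneTrace ε f z = f z := by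
  rw [coneTrace, ← h, spat_add_smul_self]

lemma rad_spat (i : Fin (n + 1)) (z : Coord n) :
    rad (spat n) i z = if i = 0 then 0 else z i := by
  unfold rad
  split_ifs with h
  · subst h; simp [spat_timeDir]
  · rw [spat_single h]
    simp [spat_apply_of_ne z h]

lemma hasFDerivAt_coneTrace {ε : ℝ} {z : Coord n} (hz : spat n z ≠ 0) (hF : Differentiable ℝ F) :
    DifferentiableAt ℝ (coneTrace ε F) z ∧ pd 0 (coneTrace ε F) z = 0 ∧
    ∀ i, i ≠ 0 → pd i (coneTrace ε F) z =
      coneTrace ε (pd i F) z + ε * (z i * ‖spat n z‖⁻¹) * coneTrace ε (pd 0 F) z := by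
  have hd := (differentiableAt_norm_clm hz).hasFDerivAt
  have h1 : HasFDerivAt (fun z => spat n z + (ε * ‖spat n z‖) • timeDir n)
      (spat n + (ε • fderiv ℝ (fun z => ‖spat n z‖) z).smulRight (timeDir n)) z :=
    (spat n).hasFDerivAt.add ((hd.const_mul ε).smul_const _)
  have h2 := (hF (spat n z + (ε * ‖spat n z‖) • timeDir n)).hasFDerivAt.comp z h1
  have h3 : ∀ i, pd i (coneTrace ε F) z =
      fderiv ℝ F (spat n z + (ε * ‖spat n z‖) • timeDir n) (spat n (EuclideanSpace.single i 1)) +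
        ε * (rad (spat n) i z / ‖spat n z‖) * coneTrace ε (pd 0 F) z := by
    intro i
    have e : fderiv ℝ (coneTrace ε F) z = _ := h2.fderiv
    rw [pd, e, ContinuousLinearMap.comp_apply, add_apply,
      ContinuousLinearMap.smulRight_apply, smul_apply, map_add, map_smul]
    have : fderiv ℝ (fun z => ‖spat n z‖) z (EuclideanSpace.single i 1) = _ := pd_norm_clm i hz
    rw [this]
    rfl
  refine ⟨h2.differentiableAt, ?_, fun i hi => ?_⟩
  · rw [h3, spat_timeDir, rad_spat]; simp
  · rw [h3, spat_single hi, rad_spat, if_neg hi, div_eq_mul_inv]; rfl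

lemma norm_conePoint_sq {ε : ℝ} (hε : ε ^ 2 = 1) (z : Coord n) :
    ‖spat n z + (ε * ‖spat n z‖) • timeDir n‖ ^ 2 = 2 * ‖spat n z‖ ^ 2 := by
  rw [norm_spat_add_smul_sq, mul_pow, hε]; ring

lemma norm_conePoint {ε : ℝ} (hε : ε ^ 2 = 1) (z : Coord n) :
    ‖spat n z + (ε * ‖spat n z‖) • timeDir n‖ = √2 * ‖spat n z‖ := by
  rw [← Real.sqrt_sq (norm_nonneg (spat n z + _)), norm_conePoint_sq hε,
    Real.sqrt_mul zero_le_two, Real.sqrt_sq (norm_nonneg _)]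

/-- On the cone `|w| = √2 |spat z|`, so `∂_i` of the trace of `F` is the trace of `∂_i F + ε √2 w^i
|w|^{-1} ∂_0 F`, which is again flat at the origin. The traces therefore form a class closed under
derivatives, although the cone is singular at its vertex. -/
lemma Flat.coneTrace {ε : ℝ} (hε : ε ^ 2 = 1)
    (hF : Flat (ContinuousLinearMap.id ℝ (Coord n)) F) : Flat (spat n) (coneTrace ε F) := by
  refine flat_of_class (𝒮 := {H | ∃ F : Coord n → ℝ, Flat (ContinuousLinearMap.id ℝ (Coord n)) F ∧
    H = LightCone.coneTrace ε F}) ?_ _ ⟨F, hF, rfl⟩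
  rintro _ ⟨F, hF, rfl⟩
  have hz0 : ∀ {F : Coord n → ℝ}, Flat (ContinuousLinearMap.id ℝ (Coord n)) F →
      ∀ z, spat n z = 0 → LightCone.coneTrace ε F z = 0 := by
    intro F hF z hz
    rw [LightCone.coneTrace, hz]
    exact hF.eq_zero (by simp)
  have hd0 : ∀ z, spat n z = 0 →
      HasFDerivAt (LightCone.coneTrace ε F) (0 : Coord n →L[ℝ] ℝ) z := by
    intro z hz
    obtain ⟨C, hC0, hC⟩ := hF.exists_bound (fun _ => rfl) 2 1
    refine hasFDerivAt_zero_of_bound hz (C := 2 * C) ?_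
    have hcont : Filter.Tendsto (fun y => ‖spat n y + (ε * ‖spat n y‖) • timeDir n‖) (𝓝 z)
        (𝓝 ‖spat n z + (ε * ‖spat n z‖) • timeDir n‖) :=
      (by fun_prop : Continuous fun y => ‖spat n y + (ε * ‖spat n y‖) • timeDir n‖).tendsto z
    rw [hz] at hcont
    simp only [norm_zero, mul_zero, zero_smul, add_zero] at hcont
    filter_upwards [hcont.eventually (ge_mem_nhds one_pos)] with y hy
    refine (hC _ hy).trans (le_of_eq ?_)
    rw [ContinuousLinearMap.id_apply, norm_conePoint_sq hε]; ring
  refine ⟨fun z => ?_, hz0 hF, fun i => ?_⟩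
  · by_cases hz : spat n z = 0
    · exact (hd0 z hz).differentiableAt
    · exact (hasFDerivAt_coneTrace hz hF.differentiable).1
  · by_cases hi : i = 0
    · subst hi
      refine ⟨_, flat_zero, funext fun z => ?_⟩
      by_cases hz : spat n z = 0
      · rw [LightCone.pd, (hd0 z hz).fderiv]; rfl
      · exact (hasFDerivAt_coneTrace hz hF.differentiable).2.1
    · refine ⟨fun w => LightCone.pd i F w + (ε * √2 * w i) * ((‖w‖ ^ 1)⁻¹ * LightCone.pd 0 F w),
        (hF.pd i).add (((hF.pd 0).inv_norm_pow_mul (fun _ => rfl) 1).smooth_mul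
          (contDiff_const.mul (contDiff_coord i))), funext fun z => ?_⟩
      by_cases hz : spat n z = 0
      · have h1 := hz0 (hF.pd i) z hz
        have h2 := hz0 (hF.pd 0) z hz
        rw [LightCone.pd, (hd0 z hz).fderiv]
        simp only [LightCone.coneTrace] at h1 h2 ⊢
        rw [h1, h2]; simp
      · rw [(hasFDerivAt_coneTrace hz hF.differentiable).2.2 i hi]
        have hpos : 0 < ‖spat n z‖ := norm_pos_iff.2 hz
        simp only [LightCone.coneTrace, pow_one, norm_conePoint hε]
        have hc : (spat n z + (ε * ‖spat n z‖) • timeDir n) i = z i := by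
          simp [spat_apply_of_ne z hi, hi]
        rw [hc]
        field_simp

lemma Flat.mono {L L' : Coord n →L[ℝ] Coord n} (h : ∀ z, L' z = 0 → L z = 0) (hF : Flat L F) :
    Flat L' F :=
  ⟨hF.1, fun l z hz => hF.2 l z (h z hz)⟩

lemma primitive_spat {i : Fin (n + 1)} (hi : i ≠ 0) (hF : ∀ z, F (spat n z) = F z) (z : Coord n) :
    primitive i F (spat n z) = primitive i F z := by
  simp only [primitive, axisMean, spat_apply_of_ne z hi, ← spat_scaleAxis hi, hF]

lemma Flat.primitive_spat {i : Fin (n + 1)} (hi : i ≠ 0) (hF : Flat (spat n) F) :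
    Flat (spat n) (LightCone.primitive i F) :=
  hF.primitive i fun u z hz => by
    rw [spat_scaleAxis hi, hz]; simp [scaleAxis]

lemma apply_add_smul_of_spat (hF : ∀ z, F (spat n z) = F z) (z : Coord n) (s : ℝ) :
    F (spat n z + s • timeDir n) = F z := by
  rw [← hF, spat_add_smul, hF]

/-! ### Hermite interpolation between the two halves of the cone -/

open Polynomial in
lemma pd_zero_of_eval (hF : Differentiable ℝ F) (p : ℝ[X]) (z : Coord n)
    (h : ∀ s, F (spat n z + s • timeDir n) = p.eval s) (s : ℝ) :
    pd 0 F (spat n z + s • timeDir n) = p.derivative.eval s := by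
  have h1 : HasDerivAt (fun s : ℝ => spat n z + s • timeDir n) (timeDir n) s := by
    simpa using ((hasDerivAt_id s).smul_const (timeDir n)).const_add (spat n z)
  have h2 : HasDerivAt (fun s => F (spat n z + s • timeDir n)) (pd 0 F _) s :=
    (hF _).hasFDerivAt.comp_hasDerivAt s h1
  simp only [h] at h2
  exact h2.unique (p.hasDerivAt s)

/-- The factor that equals `1` to second order for `z^0 = ε |z|`, and `0` for `z^0 = - ε |z|`, up to
the normalization by `16 |z|⁵`. -/
def hermiteWeight (ε t r : ℝ) : ℝ := (ε * t + r) ^ 3 * (3 * t ^ 2 - 9 * ε * t * r + 8 * r ^ 2)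

lemma Flat.linear_mul (ε c : ℝ) (hF : Flat (spat n) F) :
    Flat (spat n) fun z => (ε * z 0 + c * ‖spat n z‖) * F z := by
  have h1 := (hF.smooth_mul (contDiff_coord 0)).const_mul ε
  have h2 := (hF.norm_mul spat_spat).const_mul c
  have := h1.add h2
  refine (funext fun z => ?_ : _ = fun z => (ε * z 0 + c * ‖spat n z‖) * F z) ▸ this
  ring

lemma Flat.hermiteWeight_mul (ε : ℝ) (hF : Flat (spat n) F) :
    Flat (spat n) fun z => hermiteWeight ε (z 0) ‖spat n z‖ * F z := by
  have h1 := ((hF.linear_mul ε 1).linear_mul ε 1).linear_mul ε 1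
  have h2 := ((h1.linear_mul 1 0).linear_mul 3 (-9 * ε)).add ((h1.linear_mul 0 1).linear_mul 0 8)
  refine (funext fun z => ?_ : _ = fun z => hermiteWeight ε (z 0) ‖spat n z‖ * F z) ▸ h2
  simp only [hermiteWeight]
  ring

/-- One half of the Hermite interpolant. -/
def hermiteHalf (ε : ℝ) (α β γ : Coord n → ℝ) (z : Coord n) : ℝ :=
  hermiteWeight ε (z 0) ‖spat n z‖ * ((16 * ‖spat n z‖ ^ 5)⁻¹ *
    (α z + (z 0 - ε * ‖spat n z‖) * β z + (z 0 - ε * ‖spat n z‖) ^ 2 / 2 * γ z))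

lemma flat_hermiteHalf (ε : ℝ) {α β γ : Coord n → ℝ} (hα : Flat (spat n) α)
    (hβ : Flat (spat n) β) (hγ : Flat (spat n) γ) : Flat (spat n) (hermiteHalf ε α β γ) := by
  have h := (((hα.add (hβ.linear_mul 1 (-ε))).add
    (((hγ.linear_mul 1 (-ε)).linear_mul 1 (-ε)).const_mul (1 / 2))).inv_norm_pow_mul
      spat_spat 5).const_mul (1 / 16) |>.hermiteWeight_mul ε
  refine (funext fun z => ?_ : _ = hermiteHalf ε α β γ) ▸ h
  simp only [hermiteHalf, mul_inv]
  ring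

end

/-! ### Interpolation between the half-cones and flat tensors with prescribed divergence. -/

section

variable {n : ℕ} {F H : Coord n → ℝ}

section
open Polynomial

/-- `hermiteHalf` along a line parallel to the time axis. -/
def hermitePoly (ε r a b c : ℝ) : ℝ[X] :=
  C ((16 * r ^ 5)⁻¹) * ((C ε * X + C r) ^ 3 * (3 * X ^ 2 - C (9 * ε * r) * X + C (8 * r ^ 2)) *
    (C a + (X - C (ε * r)) * C b + (X - C (ε * r)) ^ 2 * C (c / 2)))

/-- With `τ = ε t / r` the weight is `(τ + 1)³ (3τ² - 9τ + 8) / 16`, which is `1 + O((τ - 1)³)` at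
`τ = 1` and has a triple zero at `τ = -1`. -/
lemma eval_hermitePoly_self {ε r : ℝ} (hε : ε = 1 ∨ ε = -1) (hr : r ≠ 0) (a b c : ℝ) :
    (hermitePoly ε r a b c).eval (ε * r) = a ∧
    (hermitePoly ε r a b c).derivative.eval (ε * r) = b ∧
    (hermitePoly ε r a b c).derivative.derivative.eval (ε * r) = c := by
  rcases hε with rfl | rfl <;>
  · refine ⟨?_, ?_, ?_⟩ <;>
    · simp [hermitePoly, derivative_pow]
      field_simp
      ring

lemma eval_hermitePoly_neg {ε : ℝ} (hε : ε = 1 ∨ ε = -1) (r a b c : ℝ) :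
    (hermitePoly ε r a b c).eval (-ε * r) = 0 ∧
    (hermitePoly ε r a b c).derivative.eval (-ε * r) = 0 ∧
    (hermitePoly ε r a b c).derivative.derivative.eval (-ε * r) = 0 := by
  rcases hε with rfl | rfl <;>
  · refine ⟨?_, ?_, ?_⟩ <;>
    · simp [hermitePoly, derivative_pow]

end

lemma hermiteHalf_line {ε : ℝ} {α β γ : Coord n → ℝ} (hα : ∀ z, α (spat n z) = α z)
    (hβ : ∀ z, β (spat n z) = β z) (hγ : ∀ z, γ (spat n z) = γ z) (z : Coord n) (s : ℝ) :
    hermiteHalf ε α β γ (spat n z + s • timeDir n) =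
      (hermitePoly ε ‖spat n z‖ (α z) (β z) (γ z)).eval s := by
  simp only [hermiteHalf, hermitePoly, spat_add_smul, apply_add_smul_of_spat hα,
    apply_add_smul_of_spat hβ, apply_add_smul_of_spat hγ, hermiteWeight]
  have : (spat n z + s • timeDir n) 0 = s := by simp [spat_apply_zero]
  rw [this]
  simp
  ring

lemma coneTrace_eq_zero (hF : Flat (spat n) F) (ε : ℝ) {z : Coord n} (hz : spat n z = 0) :
    coneTrace ε F z = 0 :=
  hF.eq_zero (by rw [spat_add_smul, hz])

/-- Functions with prescribed traces of order up to two on the cone. -/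
lemma exists_hermite {α β γ : ℝ → Coord n → ℝ}
    (hα : ∀ ε, ε = 1 ∨ ε = -1 → Flat (spat n) (α ε) ∧ ∀ z, α ε (spat n z) = α ε z)
    (hβ : ∀ ε, ε = 1 ∨ ε = -1 → Flat (spat n) (β ε) ∧ ∀ z, β ε (spat n z) = β ε z)
    (hγ : ∀ ε, ε = 1 ∨ ε = -1 → Flat (spat n) (γ ε) ∧ ∀ z, γ ε (spat n z) = γ ε z) :
    ∃ A : Coord n → ℝ, Flat (spat n) A ∧ ∀ ε, ε = 1 ∨ ε = -1 → coneTrace ε A = α ε ∧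
      coneTrace ε (pd 0 A) = β ε ∧ coneTrace ε (pd 0 (pd 0 A)) = γ ε := by
  have h1 : (1 : ℝ) = 1 ∨ (1 : ℝ) = -1 := Or.inl rfl
  have h2 : (-1 : ℝ) = 1 ∨ (-1 : ℝ) = -1 := Or.inr rfl
  set A : Coord n → ℝ := fun z =>
    hermiteHalf 1 (α 1) (β 1) (γ 1) z + hermiteHalf (-1) (α (-1)) (β (-1)) (γ (-1)) z with hA
  have hflat : Flat (spat n) A :=
    (flat_hermiteHalf 1 (hα _ h1).1 (hβ _ h1).1 (hγ _ h1).1).add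
      (flat_hermiteHalf (-1) (hα _ h2).1 (hβ _ h2).1 (hγ _ h2).1)
  -- On each line parallel to the time axis and off that axis, `A` is a polynomial in time, so its
  -- time derivatives on the cone are derivatives of an explicit polynomial. On the axis itself
  -- everything vanishes by flatness.
  have hline : ∀ z s, A (spat n z + s • timeDir n) =
      (hermitePoly 1 ‖spat n z‖ (α 1 z) (β 1 z) (γ 1 z) +
        hermitePoly (-1) ‖spat n z‖ (α (-1) z) (β (-1) z) (γ (-1) z)).eval s := by
    intro z s
    rw [Polynomial.eval_add, hA]
    exact congrArg₂ (· + ·) (hermiteHalf_line (hα _ h1).2 (hβ _ h1).2 (hγ _ h1).2 z s)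
      (hermiteHalf_line (hα _ h2).2 (hβ _ h2).2 (hγ _ h2).2 z s)
  have hline1 := fun z => pd_zero_of_eval hflat.differentiable _ z (hline z)
  have hline2 := fun z => pd_zero_of_eval (hflat.pd 0).differentiable _ z (hline1 z)
  have key : ∀ ε, ε = 1 ∨ ε = -1 → ∀ z, coneTrace ε A z = α ε z ∧
      coneTrace ε (pd 0 A) z = β ε z ∧ coneTrace ε (pd 0 (pd 0 A)) z = γ ε z := by
    intro ε hε z
    by_cases hz : spat n z = 0
    · rw [coneTrace_eq_zero hflat ε hz, coneTrace_eq_zero (hflat.pd 0) ε hz,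
        coneTrace_eq_zero ((hflat.pd 0).pd 0) ε hz, (hα ε hε).1.eq_zero hz, (hβ ε hε).1.eq_zero hz,
        (hγ ε hε).1.eq_zero hz]
      exact ⟨rfl, rfl, rfl⟩
    · have hr : ‖spat n z‖ ≠ 0 := norm_ne_zero_iff.2 hz
      have hp := eval_hermitePoly_self h1 hr (α 1 z) (β 1 z) (γ 1 z)
      have hm := eval_hermitePoly_self h2 hr (α (-1) z) (β (-1) z) (γ (-1) z)
      have hp' := eval_hermitePoly_neg h1 ‖spat n z‖ (α 1 z) (β 1 z) (γ 1 z)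
      have hm' := eval_hermitePoly_neg h2 ‖spat n z‖ (α (-1) z) (β (-1) z) (γ (-1) z)
      rw [neg_neg] at hm'
      simp only [coneTrace, hline, hline1, hline2, Polynomial.derivative_add, Polynomial.eval_add]
      rcases hε with rfl | rfl
      · simp only [hp, hm', add_zero, and_self]
      · simp only [hp', hm, zero_add, and_self]
  exact ⟨A, hflat, fun ε hε => ⟨funext fun z => (key ε hε z).1, funext fun z => (key ε hε z).2.1,
    funext fun z => (key ε hε z).2.2⟩⟩

lemma bilin_eta_self (z : Coord n) : bilin (eta n) z z = ‖spat n z‖ ^ 2 - z 0 ^ 2 := by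
  rw [norm_sq_eq_sum, Fin.sum_univ_succ]
  simp only [bilin, eta, Matrix.diagonal_apply, ite_mul, zero_mul, Finset.sum_ite_eq,
    Finset.mem_univ, if_true]
  rw [Fin.sum_univ_succ]
  simp [spat_apply_zero, Fin.succ_ne_zero, spat_apply_of_ne]
  ring

lemma exists_sign_of_mem_cone {z : Coord n} (hz : z ∈ cone n) :
    ∃ ε : ℝ, (ε = 1 ∨ ε = -1) ∧ z 0 = ε * ‖spat n z‖ := by
  have h : z 0 ^ 2 = ‖spat n z‖ ^ 2 := by
    have : bilin (eta n) z z = 0 := hz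
    rw [bilin_eta_self] at this
    linarith
  rcases sq_eq_sq_iff_eq_or_eq_neg.1 h with h | h
  · exact ⟨1, Or.inl rfl, by rw [h, one_mul]⟩
  · exact ⟨-1, Or.inr rfl, by rw [h]; ring⟩

/-- Functions with prescribed Hessian in the plane of the axes `0` and `i` along the cone. -/
lemma exists_hessian_on_cone {i : Fin (n + 1)} (hi : i ≠ 0) {k m : Coord n → ℝ}
    (hk : Flat (ContinuousLinearMap.id ℝ (Coord n)) k)
    (hm : Flat (ContinuousLinearMap.id ℝ (Coord n)) m) :
    ∃ A : Coord n → ℝ, Flat (spat n) A ∧ ∀ z ∈ cone n,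
      pd 0 (pd 0 A) z = k z ∧ pd 0 (pd i A) z = 0 ∧ pd i (pd i A) z = m z := by
  have hsq : ∀ ε : ℝ, ε = 1 ∨ ε = -1 → ε ^ 2 = 1 := by rintro ε (rfl | rfl) <;> norm_num
  -- multiplication by the slope of the cone, followed by integration
  set S : ℝ → (Coord n → ℝ) → Coord n → ℝ := fun ε F z => (ε * z i) * ((‖spat n z‖ ^ 1)⁻¹ * F z)
    with hS
  have hSflat : ∀ ε F, (Flat (spat n) F ∧ ∀ z, F (spat n z) = F z) →
      Flat (spat n) (S ε F) ∧ ∀ z, S ε F (spat n z) = S ε F z := by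
    rintro ε F ⟨h1, h2⟩
    refine ⟨(h1.inv_norm_pow_mul spat_spat 1).smooth_mul (contDiff_const.mul (contDiff_coord i)),
      fun z => ?_⟩
    simp only [hS, spat_apply_of_ne z hi, spat_spat, h2]
  have hJflat : ∀ F, (Flat (spat n) F ∧ ∀ z, F (spat n z) = F z) →
      Flat (spat n) (primitive i F) ∧ ∀ z, primitive i F (spat n z) = primitive i F z :=
    fun F h => ⟨h.1.primitive_spat hi, primitive_spat hi h.2⟩
  set γ : ℝ → Coord n → ℝ := fun ε => coneTrace ε k
  set μ : ℝ → Coord n → ℝ := fun ε => coneTrace ε m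
  have hγ : ∀ ε, ε = 1 ∨ ε = -1 → Flat (spat n) (γ ε) ∧ ∀ z, γ ε (spat n z) = γ ε z :=
    fun ε hε => ⟨hk.coneTrace (hsq ε hε), coneTrace_spat ε k⟩
  have hμ : ∀ ε, ε = 1 ∨ ε = -1 → Flat (spat n) (μ ε) ∧ ∀ z, μ ε (spat n z) = μ ε z :=
    fun ε hε => ⟨hm.coneTrace (hsq ε hε), coneTrace_spat ε m⟩
  -- Along the cone, `∂_i` of the trace of `F` is the trace of `∂_i F` plus the slope `ε z^i / |z|`
  -- times the trace of `∂_0 F`. A vanishing mixed derivative therefore requires `∂_i β = slope ·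
  -- γ`. Likewise the trace `α'` below is chosen so that the trace of `∂_i A` is a primitive of `μ`.
  -- Only the direction `i` is involved, so there is no integrability condition.
  set β : ℝ → Coord n → ℝ := fun ε => primitive i (S ε (γ ε))
  have hSγ := fun ε hε => hSflat ε _ (hγ ε hε)
  have hβ := fun ε hε => hJflat _ (hSγ ε hε)
  have hJμ := fun ε hε => hJflat _ (hμ ε hε)
  have hSβ := fun ε hε => hSflat ε _ (hβ ε hε)
  set α' : ℝ → Coord n → ℝ := fun ε z => S ε (β ε) z + primitive i (μ ε) z
  have hα' : ∀ ε, ε = 1 ∨ ε = -1 → Flat (spat n) (α' ε) ∧ ∀ z, α' ε (spat n z) = α' ε z :=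
    fun ε hε => ⟨(hSβ ε hε).1.add (hJμ ε hε).1, fun z =>
      congrArg₂ (· + ·) ((hSβ ε hε).2 z) ((hJμ ε hε).2 z)⟩
  have hα := fun ε hε => hJflat _ (hα' ε hε)
  obtain ⟨A, hA, hval⟩ := exists_hermite (α := fun ε => primitive i (α' ε)) hα hβ hγ
  have hchain : ∀ ε, ε = 1 ∨ ε = -1 → ∀ {F : Coord n → ℝ}, Flat (spat n) F → ∀ z, spat n z ≠ 0 →
      pd i (coneTrace ε F) z = coneTrace ε (pd i F) z + S ε (coneTrace ε (pd 0 F)) z := by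
    intro ε _ F hF z hz
    rw [(hasFDerivAt_coneTrace hz hF.differentiable).2.2 i hi, hS]
    ring
  have hmixed : ∀ ε, ε = 1 ∨ ε = -1 → ∀ z, coneTrace ε (pd i (pd 0 A)) z = 0 := by
    intro ε hε z
    by_cases hz : spat n z = 0
    · exact coneTrace_eq_zero ((hA.pd 0).pd i) ε hz
    · have h1 := hchain ε hε (hA.pd 0) z hz
      rw [(hval ε hε).2.1, (hval ε hε).2.2, pd_primitive i (hSγ ε hε).1.1] at h1
      linarith
  have hcomm : pd 0 (pd i A) = pd i (pd 0 A) := funext fun z =>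
    pd_pd_comm 0 i (hA.1.contDiffAt.of_le (by norm_cast))
  have hfirst : ∀ ε, ε = 1 ∨ ε = -1 → coneTrace ε (pd i A) = primitive i (μ ε) := by
    intro ε hε
    funext z
    by_cases hz : spat n z = 0
    · rw [coneTrace_eq_zero (hA.pd i) ε hz, (hJμ ε hε).1.eq_zero hz]
    · have h1 := hchain ε hε hA z hz
      rw [(hval ε hε).1, (hval ε hε).2.1, pd_primitive i (hα' ε hε).1.1] at h1
      simp only [α'] at h1
      linarith
  have hsecond : ∀ ε, ε = 1 ∨ ε = -1 → ∀ z, coneTrace ε (pd i (pd i A)) z = μ ε z := by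
    intro ε hε z
    by_cases hz : spat n z = 0
    · rw [coneTrace_eq_zero ((hA.pd i).pd i) ε hz, (hμ ε hε).1.eq_zero hz]
    · have h1 := hchain ε hε (hA.pd i) z hz
      have h0 : coneTrace ε (pd 0 (pd i A)) = fun _ => 0 := by
        rw [hcomm]; exact funext (hmixed ε hε)
      rw [hfirst ε hε, pd_primitive i (hμ ε hε).1.1, h0] at h1
      simp only [hS, mul_zero, add_zero] at h1
      exact h1.symm
  refine ⟨A, hA, fun z hz => ?_⟩
  obtain ⟨ε, hε, hzε⟩ : ∃ ε : ℝ, (ε = 1 ∨ ε = -1) ∧ z 0 = ε * ‖spat n z‖ :=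
    exists_sign_of_mem_cone hz
  refine ⟨?_, ?_, ?_⟩
  · rw [← coneTrace_eq (pd 0 (pd 0 A)) hzε, (hval ε hε).2.2]
    exact coneTrace_eq k hzε
  · rw [hcomm, ← coneTrace_eq (pd i (pd 0 A)) hzε, hmixed ε hε]
  · rw [← coneTrace_eq (pd i (pd i A)) hzε, hsecond ε hε]
    exact coneTrace_eq m hzε

/-- Every flat vector field is the divergence of a flat symmetric tensor that vanishes on the
cone. -/
lemma exists_divergence_eq (hn : 1 ≤ n) {f : Fin (n + 1) → Coord n → ℝ}
    (hf : ∀ ν, Flat (ContinuousLinearMap.id ℝ (Coord n)) (f ν)) :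
    ∃ K : Fin (n + 1) → Fin (n + 1) → Coord n → ℝ,
      (∀ μ ν, Flat (ContinuousLinearMap.id ℝ (Coord n)) (K μ ν)) ∧ (∀ μ ν, K μ ν = K ν μ) ∧
      (∀ μ ν, ∀ z ∈ cone n, K μ ν z = 0) ∧ ∀ ν z, ∑ μ, pd μ (K μ ν) z = f ν z := by
  have hL : ∀ (i : Fin (n + 1)) (u : ℝ) (z : Coord n), ContinuousLinearMap.id ℝ (Coord n) z = 0 →
      ContinuousLinearMap.id ℝ (Coord n) (scaleAxis i u z) = 0 := by
    intro i u z hz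
    have : z = 0 := hz
    simp [this, scaleAxis]
  have hJ := fun ν => (hf ν).primitive ν (hL ν)
  -- The target `J_0` for `Σ_i ∂_i² A_i` is shared equally among the `n` spatial axes.
  choose A hA hval using fun i : Fin n => exists_hessian_on_cone (Fin.succ_ne_zero i)
    (hJ i.succ) ((hJ 0).const_mul (1 / n))
  have hA1 : ∀ i, Flat (ContinuousLinearMap.id ℝ (Coord n)) (A i) := fun i =>
    (hA i).mono fun z hz => by
      have : z = 0 := hz
      rw [this, map_zero]
  have hn0 : (n : ℝ) ≠ 0 := by positivity
  -- The diagonal of primitives has divergence `f`. Each `A_i` adds `-∂_i² A_i`, `∂_0 ∂_i A_i`,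
  -- `-∂_0² A_i` in the entries `00`, `0i`, `ii`, which is identically divergence free. The
  -- prescribed Hessians make these entries cancel the diagonal on the cone.
  set K : Fin (n + 1) → Fin (n + 1) → Coord n → ℝ :=
    Fin.cons (Fin.cons (fun z => primitive 0 (f 0) z - ∑ i : Fin n, pd i.succ (pd i.succ (A i)) z)
        (fun j : Fin n => pd 0 (pd j.succ (A j))))
      (fun i : Fin n => Fin.cons (pd 0 (pd i.succ (A i))) (fun j : Fin n => if i = j then
        fun z => primitive i.succ (f i.succ) z - pd 0 (pd 0 (A i)) z else fun _ => 0)) with hK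
  have hF00 : Flat (ContinuousLinearMap.id ℝ (Coord n)) fun z =>
      ∑ i : Fin n, pd i.succ (pd i.succ (A i)) z :=
    Flat.sum _ fun i _ => ((hA1 i).pd i.succ).pd i.succ
  refine ⟨K, fun μ ν => ?_, fun μ ν => ?_, fun μ ν z hz => ?_, fun ν z => ?_⟩
  · refine Fin.cases ?_ (fun i => ?_) μ <;> refine Fin.cases ?_ (fun j => ?_) ν <;>
      simp only [hK, Fin.cons_zero, Fin.cons_succ]
    · exact (hJ 0).sub hF00
    · exact ((hA1 j).pd _).pd 0
    · exact ((hA1 i).pd _).pd 0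
    · split_ifs
      · exact (hJ i.succ).sub (((hA1 i).pd 0).pd 0)
      · exact flat_zero
  · refine Fin.cases ?_ (fun i => ?_) μ <;> refine Fin.cases ?_ (fun j => ?_) ν <;>
      simp only [hK, Fin.cons_zero, Fin.cons_succ]
    by_cases h : i = j
    · subst h; rfl
    · rw [if_neg h, if_neg (Ne.symm h)]
  · refine Fin.cases ?_ (fun i => ?_) μ <;> refine Fin.cases ?_ (fun j => ?_) ν <;>
      simp only [hK, Fin.cons_zero, Fin.cons_succ]
    · rw [Finset.sum_congr rfl fun i _ => (hval i z hz).2.2]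
      simp
      field_simp
      ring
    · exact (hval j z hz).2.1
    · exact (hval i z hz).2.1
    · split_ifs
      · exact sub_eq_zero.2 (hval i z hz).1.symm
      · rfl
  · have hd : ∀ {F : Coord n → ℝ}, Flat (ContinuousLinearMap.id ℝ (Coord n)) F →
        DifferentiableAt ℝ F z := fun h => h.differentiable z
    have hcomm : ∀ {F : Coord n → ℝ}, Flat (ContinuousLinearMap.id ℝ (Coord n)) F →
        ∀ i j, pd i (pd j F) = pd j (pd i F) := fun h i j =>
      funext fun z => pd_pd_comm i j (h.1.contDiffAt.of_le (by norm_cast))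
    rw [Fin.sum_univ_succ]
    refine Fin.cases ?_ (fun j => ?_) ν <;> simp only [hK, Fin.cons_zero, Fin.cons_succ]
    · rw [pd_sub 0 (hd (hJ 0)) (hd hF00), pd_primitive 0 (hf 0).1,
        pd_sum _ _ fun i _ => hd (((hA1 i).pd i.succ).pd i.succ)]
      have : ∀ i : Fin n, pd 0 (pd i.succ (pd i.succ (A i))) z =
          pd i.succ (pd 0 (pd i.succ (A i))) z := fun i => by rw [hcomm ((hA1 i).pd i.succ)]
      rw [Finset.sum_congr rfl fun i _ => this i]
      ring
    · rw [Finset.sum_eq_single j, if_pos rfl,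
        pd_sub _ (hd (hJ j.succ)) (hd (((hA1 j).pd 0).pd 0)), pd_primitive _ (hf j.succ).1,
        hcomm (hA1 j) 0 j.succ, hcomm ((hA1 j).pd 0) 0 j.succ]
      · ring
      · intro i _ hij
        rw [if_neg hij]; exact pd_const _ 0 z
      · simp

end

section

variable {n : ℕ}

/-! ### Recovering a metric from its densitized inverse -/

/-- The matrix `G` with `√|det G| G⁻¹ = M`. -/
def metricOfDens (M : Matrix (Fin (n + 1)) (Fin (n + 1)) ℝ) : Matrix (Fin (n + 1)) (Fin (n + 1)) ℝ :=
  |M.det| ^ (((n - 1 : ℕ) : ℝ)⁻¹) • M⁻¹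

lemma abs_det_smul_inv {M : Matrix (Fin (n + 1)) (Fin (n + 1)) ℝ} {a : ℝ} (ha : 0 < a) :
    |(a • M⁻¹).det| = a ^ (n + 1) * |M.det|⁻¹ := by
  rw [Matrix.det_smul, Matrix.det_nonsing_inv, Ring.inverse_eq_inv', abs_mul, abs_inv, abs_pow,
    abs_of_pos ha, Fintype.card_fin]

lemma smul_inv_inv {M : Matrix (Fin (n + 1)) (Fin (n + 1)) ℝ} (hM : M.det ≠ 0) {a : ℝ}
    (ha : 0 < a) : (a • M⁻¹)⁻¹ = a⁻¹ • M := by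
  refine Matrix.inv_eq_right_inv ?_
  rw [Matrix.smul_mul, Matrix.mul_smul, smul_smul, mul_inv_cancel₀ ha.ne', one_smul,
    Matrix.nonsing_inv_mul _ (isUnit_iff_ne_zero.2 hM)]

/-- If `M = √|det G| G⁻¹` in dimension `n + 1`, then `|det M| = |det G|^{(n-1)/2}`. Hence `√|det G|
= |det M|^{1/(n-1)}`, which explains the exponent and the need for `n ≥ 2`. -/
lemma dens_metricOfDens (hn : 2 ≤ n) {M : Matrix (Fin (n + 1)) (Fin (n + 1)) ℝ} (hM : M.det ≠ 0) :
    √|(metricOfDens M).det| • (metricOfDens M)⁻¹ = M := by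
  obtain ⟨m, rfl⟩ : ∃ m, n = m + 2 := ⟨n - 2, by omega⟩
  have hpos : 0 < |M.det| := abs_pos.2 hM
  set a : ℝ := |M.det| ^ (((m + 2 - 1 : ℕ) : ℝ)⁻¹) with ha
  have ha0 : 0 < a := Real.rpow_pos_of_pos hpos _
  have ha1 : a ^ (m + 1) = |M.det| := Real.rpow_inv_natCast_pow hpos.le (by omega)
  have e : metricOfDens M = a • M⁻¹ := rfl
  rw [e, abs_det_smul_inv ha0, smul_inv_inv hM ha0, ← ha1,
    show a ^ (m + 2 + 1) * (a ^ (m + 1))⁻¹ = a ^ 2 by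
      rw [show m + 2 + 1 = 2 + (m + 1) by ring, pow_add]; field_simp, Real.sqrt_sq ha0.le, smul_smul,
    mul_inv_cancel₀ ha0.ne', one_smul]

lemma metricOfDens_dens (hn : 2 ≤ n) {G : Matrix (Fin (n + 1)) (Fin (n + 1)) ℝ} (hG : G.det ≠ 0) :
    metricOfDens (√|G.det| • G⁻¹) = G := by
  obtain ⟨m, rfl⟩ : ∃ m, n = m + 2 := ⟨n - 2, by omega⟩
  have hpos : 0 < |G.det| := abs_pos.2 hG
  set s : ℝ := √|G.det| with hs
  have hs0 : 0 < s := Real.sqrt_pos.2 hpos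
  have hs1 : s ^ 2 = |G.det| := Real.sq_sqrt hpos.le
  have h1 : s ^ (m + 2 + 1) * |G.det|⁻¹ = s ^ (m + 2 - 1) := by
    rw [← hs1, show m + 2 - 1 = m + 1 by omega, show m + 2 + 1 = m + 1 + 2 by ring, pow_add]
    field_simp
  rw [metricOfDens, abs_det_smul_inv hs0, h1, Real.pow_rpow_inv_natCast hs0.le (by omega),
    smul_inv_inv hG hs0, smul_smul, mul_inv_cancel₀ hs0.ne', one_smul]

lemma contDiffAt_metricOfDens {M : Mat n} (hM : Matrix.det (Matrix.of M) ≠ 0)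
    (i j : Fin (n + 1)) :
    ContDiffAt ℝ ∞ (fun M : Mat n => metricOfDens (Matrix.of M) i j) M := by
  have h1 : ContDiffAt ℝ ∞ (fun M : Mat n => |Matrix.det (Matrix.of M)|) M :=
    (contDiffAt_abs hM).comp M contDiff_matrix_det.contDiffAt
  exact (h1.rpow_const_of_ne (abs_ne_zero.2 hM)).mul (contDiffAt_matrix_inv hM i j)

/-! ### Symmetric matrices near the Minkowski matrix are Lorentzian -/

lemma hasStrictFDerivAt_entry (i j : Fin (n + 1)) (M : Mat n) :
    HasStrictFDerivAt (fun M : Mat n => M i j)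
      ((ContinuousLinearMap.proj j : (Fin (n + 1) → ℝ) →L[ℝ] ℝ).comp
        (ContinuousLinearMap.proj i : Mat n →L[ℝ] (Fin (n + 1) → ℝ))) M :=
  ((ContinuousLinearMap.proj j : (Fin (n + 1) → ℝ) →L[ℝ] ℝ).comp
    (ContinuousLinearMap.proj i : Mat n →L[ℝ] (Fin (n + 1) → ℝ))).hasStrictFDerivAt

/-- The map `S ↦ S + ¼ S η S`. -/
def quadEta (S : Mat n) : Mat n := fun i j => S i j + ∑ a, (1 / 4 * sgn a) * (S i a * S a j)

lemma quadEta_zero : quadEta (0 : Mat n) = 0 := by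
  funext i j; simp [quadEta]

lemma quadEta_transpose (S : Mat n) :
    quadEta (fun i j => S j i) = fun i j => quadEta S j i := by
  funext i j
  simp only [quadEta]
  congr 1
  exact Finset.sum_congr rfl fun a _ => by ring

lemma hasStrictFDerivAt_quadEta :
    HasStrictFDerivAt (quadEta (n := n)) ((ContinuousLinearEquiv.refl ℝ (Mat n) :
      Mat n ≃L[ℝ] Mat n) : Mat n →L[ℝ] Mat n) 0 := by
  refine hasStrictFDerivAt_pi'.2 fun i => hasStrictFDerivAt_pi'.2 fun j => ?_
  have h := (hasStrictFDerivAt_entry i j (0 : Mat n)).add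
    (HasStrictFDerivAt.fun_sum (u := Finset.univ) fun a _ =>
      (((hasStrictFDerivAt_entry i a (0 : Mat n)).mul
        (hasStrictFDerivAt_entry a j (0 : Mat n))).const_mul (1 / 4 * sgn a)))
  simp only [Pi.zero_apply, zero_smul, add_zero, smul_zero, Finset.sum_const_zero] at h
  exact h

/-- Completing the square: this reduces the search for a frame to solving `quadEta S = M - η` for a
symmetric `S`. -/
lemma congr_eta_eq (S : Mat n) (hS : ∀ i j, S i j = S j i) :
    (1 + (1 / 2 : ℝ) • (eta n * Matrix.of S)).transpose * eta n *
      (1 + (1 / 2 : ℝ) • (eta n * Matrix.of S)) = eta n + Matrix.of (quadEta S) := by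
  have hT : (Matrix.of S).transpose = Matrix.of S := by ext i j; exact hS j i
  have hq : Matrix.of (quadEta S) =
      Matrix.of S + (1 / 4 : ℝ) • (Matrix.of S * eta n * Matrix.of S) := by
    ext i j
    simp only [Matrix.of_apply, quadEta, Matrix.add_apply, Matrix.smul_apply, smul_eq_mul]
    congr 1
    rw [Matrix.mul_apply, Finset.mul_sum]
    refine Finset.sum_congr rfl fun a _ => ?_
    rw [eta, Matrix.mul_diagonal, sgn]
    simp only [Matrix.of_apply]
    ring
  have he : eta n * (eta n * Matrix.of S) = Matrix.of S := by
    rw [← Matrix.mul_assoc, eta_mul_self, Matrix.one_mul]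
  rw [hq, Matrix.transpose_add, Matrix.transpose_one, Matrix.transpose_smul,
    Matrix.transpose_mul, hT, eta_transpose]
  simp only [Matrix.add_mul, Matrix.mul_add, Matrix.one_mul, Matrix.mul_one, Matrix.smul_mul,
    Matrix.mul_smul, he, Matrix.mul_assoc, eta_mul_self, smul_add, smul_smul]
  module

/-- `quadEta` has derivative the identity at `0`, so the inverse function theorem solves `quadEta S
= M - η` for `M` near `η`. The inverse of `1 + ½ η S` is then a Lorentz-orthonormal frame. -/
lemma eventually_isLorentzMatrix : ∀ᶠ M : Mat n in 𝓝 (ent (eta n)),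
    (Matrix.of M).IsSymm → IsLorentzMatrix (Matrix.of M) := by
  have hq := hasStrictFDerivAt_quadEta (n := n)
  set R := hq.localInverse with hR
  have hleft : ∀ᶠ S in 𝓝 (0 : Mat n), R (quadEta S) = S := hq.eventually_left_inverse
  have hright : ∀ᶠ S in 𝓝 (0 : Mat n), quadEta (R S) = S := by
    have := hq.eventually_right_inverse
    rwa [quadEta_zero] at this
  have hR0 : Filter.Tendsto R (𝓝 0) (𝓝 0) := by
    have := hq.localInverse_tendsto
    rwa [quadEta_zero] at this
  have htr : Filter.Tendsto (fun S : Mat n => fun i j => S j i) (𝓝 0) (𝓝 0) :=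
    (by fun_prop : Continuous fun S : Mat n => fun i j => S j i).tendsto 0
  have hsub : Filter.Tendsto (fun M : Mat n => M - ent (eta n)) (𝓝 (ent (eta n))) (𝓝 0) := by
    have := (continuous_sub_right (ent (eta n))).tendsto (ent (eta n))
    rwa [sub_self] at this
  have hdet : ∀ᶠ M : Mat n in 𝓝 (ent (eta n)), Matrix.det (Matrix.of M) ≠ 0 :=
    (contDiff_matrix_det.continuous.continuousAt).eventually_ne eta_det_ne_zero
  filter_upwards [hsub.eventually hright, hsub.eventually ((htr.comp hR0).eventually hleft), hdet]
    with M h1 h2 h3 hM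
  set S := R (M - ent (eta n)) with hS
  -- The transpose of `S` solves the same equation since `M - η` is symmetric, and the local
  -- solution is unique.
  have hsymm : ∀ i j, S i j = S j i := by
    have h4 : quadEta (fun i j => S j i) = M - ent (eta n) := by
      rw [quadEta_transpose, h1]
      funext i j
      have e1 : M j i = M i j := hM.apply i j
      have e2 : eta n j i = eta n i j := congrFun (congrFun eta_transpose i) j
      simp only [Pi.sub_apply, ent, e1, e2]
    have h5 : S = fun i j => S j i := by
      have : R (quadEta fun i j => S j i) = fun i j => S j i := h2
      rwa [h4] at this
    exact fun i j => congrFun (congrFun h5 i) j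
  set B := 1 + (1 / 2 : ℝ) • (eta n * Matrix.of S) with hB
  have hBM : B.transpose * eta n * B = Matrix.of M := by
    rw [congr_eta_eq S hsymm, h1]
    ext i j
    simp [ent]
  have hBdet : IsUnit B.det := by
    rw [isUnit_iff_ne_zero]
    intro h0
    rw [← hBM, Matrix.det_mul, h0, mul_zero] at h3
    exact h3 rfl
  refine ⟨hM, B⁻¹, (Matrix.isUnit_nonsing_inv_det_iff).2 hBdet, ?_⟩
  rw [← hBM, Matrix.transpose_nonsing_inv]
  have hBT : IsUnit B.transpose.det := by rwa [Matrix.det_transpose]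
  rw [← Matrix.mul_assoc, ← Matrix.mul_assoc, Matrix.nonsing_inv_mul _ hBT, Matrix.one_mul,
    Matrix.mul_assoc, Matrix.mul_nonsing_inv _ hBdet, Matrix.mul_one]

/-! ### Flatness and vanishing order at the origin -/

lemma Flat.ord {F : Coord n → ℝ} (hF : Flat (ContinuousLinearMap.id ℝ (Coord n)) F) (N : ℕ) :
    Ord N F := by
  refine ⟨hF.1.contDiffAt, ?_⟩
  obtain ⟨C, _, hC⟩ := hF.exists_bound (fun _ => rfl) N 1
  refine Asymptotics.IsBigO.of_bound C ?_
  filter_upwards [Metric.closedBall_mem_nhds (0 : Coord n) one_pos] with x hx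
  simpa using hC x (by simpa using hx)

lemma flat_of_ord {F : Coord n → ℝ} (hF : ContDiff ℝ ∞ F) (h : ∀ N, Ord N F) :
    Flat (ContinuousLinearMap.id ℝ (Coord n)) F := by
  refine ⟨hF, fun l z hz => ?_⟩
  have hz0 : z = 0 := hz
  subst hz0
  induction l generalizing F with
  | nil => exact (h 1).apply_zero
  | cons i l ih => exact ih (contDiff_pd i hF) fun N => (h (N + 1)).pd i

/-- A function that is smooth on a ball coincides with a globally smooth one on a smaller ball. -/
lemma exists_contDiff_eq_on_ball {F : Coord n → ℝ} {ρ : ℝ} (hρ : 0 < ρ)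
    (hF : ∀ x ∈ Metric.ball (0 : Coord n) ρ, ContDiffAt ℝ ∞ F x) :
    ∃ F' : Coord n → ℝ, ContDiff ℝ ∞ F' ∧ ∀ x ∈ Metric.ball (0 : Coord n) (ρ / 4), F' x = F x := by
  have hc : ContDiff ℝ ∞ fun x : Coord n => cutoff n ((2 / ρ) • x) :=
    contDiff_cutoff.comp (contDiff_const_smul _)
  have hnorm : ∀ x : Coord n, ‖(2 / ρ) • x‖ = 2 / ρ * ‖x‖ := fun x => by
    rw [norm_smul, Real.norm_of_nonneg (by positivity)]
  refine ⟨fun x => cutoff n ((2 / ρ) • x) * F x, contDiff_iff_contDiffAt.2 fun x => ?_,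
    fun x hx => ?_⟩
  · by_cases hx : x ∈ Metric.ball (0 : Coord n) ρ
    · exact hc.contDiffAt.mul (hF x hx)
    · rw [mem_ball_zero_iff, not_lt] at hx
      refine (contDiffAt_const (c := (0 : ℝ))).congr_of_eventuallyEq ?_
      filter_upwards [continuous_norm.continuousAt.eventually_const_lt
        (show ρ / 2 < ‖x‖ by linarith)] with y hy
      rw [cutoff_eq_zero, zero_mul]
      rw [hnorm, div_mul_eq_mul_div, le_div_iff₀ hρ]; linarith
  · rw [mem_ball_zero_iff] at hx
    simp only
    rw [cutoff_eq_one, one_mul]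
    rw [hnorm, div_mul_eq_mul_div, div_le_iff₀ hρ]; linarith

end

section

variable {n : ℕ}

/-! ### Exact harmonic coordinates -/

/-- The matrix of components of `dens G`. -/
def densMatrix (G : TensorField n) : TensorField n := fun x => √|(G x).det| • (G x)⁻¹

lemma densMatrix_apply (G : TensorField n) (μ ν : Fin (n + 1)) (x : Coord n) :
    densMatrix G x μ ν = dens G μ ν x := rfl

lemma contDiffAt_ent {G : TensorField n} {x : Coord n}
    (h : ∀ μ ν, ContDiffAt ℝ ∞ (fun z => G z μ ν) x) : ContDiffAt ℝ ∞ (fun z => ent (G z)) x :=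
  contDiffAt_pi.2 fun μ => contDiffAt_pi.2 fun ν => h μ ν

lemma contDiffAt_dens {G : TensorField n} {x : Coord n}
    (h : ∀ μ ν, ContDiffAt ℝ ∞ (fun z => G z μ ν) x) (hx : (G x).det ≠ 0) (μ ν : Fin (n + 1)) :
    ContDiffAt ℝ ∞ (dens G μ ν) x :=
  ContDiffAt.comp (g := fun M : Mat n => √|Matrix.det (Matrix.of M)| * (Matrix.of M)⁻¹ μ ν) x
    ((contDiffAt_sqrt_abs_det (M := ent (G x)) hx).mul (contDiffAt_matrix_inv hx μ ν))
    (contDiffAt_ent h)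

lemma continuousAt_det {G : TensorField n} {x : Coord n}
    (h : ∀ μ ν, ContDiffAt ℝ ∞ (fun z => G z μ ν) x) : ContinuousAt (fun z => (G z).det) x :=
  (contDiff_matrix_det.continuous.continuousAt).comp (contDiffAt_ent h).continuousAt

/-- A metric whose coordinates are harmonic to infinite order at the origin can be modified away
from the cone, to infinite order, into one whose coordinates are harmonic. -/
lemma exists_harmonic_of_flat (hn : 2 ≤ n) {G : TensorField n} {V : Set (Coord n)} (hV : IsOpen V)
    (hV0 : (0 : Coord n) ∈ V) (hGs : ∀ x ∈ V, ∀ μ ν, ContDiffAt ℝ ∞ (fun z => G z μ ν) x)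
    (hsymm : ∀ x ∈ V, (G x).IsSymm) (hG : NearEta G) (hharm : ∀ N ν, Ord N (harm G ν)) :
    ∃ (G' : TensorField n) (ρ : ℝ), 0 < ρ ∧ Metric.ball 0 ρ ⊆ V ∧
      IsLorentzMetricOn G' (Metric.ball 0 ρ) ∧
      (∀ x ∈ Metric.ball 0 ρ, x ∈ cone n → G' x = G x) ∧
      (∀ ν, ∀ x ∈ Metric.ball 0 ρ, harm G' ν x = 0) ∧ ∀ N, OrdT N fun x => G' x - G x := by
  obtain ⟨ρ₀, hρ₀, hball⟩ := Metric.eventually_nhds_iff_ball.1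
    ((hV.eventually_mem hV0).and hG.eventually_det_ne_zero)
  have hdens : ∀ x ∈ Metric.ball (0 : Coord n) ρ₀, ∀ μ ν, ContDiffAt ℝ ∞ (dens G μ ν) x :=
    fun x hx => contDiffAt_dens (hGs x (hball x hx).1) (hball x hx).2
  choose F hF hFG using fun ν => exists_contDiff_eq_on_ball hρ₀ (F := harm G ν) fun x hx =>
    ContDiffAt.sum fun μ _ => contDiffAt_pd μ (hdens x hx μ ν)
  have hFflat : ∀ ν, Flat (ContinuousLinearMap.id ℝ (Coord n)) (F ν) := fun ν =>
    flat_of_ord (hF ν) fun N => (hharm N ν).congr <| by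
      filter_upwards [Metric.ball_mem_nhds (0 : Coord n) (by positivity : 0 < ρ₀ / 4)] with x hx
      exact (hFG ν x hx).symm
  -- The harmonic condition is linear in the densitized inverse metric, so adding a tensor of
  -- divergence `-F` to that density removes the flat defect exactly rather than to leading order.
  obtain ⟨K, hK, hKsymm, hKcone, hKdiv⟩ := exists_divergence_eq (by omega)
    fun ν => (hFflat ν).neg
  set KM : TensorField n := fun x => Matrix.of fun μ ν => K μ ν x with hKM
  have hKO : ∀ N, OrdT N KM := fun N μ ν => (hK μ ν).ord N
  set D : TensorField n := fun x => densMatrix G x + KM x with hD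
  set G' : TensorField n := fun x => metricOfDens (D x) with hG'
  have hDapply : ∀ μ ν x, D x μ ν = dens G μ ν x + K μ ν x := fun μ ν x => rfl
  have hDs : ∀ x ∈ Metric.ball (0 : Coord n) ρ₀, ∀ μ ν, ContDiffAt ℝ ∞ (fun z => D z μ ν) x :=
    fun x hx μ ν => (hdens x hx μ ν).add (hK μ ν).1.contDiffAt
  have hDcone : ∀ x ∈ cone n, D x = densMatrix G x := by
    intro x hx
    ext μ ν
    rw [hDapply, hKcone μ ν x hx, add_zero, densMatrix_apply]
  have h0cone : (0 : Coord n) ∈ cone n := by simp [cone, bilin]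
  have hdens0 : densMatrix G 0 = eta n := by
    rw [densMatrix, hG.apply_zero, eta_det, eta_inv]; simp
  have h0ball : (0 : Coord n) ∈ Metric.ball (0 : Coord n) ρ₀ := Metric.mem_ball_self hρ₀
  have hD0 : D 0 = eta n := by rw [hDcone 0 h0cone, hdens0]
  have hGG : ∀ x ∈ Metric.ball (0 : Coord n) ρ₀, metricOfDens (densMatrix G x) = G x :=
    fun x hx => metricOfDens_dens hn (hball x hx).2
  have hGcone : ∀ x ∈ Metric.ball (0 : Coord n) ρ₀, x ∈ cone n → G' x = G x := fun x hx hxc => by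
    rw [hG']; simp only [hDcone x hxc, hGG x hx]
  have hDdet : ∀ᶠ x in 𝓝 (0 : Coord n), (D x).det ≠ 0 :=
    (continuousAt_det (hDs 0 h0ball)).eventually_ne (by rw [hD0]; exact eta_det_ne_zero)
  have hG's : ∀ x ∈ Metric.ball (0 : Coord n) ρ₀, (D x).det ≠ 0 →
      ∀ μ ν, ContDiffAt ℝ ∞ (fun z => G' z μ ν) x := fun x hx hdx μ ν =>
    ContDiffAt.comp (g := fun M : Mat n => metricOfDens (Matrix.of M) μ ν) x
      (contDiffAt_metricOfDens (M := ent (D x)) hdx μ ν) (contDiffAt_ent (hDs x hx))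
  have hG'cont : ContinuousAt (fun x => ent (G' x)) 0 :=
    (contDiffAt_ent (hG's 0 h0ball hDdet.self_of_nhds)).continuousAt
  have hG'0 : G' 0 = eta n := by rw [hGcone 0 h0ball h0cone, hG.apply_zero]
  have hG'symm : ∀ x ∈ V, (G' x).IsSymm := by
    intro x hx
    refine (Matrix.IsSymm.inv (Matrix.IsSymm.add ((hsymm x hx).inv.smul _) ?_)).smul _
    ext μ ν
    simp only [hKM, Matrix.transpose_apply, Matrix.of_apply, hKsymm]
  have hLor : ∀ᶠ x in 𝓝 (0 : Coord n), (G' x).IsSymm → IsLorentzMatrix (G' x) := by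
    have h1 := hG'cont.tendsto
    rw [hG'0] at h1
    exact h1.eventually eventually_isLorentzMatrix
  obtain ⟨ρ, hρ, hρball⟩ := Metric.eventually_nhds_iff_ball.1
    ((hDdet.and hLor).and (Metric.ball_mem_nhds (0 : Coord n) (by positivity : 0 < ρ₀ / 4)))
  have hsub : ∀ x ∈ Metric.ball (0 : Coord n) ρ, x ∈ Metric.ball (0 : Coord n) ρ₀ := fun x hx =>
    Metric.ball_subset_ball (by linarith) (hρball x hx).2
  refine ⟨G', ρ, hρ, fun x hx => (hball x (hsub x hx)).1, ⟨fun μ ν x hx => ?_, fun x hx => ?_⟩,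
    fun x hx => hGcone x (hsub x hx), fun ν x hx => ?_, fun N μ ν => ?_⟩
  · exact (hG's x (hsub x hx) (hρball x hx).1.1 μ ν).contDiffWithinAt
  · exact (hρball x hx).1.2 (hG'symm x (hball x (hsub x hx)).1)
  -- Near `x` the densitized inverse of `G'` is the corrected density, since `metricOfDens` is a
  -- right inverse of the passage to densities.
  · have hdensG' : ∀ μ, dens G' μ ν =ᶠ[𝓝 x] fun z => dens G μ ν z + K μ ν z := fun μ => by
      filter_upwards [Metric.isOpen_ball.mem_nhds hx] with z hz
      have := congrFun (congrFun (dens_metricOfDens hn (hρball z hz).1.1) μ) ν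
      rw [← hDapply]
      exact this
    have hpd : ∀ μ, pd μ (dens G' μ ν) x = pd μ (dens G μ ν) x + pd μ (K μ ν) x := fun μ => by
      rw [(pd_congr μ (hdensG' μ)).self_of_nhds]
      exact pd_add μ ((hdens x (hsub x hx) μ ν).differentiableAt (by simp))
        ((hK μ ν).differentiable x)
    have h1 : ∑ μ, pd μ (dens G μ ν) x = F ν x := (hFG ν x (hρball x hx).2).symm
    rw [harm, Finset.sum_congr rfl fun μ _ => hpd μ, Finset.sum_add_distrib, hKdiv, h1,
      add_neg_cancel]
  -- `G'` and `G` are the images, under one smooth map, of two densities that differ by the flat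
  -- tensor `K`.
  · have hu : ContDiffAt ℝ ∞ (fun x => ent (densMatrix G x)) 0 :=
      contDiffAt_ent fun μ ν => hdens 0 h0ball μ ν
    have hO : (fun x => ent (D x) - ent (densMatrix G x)) =O[𝓝 0] fun x => ‖x‖ ^ N := by
      refine (hKO N).isBigO.congr_left fun x => ?_
      funext i j
      simp [ent, hD]
    refine (ord_comp_sub (contDiffAt_metricOfDens (M := ent (eta n)) eta_det_ne_zero μ ν) hu
      (contDiffAt_ent (hDs 0 h0ball)) (congrArg ent hdens0) (congrArg ent hD0) hO).congr ?_
    filter_upwards [Metric.ball_mem_nhds (0 : Coord n) hρ₀] with x hx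
    simp only [of_ent, hGG x hx, hG', Matrix.sub_apply]

/-! ### Identity coordinates and the tensor induced on the cone. -/

lemma inCoords_ofSet {s : Set (Coord n)} (hs : IsOpen s) (G : TensorField n) :
    inCoords G (OpenPartialHomeomorph.ofSet s hs) = G := by
  funext z
  ext μ ν
  simp [inCoords, pd_coord]

lemma box_coord {G : TensorField n} {x : Coord n} (ν : Fin (n + 1)) :
    box G (fun z => z ν) x = (√|(G x).det|)⁻¹ * harm G ν x := by
  have : ∀ μ, (fun z => √|(G z).det| * ∑ a, (G z)⁻¹ μ a * pd a (fun z : Coord n => z ν) z) =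
      dens G μ ν := fun μ => by
    funext z
    simp [pd_coord, dens]
  simp only [box, this, harm]

lemma bilin_eta_eq_sum (x v : Coord n) : bilin (eta n) x v = ∑ μ, ev (xl μ) x * v μ := by
  simp [bilin, eta_apply, xl, ev_smul, ev_X]

lemma ev_sig (x : Coord n) : ev (sig n) x = bilin (eta n) x x := by
  simp [bilin, eta_apply, sig, ev_sum, ev_smul, ev_mul, ev_X, mul_assoc]

/-- Each term of the modification contains a factor `x_μ v^μ`, `x_ν w^ν` or `σ`, all of which vanish
for tangent vectors at a point of the cone. -/
lemma bilin_modifySmooth (g : TensorField n) (ξ : Fin (n + 1) → Coord n → ℝ)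
    (q : Fin (n + 1) → Fin (n + 1) → Coord n → ℝ) {x v w : Coord n} (hx : x ∈ cone n)
    (hv : bilin (eta n) x v = 0) (hw : bilin (eta n) x w = 0) :
    bilin (modifySmooth g ξ q x) v w = bilin (g x) v w := by
  have hσ : ev (sig n) x = 0 := (ev_sig x).trans hx
  rw [bilin_eta_eq_sum] at hv hw
  have h : bilin (modifySmooth g ξ q x) v w = bilin (g x) v w +
      (∑ μ, ev (xl μ) x * v μ) * (∑ ν, ξ ν x * w ν) +
      (∑ μ, ξ μ x * v μ) * (∑ ν, ev (xl ν) x * w ν) := by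
    simp only [bilin, Finset.sum_mul_sum, ← Finset.sum_add_distrib, modifySmooth, hσ]
    refine Finset.sum_congr rfl fun μ _ => Finset.sum_congr rfl fun ν _ => ?_
    simp only [Matrix.add_apply, Matrix.of_apply]
    ring
  rw [h, hv, hw, zero_mul, mul_zero, add_zero, add_zero]

end

end LightCone

end

/-! ### Proof of the theorem. -/

open LightCone

theorem lemma5p6 (n : ℕ) (hn : 2 ≤ n) (U : Set (LightCone.Coord n)) (hU : IsOpen U)
    (hU0 : (0 : LightCone.Coord n) ∈ U)
    (g : LightCone.TensorField n) (hg : LightCone.IsLorentzMetricOn g U)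
    (hcone : ∃ ε : ℝ, 0 < ε ∧ Metric.ball (0 : LightCone.Coord n) ε ⊆ U ∧
      LightCone.lightCone g (Metric.ball 0 ε) = LightCone.cone n ∩ Metric.ball 0 ε)
    (hg0 : ∀ α β, (fun x => g x α β - LightCone.eta n α β)
      =O[nhds (0 : LightCone.Coord n)] fun x => ‖x‖ ^ 2)
    (hg1 : ∀ σ α β, (fun x => LightCone.pd σ (fun z => g z α β) x)
      =O[nhds (0 : LightCone.Coord n)] fun x => ‖x‖)
    (ℓ : ℕ∞) :
    ∃ (gh : LightCone.TensorField n)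
      (y : OpenPartialHomeomorph (LightCone.Coord n) (LightCone.Coord n)),
      -- `y` is a smooth coordinate system near the origin, `gh` a smooth metric on its domain
      (0 : LightCone.Coord n) ∈ y.source ∧ y.source ⊆ U ∧
      ContDiffOn ℝ ∞ y y.source ∧ ContDiffOn ℝ ∞ y.symm y.target ∧
      LightCone.IsLorentzMetricOn gh y.source ∧
      -- the tensor induced on the light-cone is unchanged
      LightCone.InduceSameOnCone gh g y.source ∧
      -- the coordinates `y` coincide with the original ones on the light-cone
      (∀ x ∈ y.source ∩ LightCone.cone n, y x = x) ∧
      -- the coordinates `y` are harmonic for `gh`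
      (∀ μ, ∀ x ∈ y.source, LightCone.box gh (fun z => y z μ) x = 0) ∧
      -- the Ricci estimates hold in the coordinates `y`
      (∀ μ ν, LightCone.IsOrder (LightCone.ricci (LightCone.inCoords gh y) μ ν) (min ℓ 2)) ∧
      ∃ P : Fin (n + 1) → LightCone.Coord n → ℝ,
        (∀ μ, ContDiffOn ℝ ∞ (P μ) y.target) ∧
        ∀ μ, LightCone.IsOrder
          (fun z => (∑ ν, LightCone.ricci (LightCone.inCoords gh y) μ ν z * z ν) -
            P μ z * LightCone.bilin (LightCone.eta n) z z) (ℓ + 1) := by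
  have hgs : ∀ x ∈ U, ∀ μ ν, ContDiffAt ℝ ∞ (fun z => g z μ ν) x := fun x hx μ ν =>
    (hg.1 μ ν).contDiffAt (hU.mem_nhds hx)
  have hgnear : NearEta g := fun μ ν =>
    ⟨(hgs 0 hU0 μ ν).sub contDiffAt_const, hg0 μ ν⟩
  obtain ⟨ξ, q, P, hξ, hq, hqs, hP, hnear, hharm, hric, hricx⟩ := exists_formal_solution hn hgnear
    ((hU.eventually_mem hU0).mono fun x hx => (hg.2 x hx).1)
  set G := modifySmooth g ξ q with hG
  have hGs : ∀ x ∈ U, ∀ μ ν, ContDiffAt ℝ ∞ (fun z => G z μ ν) x := fun x hx μ ν =>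
    (hgs x hx μ ν).add ((((contDiff_ev _).mul (hξ ν)).add ((contDiff_ev _).mul (hξ μ))).add
      ((contDiff_ev _).mul (hq μ ν))).contDiffAt
  have hGsymm : ∀ x ∈ U, (G x).IsSymm := fun x hx => by
    refine Matrix.IsSymm.add (hg.2 x hx).1 ?_
    ext μ ν
    simp only [Matrix.transpose_apply, Matrix.of_apply, hqs ν μ]
    ring
  obtain ⟨G', ρ, hρ, hρU, hLor, hGcone, hG'harm, hGG'⟩ :=
    exists_harmonic_of_flat hn hU hU0 hGs hGsymm hnear hharm
  have hnear' : NearEta G' := fun μ ν => ((hnear μ ν).add (hGG' 2 μ ν)).congr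
    (Filter.Eventually.of_forall fun x => by simp only [Matrix.sub_apply]; ring)
  -- Passing to exact harmonic coordinates changes the Ricci tensor only by a flat term, so the
  -- estimates obtained for `G` carry over to `G'`.
  have hricsub : ∀ N μ ν, Ord N fun x => ricci G' μ ν x - ricci G μ ν x := fun N =>
    ord_ricci_sub_of_ord hnear hnear' (hGG' (N + 2))
  refine ⟨G', OpenPartialHomeomorph.ofSet (Metric.ball 0 ρ) Metric.isOpen_ball,
    Metric.mem_ball_self hρ, hρU, contDiffOn_id, contDiffOn_id, hLor, ?_, fun x _ => rfl, ?_, ?_,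
    P, fun μ => (hP μ).contDiffOn, ?_⟩
  · rintro x ⟨hx, hxc⟩ _ v w hv hw
    rw [hGcone x hx hxc, bilin_modifySmooth g ξ q hxc hv hw]
  · intro μ x hx
    have := box_coord (G := G') (x := x) μ
    rw [hG'harm μ x hx, mul_zero] at this
    exact this
  · intro μ ν N hN
    rw [inCoords_ofSet]
    have hN2 : N ≤ 2 := by exact_mod_cast hN.trans (min_le_right _ _)
    have h2 : Ord 2 (ricci G' μ ν) := ((hricsub 2 μ ν).add (hric μ ν)).congr
      (Filter.Eventually.of_forall fun x => by ring)
    exact (h2.mono hN2).2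
  -- The constraints hold to every finite order `N`, so no comparison of `N` with `ℓ + 1` is needed.
  · intro μ N _
    rw [inCoords_ofSet]
    have h1 : Ord N fun x => ∑ ν, (ricci G' μ ν x - ricci G μ ν x) * x ν :=
      Ord.sum fun ν _ => (hricsub N μ ν).mul_smooth (contDiff_coord ν).contDiffAt
    refine ((h1.add (hricx N μ)).congr (Filter.Eventually.of_forall fun x => ?_)).2
    simp only [sub_mul, Finset.sum_sub_distrib, ev_sig]
    ring
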